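/- Let $M$ be a smooth (Hausdorff) paracompact finite-dimensional manifold with a Poisson structure, i.e. a smooth bivector field $\alpha$, viewed as a skew family of maps $\alpha(x):T^*_xM\to T_xM$, such that $\{f,g\}=\langle df,\alpha\,dg\rangle$ satisfies the Jacobi identity on $C^\infty(M)$. Let $I=[0,1]$ and let $\mathcal C$ be the set of pairs $\hat X=(X,\eta)$, where $X:I\to M$ is continuously differentiable, $\eta=\eta_u\,du$ is a continuous $1$-form on $I$ with values in $X^*(T^*M)$, and $$dX(u)+\alpha(X(u))\,\eta(u)=0 .$$ For $\hat X\in\mathcal C$ and a continuously differentiable section $\beta$ of $X^*(T^*M)$ with $\beta(0)=\beta(1)=0$, the infinitesimal gauge transformation $\xi_\beta$ at $\hat X$ is the tangent vector to $\mathcal C$ given in local coordinates on $M$ by $$\xi_\beta X^i(u)=-\alpha^{ij}(X(u))\beta_j(u),\qquad \xi_\beta\eta_i(u)=d_u\beta_i(u)+\partial_i\alpha^{jk}(X(u))\,\eta_j(u)\beta_k(u).$$ Let $\mathcal G=\mathcal C/H$ be the space of leaves of the distribution on $\mathcal C$ spanned by the vectors $\xi_\beta$: two elements of $\mathcal C$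 lie on the same leaf if and only if they are joined by a piecewise continuously differentiable curve in $\mathcal C$ (with the $C^1$ topology on $X$ and the $C^0$ topology on $\eta$) that is tangent to this distribution. Write $[(X,\eta)]\in\mathcal G$ for the leaf of $(X,\eta)$. Call $(X,\eta)\in\mathcal C$ normalized if $\eta(0)=\eta(1)=0$. Then: 1. Every class in $\mathcal G$ has a normalized representative, and every class has a representative $(X,\eta)$ with $X$ and $\eta$ smooth ($C^\infty$). 2. The following are well defined on $\mathcal G$: the maps $l,r:\mathcal G\to M$, $l[(X,\eta)]=X(0)$, $r[(X,\eta)]=X(1)$; the inversion $[(X,\eta)]^{-1}=[(X\circ\theta,\theta^*\eta)]$ with $\theta(u)=1-u$; and the composition $g\bullet h$, for $r(g)=l(h)$, which is the class of the concatenation $$X(u)=\begin{cases}X_1(2u)\\X_2(2u-1)\end{cases}\qquad \eta(u)=\begin{cases}2\,\eta_{1u}(2u)\,du,&0\le u\le\tfrac12,\\2\,\eta_{2u}(2u-1)\,du,&\tfrac12\le u\le1,\end{cases}$$ of normalized representatives $(X_1,\eta_1)$ of $g$ and $(X_2,\eta_2)$ of $h$, and does not depend on the choice of these. 3. With $j(x)$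 the class of the constant solution $X(u)=x$, $\eta=0$, the set $\mathcal G$ is a groupoid over $M$. Writing $\mathcal G_{x,y}=l^{-1}(x)\cap r^{-1}(y)$: (i) $l\circ j=r\circ j=\mathrm{id}_M$; (ii) $g\bullet h\in\mathcal G_{x,z}$ if $g\in\mathcal G_{x,y}$ and $h\in\mathcal G_{y,z}$; (iii) $j(x)\bullet g=g\bullet j(y)=g$ if $g\in\mathcal G_{x,y}$; (iv) if $g\in\mathcal G_{x,y}$ then $g^{-1}\in\mathcal G_{y,x}$, $g\bullet g^{-1}=j(x)$ and $g^{-1}\bullet g=j(y)$; (v) $(g\bullet h)\bullet k=g\bullet(h\bullet k)$ whenever $r(g)=l(h)$ and $r(h)=l(k)$. -/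

import Mathlib

open Set Topology Bundle
open scoped Manifold ContDiff unitInterval

noncomputable section

namespace PoissonSigma

section Poisson

variable {E : Type*} [NormedAddCommGroup E] [NormedSpace ℝ E]
variable {M : Type*} [TopologicalSpace M] [ChartedSpace E M]

/-- The cotangent space `T*ₓM`. -/
abbrev CoTangent (E : Type*) [NormedAddCommGroup E] [NormedSpace ℝ E]
    {M : Type*} [TopologicalSpace M] [ChartedSpace E M] (x : M) : Type _ :=
  TangentSpace 𝓘(ℝ, E) x →L[ℝ] ℝ

/-- The bracket `{f, g}(x) = α(df, dg)(x) = ⟨df(x), α(x) dg(x)⟩` of a bivector field `α`,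
viewed as a family of linear maps `α(x) : T*ₓM → TₓM`. -/
def bracket (α : ∀ x : M, CoTangent E x →L[ℝ] TangentSpace 𝓘(ℝ, E) x) (f g : M → ℝ) : M → ℝ :=
  fun x => (mfderiv 𝓘(ℝ, E) 𝓘(ℝ, ℝ) f x : CoTangent E x)
    (α x (mfderiv 𝓘(ℝ, E) 𝓘(ℝ, ℝ) g x : CoTangent E x))

variable [IsManifold 𝓘(ℝ, E) ∞ M]

/-- The matrix `(αⁱʲ)` of a bivector field in the chart centred at `c`, as a map
`(ℝⁿ)* → ℝⁿ` depending on the coordinate vector `y`. -/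
def coordBivector (α : ∀ x : M, CoTangent E x →L[ℝ] TangentSpace 𝓘(ℝ, E) x) (c : M) (y : E) :
    (E →L[ℝ] ℝ) →L[ℝ] E :=
  let x := (extChartAt 𝓘(ℝ, E) c).symm y
  let T : TangentSpace 𝓘(ℝ, E) x →L[ℝ] E :=
    (trivializationAt E (TangentSpace 𝓘(ℝ, E)) c).continuousLinearMapAt ℝ x
  T ∘L (α x) ∘L ContinuousLinearMap.precomp ℝ T

variable (E M) in
/-- A Poisson structure on `M`: a smooth bivector field `α`, viewed as a skew family of maps
`α(x) : T*ₓM → TₓM`, whose bracket of functions satisfies the Jacobi identity. -/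
structure PoissonStructure where
  /-- the map `α(x) : T*ₓM → TₓM` -/
  toMap : ∀ x : M, CoTangent E x →L[ℝ] TangentSpace 𝓘(ℝ, E) x
  skew : ∀ (x : M) (ξ ζ : CoTangent E x), ξ (toMap x ζ) = -ζ (toMap x ξ)
  smooth : ∀ c : M, ContDiffOn ℝ ∞ (coordBivector toMap c) (extChartAt 𝓘(ℝ, E) c).target
  jacobi : ∀ f g h : M → ℝ, ContMDiff 𝓘(ℝ, E) 𝓘(ℝ, ℝ) ∞ f → ContMDiff 𝓘(ℝ, E) 𝓘(ℝ, ℝ) ∞ g →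
    ContMDiff 𝓘(ℝ, E) 𝓘(ℝ, ℝ) ∞ h → ∀ x : M,
      bracket toMap f (bracket toMap g h) x + bracket toMap g (bracket toMap h f) x +
        bracket toMap h (bracket toMap f g) x = 0

variable (E M) in
/-- The cotangent bundle `T*M`. -/
abbrev CoTangentBundle : Type _ :=
  TotalSpace (E →L[ℝ] ℝ) (fun x : M => TangentSpace 𝓘(ℝ, E) x →L[ℝ] ℝ)

/-- The components `(p₁, …, pₙ)`, in the chart centred at `c`, of a covector `p` whose base point
lies in the domain of that chart. -/
def coordCovector (c : M) (p : CoTangentBundle E M) : E →L[ℝ] ℝ :=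
  p.2 ∘L (trivializationAt E (TangentSpace 𝓘(ℝ, E)) c).symmL ℝ p.1

/-- Multiplication of covectors by a real number. -/
def scale (r : ℝ) (p : CoTangentBundle E M) : CoTangentBundle E M := ⟨p.1, r • p.2⟩

theorem continuous_scale (r : ℝ) : Continuous (scale r : CoTangentBundle E M → _) := by
  rw [continuous_iff_continuousAt]
  intro p
  have h := (FiberBundle.continuousAt_totalSpace (E →L[ℝ] ℝ)
    (E := fun x : M => TangentSpace 𝓘(ℝ, E) x →L[ℝ] ℝ) id (x₀ := p)).1 continuousAt_id
  refine (FiberBundle.continuousAt_totalSpace _ _).2 ⟨h.1, ?_⟩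
  refine (h.2.const_smul r).congr ?_
  have hb : ∀ᶠ q in 𝓝 p, q.1 ∈ (trivializationAt (E →L[ℝ] ℝ)
    (fun x : M => TangentSpace 𝓘(ℝ, E) x →L[ℝ] ℝ) p.1).baseSet :=
    h.1 ((trivializationAt (E →L[ℝ] ℝ)
    (fun x : M => TangentSpace 𝓘(ℝ, E) x →L[ℝ] ℝ) p.1).open_baseSet.mem_nhds
      (FiberBundle.mem_baseSet_trivializationAt' _))
  filter_upwards [hb] with q hq
  exact (((trivializationAt (E →L[ℝ] ℝ)
    (fun x : M => TangentSpace 𝓘(ℝ, E) x →L[ℝ] ℝ) p.1).linear ℝ hq).map_smul r q.2).symm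

/-- `t ↦ X̂(t)` for a map `X̂` on `I = [0,1]`, extended by constants to all real `t`. -/
abbrev ext01 {Y : Type*} (f : I → Y) : ℝ → Y := fun t => f (projIcc 0 1 zero_le_one t)

/-- The constraint manifold `𝒞`: continuous bundle morphisms `X̂ = (X, η) : TI → T*M` with
`dX + α(X) η = 0`. A morphism is recorded by `u ↦ (X(u), η_u(u)) ∈ T*M` where `η = η_u du`;
the constraint makes `X` continuously differentiable, as `u ↦ α(X(u)) η_u(u)` is continuous. -/
structure Constraint (α : PoissonStructure E M) where
  /-- the map `u ↦ (X(u), η_u(u))` -/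
  toMap : C(I, CoTangentBundle E M)
  gauss : ∀ t ∈ Icc (0 : ℝ) 1,
    HasMFDerivWithinAt 𝓘(ℝ, ℝ) 𝓘(ℝ, E) (fun τ => (ext01 toMap τ).proj) (Icc 0 1) t
      ((1 : ℝ →L[ℝ] ℝ).smulRight (-(α.toMap _ (ext01 toMap t).2)))

namespace Constraint

variable {α : PoissonStructure E M}

/-- The initial point `l(X, η) = X(0)`. -/
def left (P : Constraint α) : M := (P.toMap 0).proj

/-- The final point `r(X, η) = X(1)`. -/
def right (P : Constraint α) : M := (P.toMap 1).proj

/-- `η` vanishes at both endpoints. -/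
def Normalized (P : Constraint α) : Prop := (P.toMap 0).2 = 0 ∧ (P.toMap 1).2 = 0

/-- Both `X` and `η` are smooth on the closed interval. -/
def Smooth (P : Constraint α) : Prop :=
  ContMDiffOn 𝓘(ℝ, ℝ) (𝓘(ℝ, E).prod 𝓘(ℝ, E →L[ℝ] ℝ)) ∞ (ext01 P.toMap) (Icc 0 1)

variable (α) in
/-- The constant solution `X(u) = x`, `η(u) = 0`. -/
def const (x : M) : Constraint α where
  toMap := ContinuousMap.const _ ⟨x, 0⟩
  gauss t _ := by
    have h : (ContinuousLinearMap.smulRight (1 : ℝ →L[ℝ] ℝ)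
        (-(α.toMap x (0 : CoTangent E x)))) = 0 := by
      ext; simp
    exact (hasMFDerivWithinAt_const x _ t).congr_mfderiv h.symm

theorem gauss_comp (P : Constraint α) (a b : ℝ) (s : Set ℝ) (t : ℝ) (ht : t ∈ s)
    (hs : ∀ τ ∈ s, a * τ + b ∈ Icc (0 : ℝ) 1) :
    HasMFDerivWithinAt 𝓘(ℝ, ℝ) 𝓘(ℝ, E) (fun τ => (ext01 P.toMap (a * τ + b)).proj) s t
      ((1 : ℝ →L[ℝ] ℝ).smulRight (-(α.toMap _ (scale a (ext01 P.toMap (a * t + b))).2))) := by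
  have h0 : HasFDerivWithinAt (fun τ : ℝ => a * τ + b) ((1 : ℝ →L[ℝ] ℝ).smulRight a) s t := by
    have := (((hasDerivAt_id t).const_mul a).add_const b).hasDerivWithinAt (s := s)
    exact this.hasFDerivWithinAt.congr_fderiv (by ext; simp)
  have h2 := HasMFDerivWithinAt.comp (u := Icc (0 : ℝ) 1) t (P.gauss _ (hs t ht))
    h0.hasMFDerivWithinAt hs
  refine h2.congr_mfderiv ?_
  refine ContinuousLinearMap.ext fun (r : ℝ) => ?_
  change ((r * a : ℝ) • (-(α.toMap (ext01 P.toMap (a * t + b)).proj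
      (ext01 P.toMap (a * t + b)).2)) : TangentSpace 𝓘(ℝ, E) (ext01 P.toMap (a * t + b)).proj) =
    (r • (-(α.toMap (ext01 P.toMap (a * t + b)).proj (a • (ext01 P.toMap (a * t + b)).2))))
  rw [map_smul, mul_smul, smul_neg a]

theorem gauss_of_eqOn (P : Constraint α) (a b : ℝ) (s : Set ℝ) (t : ℝ) (ht : t ∈ s)
    (hs : ∀ τ ∈ s, a * τ + b ∈ Icc (0 : ℝ) 1) (f : ℝ → CoTangentBundle E M)
    (hf : ∀ τ ∈ s, f τ = scale a (ext01 P.toMap (a * τ + b))) :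
    HasMFDerivWithinAt 𝓘(ℝ, ℝ) 𝓘(ℝ, E) (fun τ => (f τ).proj) s t
      ((1 : ℝ →L[ℝ] ℝ).smulRight (-(α.toMap _ (f t).2))) := by
  have h := P.gauss_comp a b s t ht hs
  have h' := h.congr_mono (t := s) (f₁ := fun τ => (f τ).proj)
    (fun τ hτ => by rw [hf τ hτ]; rfl) (by rw [hf t ht]; rfl) subset_rfl
  rw [hf t ht]
  exact h'

/-- The reversed solution `(X ∘ θ, θ*η)`, where `θ(u) = 1 - u`; note `θ*(du) = -du`. -/
def reverse (P : Constraint α) : Constraint α where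
  toMap := ⟨fun u => scale (-1) (P.toMap (σ u)),
    (continuous_scale _).comp (P.toMap.continuous.comp unitInterval.continuous_symm)⟩
  gauss t ht := by
    refine P.gauss_of_eqOn (-1) 1 (Icc 0 1) t ht
      (fun τ hτ => by constructor <;> linarith [hτ.1, hτ.2]) _ (fun τ hτ => ?_)
    have : σ (projIcc 0 1 zero_le_one τ) = projIcc 0 1 zero_le_one (-1 * τ + 1) := by
      apply Subtype.ext
      rw [unitInterval.coe_symm_eq, projIcc_of_mem _ hτ, projIcc_of_mem _ (by
        constructor <;> linarith [hτ.1, hτ.2])]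
      ring
    simp only [ext01, ContinuousMap.coe_mk, this]

theorem continuous_ext01 (P : Constraint α) : Continuous (ext01 P.toMap) :=
  P.toMap.continuous.comp continuous_projIcc

/-- The map `u ↦ (X₁(2u), 2η₁(2u))` for `u ≤ 1/2`, `u ↦ (X₂(2u-1), 2η₂(2u-1))` for `u ≥ 1/2`. -/
def concatMap (P Q : Constraint α) (t : ℝ) : CoTangentBundle E M :=
  if t ≤ 1 / 2 then scale 2 (ext01 P.toMap (2 * t)) else scale 2 (ext01 Q.toMap (2 * t - 1))

theorem concat_junction (P Q : Constraint α) (hP : P.Normalized) (hQ : Q.Normalized)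
    (h : P.right = Q.left) : P.toMap 1 = Q.toMap 0 := by
  obtain ⟨-, h1⟩ := hP
  obtain ⟨h2, -⟩ := hQ
  unfold right left at h
  generalize P.toMap 1 = p at *
  generalize Q.toMap 0 = q at *
  obtain ⟨x, ξ⟩ := p
  obtain ⟨y, ζ⟩ := q
  change x = y at h
  subst h
  change ξ = 0 at h1
  change ζ = 0 at h2
  rw [h1, h2]

theorem concatMap_of_le (P Q : Constraint α) {t : ℝ} (ht : t ≤ 1 / 2) :
    concatMap P Q t = scale 2 (ext01 P.toMap (2 * t)) := if_pos ht

theorem concatMap_of_ge (P Q : Constraint α) (hP : P.Normalized) (hQ : Q.Normalized)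
    (h : P.right = Q.left) {t : ℝ} (ht : 1 / 2 ≤ t) :
    concatMap P Q t = scale 2 (ext01 Q.toMap (2 * t - 1)) := by
  rcases ht.eq_or_lt with rfl | ht
  · rw [concatMap_of_le P Q le_rfl]
    have h1 : ext01 P.toMap (2 * (1 / 2)) = P.toMap 1 := by
      simp only [ext01]; norm_num
    have h2 : ext01 Q.toMap (2 * (1 / 2) - 1) = Q.toMap 0 := by
      simp only [ext01]; norm_num
    rw [h1, h2, concat_junction P Q hP hQ h]
  · exact if_neg (not_le.2 ht)

theorem continuous_concatMap (P Q : Constraint α) (hP : P.Normalized) (hQ : Q.Normalized)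
    (h : P.right = Q.left) : Continuous (concatMap P Q) := by
  refine Continuous.if_le ?_ ?_ continuous_id continuous_const ?_
  · exact (continuous_scale _).comp (P.continuous_ext01.comp (by fun_prop))
  · exact (continuous_scale _).comp (Q.continuous_ext01.comp (by fun_prop))
  · rintro t ht
    have ht : t = 1 / 2 := ht
    rw [← concatMap_of_le P Q ht.le, concatMap_of_ge P Q hP hQ h ht.ge]

/-- The concatenation of two solutions whose one-forms vanish at the endpoints. -/
def concat (P Q : Constraint α) (hP : P.Normalized) (hQ : Q.Normalized)
    (h : P.right = Q.left) : Constraint α where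
  toMap := ⟨fun u => concatMap P Q u,
    (continuous_concatMap P Q hP hQ h).comp continuous_subtype_val⟩
  gauss t ht := by
    set f : ℝ → CoTangentBundle E M := ext01 (fun u : I => concatMap P Q u) with hf
    have hfeq : ∀ τ ∈ Icc (0 : ℝ) 1, f τ = concatMap P Q τ := fun τ hτ => by
      simp only [hf, ext01, projIcc_of_mem _ hτ]
    change HasMFDerivWithinAt 𝓘(ℝ, ℝ) 𝓘(ℝ, E) (fun τ => (f τ).proj) (Icc 0 1) t
      ((1 : ℝ →L[ℝ] ℝ).smulRight (-(α.toMap _ (f t).2)))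
    have hL : t ≤ 1 / 2 → HasMFDerivWithinAt 𝓘(ℝ, ℝ) 𝓘(ℝ, E) (fun τ => (f τ).proj)
        (Icc 0 (1 / 2)) t ((1 : ℝ →L[ℝ] ℝ).smulRight (-(α.toMap _ (f t).2))) := fun h2 =>
      P.gauss_of_eqOn 2 0 (Icc 0 (1 / 2)) t ⟨ht.1, h2⟩
        (fun τ hτ => by constructor <;> linarith [hτ.1, hτ.2]) f
        (fun τ hτ => by
          rw [hfeq τ ⟨hτ.1, by linarith [hτ.2]⟩, concatMap_of_le P Q hτ.2, add_zero])
    have hR : 1 / 2 ≤ t → HasMFDerivWithinAt 𝓘(ℝ, ℝ) 𝓘(ℝ, E) (fun τ => (f τ).proj)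
        (Icc (1 / 2) 1) t ((1 : ℝ →L[ℝ] ℝ).smulRight (-(α.toMap _ (f t).2))) := fun h2 =>
      Q.gauss_of_eqOn 2 (-1) (Icc (1 / 2) 1) t ⟨h2, ht.2⟩
        (fun τ hτ => by constructor <;> linarith [hτ.1, hτ.2]) f
        (fun τ hτ => by
          rw [hfeq τ ⟨by linarith [hτ.1], hτ.2⟩, concatMap_of_ge P Q hP hQ h hτ.1,
            sub_eq_add_neg])
    have hU : Icc (0 : ℝ) 1 = Icc 0 (1 / 2) ∪ Icc (1 / 2) 1 :=
      (Icc_union_Icc_eq_Icc (by norm_num) (by norm_num)).symm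
    rcases lt_trichotomy t (1 / 2) with h2 | h2 | h2
    · refine (hL h2.le).mono_of_mem_nhdsWithin ?_
      filter_upwards [self_mem_nhdsWithin, nhdsWithin_le_nhds (Iio_mem_nhds h2)] with τ h3 h4
      exact ⟨h3.1, le_of_lt h4⟩
    · rw [hU]
      exact (hL h2.le).union (hR h2.ge)
    · refine (hR h2.le).mono_of_mem_nhdsWithin ?_
      filter_upwards [self_mem_nhdsWithin, nhdsWithin_le_nhds (Ioi_mem_nhds h2)] with τ h3 h4
      exact ⟨le_of_lt h4, h3.2⟩

end Constraint

/-- `Γ` is a curve in `𝒞` with parameter `s ∈ [0,1]`, continuously differentiable, and tangent at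
every `s` to the distribution spanned by the infinitesimal gauge transformations `ξ_β`, where
`β ∈ C¹₀(I, X*(T*M))`: there, in every chart, the velocity `∂ₛ Γ(s) = ξ_{β(s)}(Γ(s))` reads
`∂ₛ Xⁱ = -αⁱʲ(X) βⱼ` and `∂ₛ ηᵢ = ∂ᵤ βᵢ + ∂ᵢαʲᵏ(X) ηⱼ βₖ`.
The parameter `β(s)` is continuous in `s` for the `C¹` topology. -/
structure IsGaugeCurve {α : PoissonStructure E M} (Γ : ℝ → Constraint α)
    (β : ℝ → ℝ → CoTangentBundle E M) : Prop where
  continuousOn_curve :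
    ContinuousOn (fun p : ℝ × ℝ => ext01 (Γ p.1).toMap p.2) (Icc 0 1 ×ˢ Icc 0 1)
  continuousOn_param : ContinuousOn (fun p : ℝ × ℝ => β p.1 p.2) (Icc 0 1 ×ˢ Icc 0 1)
  proj_param : ∀ s ∈ Icc (0 : ℝ) 1, ∀ u ∈ Icc (0 : ℝ) 1,
    (β s u).proj = (ext01 (Γ s).toMap u).proj
  param_zero : ∀ s ∈ Icc (0 : ℝ) 1, (β s 0).2 = 0
  param_one : ∀ s ∈ Icc (0 : ℝ) 1, (β s 1).2 = 0
  differentiable_param : ∀ c : M, ∀ s ∈ Icc (0 : ℝ) 1, ∀ u ∈ Icc (0 : ℝ) 1,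
    (ext01 (Γ s).toMap u).proj ∈ (chartAt E c).source →
      DifferentiableWithinAt ℝ (fun v => coordCovector c (β s v)) (Icc 0 1) u
  continuousOn_deriv_param : ∀ c : M,
    ContinuousOn
      (fun p : ℝ × ℝ => derivWithin (fun v => coordCovector c (β p.1 v)) (Icc 0 1) p.2)
      {p | p ∈ Icc (0 : ℝ) 1 ×ˢ Icc (0 : ℝ) 1 ∧
        (ext01 (Γ p.1).toMap p.2).proj ∈ (chartAt E c).source}
  velocity_base : ∀ c : M, ∀ s ∈ Icc (0 : ℝ) 1, ∀ u ∈ Icc (0 : ℝ) 1,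
    (ext01 (Γ s).toMap u).proj ∈ (chartAt E c).source →
      HasDerivWithinAt (fun r => extChartAt 𝓘(ℝ, E) c (ext01 (Γ r).toMap u).proj)
        (-(coordBivector α.toMap c (extChartAt 𝓘(ℝ, E) c (ext01 (Γ s).toMap u).proj)
          (coordCovector c (β s u)))) (Icc 0 1) s
  velocity_form : ∀ c : M, ∀ s ∈ Icc (0 : ℝ) 1, ∀ u ∈ Icc (0 : ℝ) 1,
    (ext01 (Γ s).toMap u).proj ∈ (chartAt E c).source →
      HasDerivWithinAt (fun r => coordCovector c (ext01 (Γ r).toMap u))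
        (derivWithin (fun v => coordCovector c (β s v)) (Icc 0 1) u +
          (coordCovector c (ext01 (Γ s).toMap u)) ∘L
            ((fderiv ℝ (coordBivector α.toMap c)
              (extChartAt 𝓘(ℝ, E) c (ext01 (Γ s).toMap u).proj)).flip (coordCovector c (β s u))))
        (Icc 0 1) s

/-- Two solutions are joined by a continuously differentiable curve in `𝒞` tangent to the
distribution of infinitesimal gauge transformations. -/
def GaugeRelated {α : PoissonStructure E M} (P Q : Constraint α) : Prop :=
  ∃ (Γ : ℝ → Constraint α) (β : ℝ → ℝ → CoTangentBundle E M),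
    IsGaugeCurve Γ β ∧ Γ 0 = P ∧ Γ 1 = Q

/-- Lying on the same leaf of the foliation by integral manifolds of the distribution, i.e. on
the same orbit of the gauge group `H`: being joined by a finite chain of gauge curves. -/
def leafSetoid (α : PoissonStructure E M) : Setoid (Constraint α) :=
  Relation.EqvGen.setoid GaugeRelated

/-- The phase space `𝒢 = 𝒞/H`: the space of leaves. -/
def PhaseSpace (α : PoissonStructure E M) : Type _ := Quotient (leafSetoid α)

/-- The class `[(X, η)]` in `𝒢`. -/
def PhaseSpace.mk {α : PoissonStructure E M} (P : Constraint α) : PhaseSpace α :=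
  Quotient.mk (leafSetoid α) P

/-- The groupoid axioms for units `j`, source `l`, target `r`, an inversion and a partial
composition law defined on the pairs with `r g = l h`. -/
structure IsGroupoid {X G : Type*} (j : X → G) (l r : G → X) (inv : G → G)
    (comp : ∀ g h : G, r g = l h → G) : Prop where
  unit_left : ∀ x, l (j x) = x
  unit_right : ∀ x, r (j x) = x
  comp_left : ∀ g h (p : r g = l h), l (comp g h p) = l g
  comp_right : ∀ g h (p : r g = l h), r (comp g h p) = r h
  unit_comp : ∀ g (p : r (j (l g)) = l g), comp (j (l g)) g p = g
  comp_unit : ∀ g (p : r g = l (j (r g))), comp g (j (r g)) p = g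
  inv_left : ∀ g, l (inv g) = r g
  inv_right : ∀ g, r (inv g) = l g
  comp_inv : ∀ g (p : r g = l (inv g)), comp g (inv g) p = j (l g)
  inv_comp : ∀ g (p : r (inv g) = l g), comp (inv g) g p = j (r g)
  assoc : ∀ g h k (p : r g = l h) (q : r h = l k) (p' : r (comp g h p) = l k)
    (q' : r g = l (comp h k q)), comp (comp g h p) k p' = comp g (comp h k q) q'

end Poisson

end PoissonSigma

end

open PoissonSigma

/-! Units, inverses and composition only involve pulling solutions back by maps of the interval, so
the groupoid laws are those of paths up to reparametrization. Two facts carry them. First, two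
pullbacks of a smooth solution by maps ρ₀, ρ₁ of [0,1] with the same end values lie on one leaf:
along the convex homotopy φₛ from ρ₀ to ρ₁ the velocity is the gauge transformation with parameter
(ρ₁ - ρ₀) η(φₛ), because the quadratic term vanishes by skewness
(`Constraint.Smooth.gaugeRelated_reparam`). Second, every leaf contains a smooth solution
(`exists_smooth_representative`); this is needed because a gauge parameter has to be C¹ whereas η is
only continuous.

Pullback by a map that sends end points to end points carries gauge curves to gauge curves, so the
first fact extends to the classes of all solutions (`PhaseSpace.mk_reparam_eq`). Pullback by a map
constant near 0 and near 1 then provides normalized representatives and lets gauge curves be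
concatenated (`GaugeSquare.glue`). Associativity and the unit laws become equalities of pullbacks of
one solution. A path followed by its reverse is a pullback by a map vanishing at both ends, which is
homotopic to a constant map.

Smooth representatives are built in charts. Let A be the matrix of the bivector field and g the
components of η on an interval [a,b] mapped to a chart. For a variation δ one solves, for each s,
the system x' = -A(x)(g + sδ), β' = δ - ⟨g + sδ, DA(x)β⟩, with x(a) fixed and β(a) = 0. The implicit
function theorem on continuous paths gives smooth dependence on s, the linearized equation being a
Volterra equation (`exists_smooth_solution`). By the Jacobi identity W = ∂ₛx + A(x)β solves a
homogeneous linear equation with W(a) = 0, hence ∂ₛx = -A(x)β: varying η along δ is a gauge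
transformation (`gaugeFamily_of_curve`). As β need not vanish at b, s is replaced by sκ(u) with a
cutoff κ, which changes the form into g + sκδ + sκ'β and leaves the solution alone where κ vanishes
(`exists_gaugeRelated_moved`). The choice δ = -g makes η vanish near the nodes of a subdivision;
then taking g + δ smooth makes the solution smooth on each piece (`Constraint.exists_smooth_piece`).

All gauge equations are checked near each point in a single chart; `GaugeEq.change` shows that the
choice of chart is immaterial. -/

open Set Topology Bundle
open scoped Manifold ContDiff unitInterval

set_option linter.unusedSectionVars false
set_option synthInstance.maxHeartbeats 200000

universe u

noncomputable section

namespace PoissonSigma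

/-! ### Solutions and covectors in a chart. -/

section Coordinates

variable {E : Type*} [NormedAddCommGroup E] [NormedSpace ℝ E]
variable {M : Type*} [TopologicalSpace M] [ChartedSpace E M] [IsManifold 𝓘(ℝ, E) ∞ M]

/-- The isomorphism `TₓM → E` given by the chart centred at `c`. -/
def frame (c x : M) : TangentSpace 𝓘(ℝ, E) x →L[ℝ] E :=
  (trivializationAt E (TangentSpace 𝓘(ℝ, E)) c).continuousLinearMapAt ℝ x

/-- The inverse `E → TₓM` of `frame`. -/
def coframe (c x : M) : E →L[ℝ] TangentSpace 𝓘(ℝ, E) x :=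
  (trivializationAt E (TangentSpace 𝓘(ℝ, E)) c).symmL ℝ x

theorem coframe_frame {c x : M} (hx : x ∈ (chartAt E c).source) (v : TangentSpace 𝓘(ℝ, E) x) :
    coframe c x (frame c x v) = v :=
  Trivialization.symmL_continuousLinearMapAt _ (by simpa using hx) v

theorem frame_coframe {c x : M} (hx : x ∈ (chartAt E c).source) (v : E) :
    frame c x (coframe c x v) = v :=
  Trivialization.continuousLinearMapAt_symmL _ (by simpa using hx) v

theorem frame_eq_mfderiv {c x : M} (hx : x ∈ (chartAt E c).source) :
    frame (E := E) c x = mfderiv 𝓘(ℝ, E) 𝓘(ℝ, E) (extChartAt 𝓘(ℝ, E) c) x :=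
  TangentBundle.continuousLinearMapAt_trivializationAt hx

theorem coframe_eq_mfderivWithin {c x : M} (hx : x ∈ (chartAt E c).source) :
    coframe (E := E) c x = mfderivWithin 𝓘(ℝ, E) 𝓘(ℝ, E) (extChartAt 𝓘(ℝ, E) c).symm
      (range 𝓘(ℝ, E)) (extChartAt 𝓘(ℝ, E) c x) :=
  TangentBundle.symmL_trivializationAt hx

theorem symm_extChartAt {c x : M} (hx : x ∈ (chartAt E c).source) :
    (extChartAt 𝓘(ℝ, E) c).symm (extChartAt 𝓘(ℝ, E) c x) = x :=
  (extChartAt 𝓘(ℝ, E) c).left_inv (by simpa using hx)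

theorem coordCovector_apply (c : M) (p : CoTangentBundle E M) (v : E) :
    coordCovector c p v = p.2 (coframe c p.1 v) := rfl

theorem coordCovector_scale (c : M) (r : ℝ) (p : CoTangentBundle E M) :
    coordCovector c (scale r p) = r • coordCovector c p := rfl

theorem coordCovector_of_snd_eq_zero (c : M) {p : CoTangentBundle E M} (h : p.2 = 0) :
    coordCovector c p = 0 := by
  ext v; rw [coordCovector_apply, h]; rfl

theorem coordBivector_apply (α : ∀ x : M, CoTangent E x →L[ℝ] TangentSpace 𝓘(ℝ, E) x) {c x : M}
    (hx : x ∈ (chartAt E c).source) (ξ : E →L[ℝ] ℝ) :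
    coordBivector α c (extChartAt 𝓘(ℝ, E) c x) ξ = frame c x (α x (ξ ∘L frame c x)) := by
  unfold coordBivector
  rw [symm_extChartAt hx]
  rfl

/-- The covector with base point of coordinates `y` and components `ξ` in the chart centred
at `c`. -/
def ofCoord (c : M) (y : E) (ξ : E →L[ℝ] ℝ) : CoTangentBundle E M :=
  ⟨(extChartAt 𝓘(ℝ, E) c).symm y, ξ ∘L frame c _⟩

theorem ofCoord_proj (c : M) (y : E) (ξ : E →L[ℝ] ℝ) :
    (ofCoord c y ξ).proj = (extChartAt 𝓘(ℝ, E) c).symm y := rfl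

theorem symm_mem_source {c : M} {y : E} (hy : y ∈ (extChartAt 𝓘(ℝ, E) c).target) :
    (extChartAt 𝓘(ℝ, E) c).symm y ∈ (chartAt E c).source := by
  simpa using (extChartAt 𝓘(ℝ, E) c).map_target hy

theorem extChartAt_mem_target {c x : M} (hx : x ∈ (chartAt E c).source) :
    extChartAt 𝓘(ℝ, E) c x ∈ (extChartAt 𝓘(ℝ, E) c).target :=
  (extChartAt 𝓘(ℝ, E) c).map_source (by simpa using hx)

theorem extChartAt_ofCoord {c : M} {y : E} (hy : y ∈ (extChartAt 𝓘(ℝ, E) c).target)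
    (ξ : E →L[ℝ] ℝ) : extChartAt 𝓘(ℝ, E) c (ofCoord c y ξ).proj = y :=
  (extChartAt 𝓘(ℝ, E) c).right_inv hy

theorem coordCovector_ofCoord {c : M} {y : E} (hy : y ∈ (extChartAt 𝓘(ℝ, E) c).target)
    (ξ : E →L[ℝ] ℝ) : coordCovector c (ofCoord c y ξ) = ξ := by
  ext v
  change ξ (frame c _ (coframe c _ v)) = _
  rw [frame_coframe (symm_mem_source hy)]

theorem ofCoord_coord {c : M} {p : CoTangentBundle E M} (hp : p.proj ∈ (chartAt E c).source) :
    ofCoord c (extChartAt 𝓘(ℝ, E) c p.proj) (coordCovector c p) = p := by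
  obtain ⟨x, ξ⟩ := p
  change x ∈ _ at hp
  change (⟨(extChartAt 𝓘(ℝ, E) c).symm (extChartAt 𝓘(ℝ, E) c x),
    (ξ ∘L coframe c x) ∘L frame c _⟩ : CoTangentBundle E M) = _
  rw [symm_extChartAt hp]
  congr 1
  ext v
  change ξ (coframe c x (frame c x v)) = _
  rw [coframe_frame hp]

/-- The trivialization of a bundle of homomorphisms precomposes with the inverse frame of the
tangent bundle, which is how `coordCovector` is defined. Continuity and smoothness in the cotangent
bundle thereby reduce to base point and components. -/
theorem trivializationAt_cotangent (c : M) (p : CoTangentBundle E M) :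
    trivializationAt (E →L[ℝ] ℝ) (fun x : M => TangentSpace 𝓘(ℝ, E) x →L[ℝ] ℝ) c p =
      (p.proj, coordCovector c p) := by
  refine Prod.ext rfl ?_
  ext v
  rw [hom_trivializationAt_apply]
  change ((trivializationAt ℝ (Bundle.Trivial M ℝ) c).continuousLinearMapAt ℝ p.proj)
    (p.2 (coframe c p.proj v)) = _
  have : (trivializationAt ℝ (Bundle.Trivial M ℝ) c).continuousLinearMapAt ℝ p.proj =
      ContinuousLinearMap.id ℝ ℝ := Bundle.Trivial.continuousLinearMapAt_trivialization ℝ M ℝ p.proj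
  rw [this]
  rfl

theorem mem_trivializationAt_cotangent_source {c : M} {p : CoTangentBundle E M}
    (hp : p.proj ∈ (chartAt E c).source) :
    p ∈ (trivializationAt (E →L[ℝ] ℝ)
      (fun x : M => TangentSpace 𝓘(ℝ, E) x →L[ℝ] ℝ) c).source := by
  rw [hom_trivializationAt_source]
  simpa using hp

theorem continuousWithinAt_cotangent_iff {Z : Type*} [TopologicalSpace Z] (c : M)
    {f : Z → CoTangentBundle E M} {s : Set Z} {z : Z}
    (h : (f z).proj ∈ (chartAt E c).source) :
    ContinuousWithinAt f s z ↔ ContinuousWithinAt (fun w => (f w).proj) s z ∧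
      ContinuousWithinAt (fun w => coordCovector c (f w)) s z := by
  set e := trivializationAt (E →L[ℝ] ℝ) (fun x : M => TangentSpace 𝓘(ℝ, E) x →L[ℝ] ℝ) c with he
  have hz : f z ∈ e.source := mem_trivializationAt_cotangent_source h
  constructor
  · intro hf
    have h1 : ContinuousWithinAt (fun w => (f w).proj) s z :=
      (FiberBundle.continuous_proj (E →L[ℝ] ℝ)
        (fun x : M => TangentSpace 𝓘(ℝ, E) x →L[ℝ] ℝ)).continuousAt.comp_continuousWithinAt hf
    refine ⟨h1, ?_⟩
    have h2 : ContinuousWithinAt (fun w => e (f w)) s z :=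
      (e.toOpenPartialHomeomorph.continuousAt hz).comp_continuousWithinAt hf
    refine (continuous_snd.continuousAt.comp_continuousWithinAt h2).congr_of_eventuallyEq
      (Filter.Eventually.of_forall fun w => ?_) ?_
    · simp only [Function.comp, he, trivializationAt_cotangent]
    · simp only [Function.comp, he, trivializationAt_cotangent]
  · rintro ⟨h1, h2⟩
    have h3 : ContinuousWithinAt (fun w => e (f w)) s z :=
      (h1.prodMk h2).congr_of_eventuallyEq
        (Filter.Eventually.of_forall fun w => trivializationAt_cotangent _ _)
        (trivializationAt_cotangent _ _)
    have h4 := ContinuousAt.comp_continuousWithinAt (f := fun w => e (f w)) (x := z)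
      (e.toOpenPartialHomeomorph.symm.continuousAt (e.toOpenPartialHomeomorph.map_source hz)) h3
    have hs : ∀ᶠ w in 𝓝[s] z, (f w).proj ∈ (chartAt E c).source :=
      h1 ((chartAt E c).open_source.mem_nhds h)
    refine h4.congr_of_eventuallyEq ?_ (e.toOpenPartialHomeomorph.left_inv hz).symm
    filter_upwards [hs] with w hw
    exact (e.toOpenPartialHomeomorph.left_inv (mem_trivializationAt_cotangent_source hw)).symm

theorem continuousWithinAt_proj_iff {Z : Type*} [TopologicalSpace Z] (c : M)
    {f : Z → M} {s : Set Z} {z : Z} (hs : ∀ᶠ w in 𝓝[s] z, f w ∈ (chartAt E c).source)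
    (h : f z ∈ (chartAt E c).source) :
    ContinuousWithinAt f s z ↔ ContinuousWithinAt (fun w => extChartAt 𝓘(ℝ, E) c (f w)) s z := by
  constructor
  · intro hf
    exact (continuousAt_extChartAt' (by simpa using h)).comp_continuousWithinAt hf
  · intro hf
    have := ContinuousAt.comp_continuousWithinAt (f := fun w => extChartAt 𝓘(ℝ, E) c (f w))
      (x := z) (continuousAt_extChartAt_symm'' (extChartAt_mem_target h)) hf
    refine this.congr_of_eventuallyEq ?_ (symm_extChartAt h).symm
    filter_upwards [hs] with w hw
    exact (symm_extChartAt hw).symm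

/-- The constraint equation in the chart centred at `c`. -/
theorem hasMFDerivWithinAt_iff_hasDerivWithinAt
    (α : ∀ x : M, CoTangent E x →L[ℝ] TangentSpace 𝓘(ℝ, E) x) (c : M)
    {f : ℝ → CoTangentBundle E M} {s : Set ℝ} {t : ℝ}
    (h : (f t).proj ∈ (chartAt E c).source) :
    HasMFDerivWithinAt 𝓘(ℝ, ℝ) 𝓘(ℝ, E) (fun τ => (f τ).proj) s t
        ((1 : ℝ →L[ℝ] ℝ).smulRight (-(α _ (f t).2))) ↔
      ContinuousWithinAt (fun τ => (f τ).proj) s t ∧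
      HasDerivWithinAt (fun τ => extChartAt 𝓘(ℝ, E) c (f τ).proj)
        (-(coordBivector α c (extChartAt 𝓘(ℝ, E) c (f t).proj) (coordCovector c (f t)))) s t := by
  have key : coordBivector α c (extChartAt 𝓘(ℝ, E) c (f t).proj) (coordCovector c (f t)) =
      frame c (f t).proj (α _ (f t).2) := by
    rw [coordBivector_apply α h]
    congr 2
    ext v
    change (f t).2 (coframe c _ (frame c _ v)) = _
    rw [coframe_frame h]
  constructor
  · intro hf
    refine ⟨hf.continuousWithinAt, ?_⟩
    have h0 : HasMFDerivAt 𝓘(ℝ, E) 𝓘(ℝ, E) (extChartAt 𝓘(ℝ, E) c) (f t).proj _ :=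
      (mdifferentiableAt_extChartAt h).hasMFDerivAt
    have h1 := h0.comp_hasMFDerivWithinAt (f := fun τ => (f τ).proj) t hf
    have h2 : HasFDerivWithinAt (fun τ => extChartAt 𝓘(ℝ, E) c (f τ).proj) _ s t :=
      (hasMFDerivWithinAt_iff_hasFDerivWithinAt.1 h1)
    have h3 : HasFDerivWithinAt (fun τ => extChartAt 𝓘(ℝ, E) c (f τ).proj)
        ((1 : ℝ →L[ℝ] ℝ).smulRight (-(frame (E := E) c (f t).proj (α _ (f t).2)))) s t := by
      refine h2.congr_fderiv (ContinuousLinearMap.ext fun (r : ℝ) => ?_)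
      rw [← frame_eq_mfderiv h]
      change frame c (f t).proj (r • (-(α _ (f t).2))) = r • (-(frame c (f t).proj (α _ (f t).2)))
      rw [map_smul, map_neg]
    rw [key]
    simpa using h3.hasDerivWithinAt
  · rintro ⟨hc, hd⟩
    have h1 : HasMFDerivWithinAt 𝓘(ℝ, ℝ) 𝓘(ℝ, E)
        (fun τ => extChartAt 𝓘(ℝ, E) c (f τ).proj) s t _ :=
      hd.hasFDerivWithinAt.hasMFDerivWithinAt
    have h2 : HasMFDerivWithinAt 𝓘(ℝ, E) 𝓘(ℝ, E) (extChartAt 𝓘(ℝ, E) c).symm (range 𝓘(ℝ, E))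
      (extChartAt 𝓘(ℝ, E) c (f t).proj) _ :=
      (mdifferentiableWithinAt_extChartAt_symm (extChartAt_mem_target h)).hasMFDerivWithinAt
    have h3 := HasMFDerivWithinAt.comp (u := range 𝓘(ℝ, E)) t h2 h1 (fun τ _ => by simp)
    have hs : ∀ᶠ τ in 𝓝[s] t, (f τ).proj ∈ (chartAt E c).source :=
      hc ((chartAt E c).open_source.mem_nhds h)
    have h4 := h3.congr_of_eventuallyEq (f₁ := fun τ => (f τ).proj)
      (by filter_upwards [hs] with τ hτ
          exact (symm_extChartAt hτ).symm)
      (symm_extChartAt h).symm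
    refine h4.congr_mfderiv ?_
    refine ContinuousLinearMap.ext fun (r : ℝ) => ?_
    rw [key, ← coframe_eq_mfderivWithin h]
    change coframe c (f t).proj (r • (-(frame c (f t).proj (α _ (f t).2)))) = r • (-(α _ (f t).2))
    rw [map_smul, map_neg, coframe_frame h]

theorem contMDiffWithinAt_cotangent_iff (c : M) {f : ℝ → CoTangentBundle E M} {s : Set ℝ} {t : ℝ}
    (h : (f t).proj ∈ (chartAt E c).source)
    (hc : ContinuousWithinAt (fun τ => (f τ).proj) s t) :
    ContMDiffWithinAt 𝓘(ℝ, ℝ) (𝓘(ℝ, E).prod 𝓘(ℝ, E →L[ℝ] ℝ)) ∞ f s t ↔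
      ContDiffWithinAt ℝ ∞ (fun τ => extChartAt 𝓘(ℝ, E) c (f τ).proj) s t ∧
      ContDiffWithinAt ℝ ∞ (fun τ => coordCovector c (f τ)) s t := by
  rw [(trivializationAt (E →L[ℝ] ℝ) (fun x : M => TangentSpace 𝓘(ℝ, E) x →L[ℝ] ℝ)
    c).contMDiffWithinAt_iff (mem_trivializationAt_cotangent_source h)]
  simp only [trivializationAt_cotangent, contMDiffWithinAt_iff_contDiffWithinAt]
  refine and_congr_left fun _ => ?_
  rw [contMDiffWithinAt_iff_target_of_mem_source (y := c) (f := fun x => (f x).proj) h]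
  simp only [hc, true_and, contMDiffWithinAt_iff_contDiffWithinAt]
  rfl

end Coordinates

/-! ### The Poisson tensor in coordinates and its transformation law. -/

section Coordinates

variable {E : Type*} [NormedAddCommGroup E] [NormedSpace ℝ E]
variable {M : Type*} [TopologicalSpace M] [ChartedSpace E M] [IsManifold 𝓘(ℝ, E) ∞ M]

theorem mfderiv_comp_extChartAt {c x : M} (hx : x ∈ (chartAt E c).source) {f : M → ℝ} {g : E → ℝ}
    (hf : f =ᶠ[𝓝 x] fun z => g (extChartAt 𝓘(ℝ, E) c z))
    (hg : DifferentiableAt ℝ g (extChartAt 𝓘(ℝ, E) c x)) :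
    (mfderiv 𝓘(ℝ, E) 𝓘(ℝ, ℝ) f x : CoTangent E x) =
      (fderiv ℝ g (extChartAt 𝓘(ℝ, E) c x)) ∘L frame c x := by
  rw [hf.mfderiv_eq]
  have h0 : HasMFDerivAt 𝓘(ℝ, E) 𝓘(ℝ, E) (extChartAt 𝓘(ℝ, E) c) x _ :=
    (mdifferentiableAt_extChartAt hx).hasMFDerivAt
  have h1 : HasMFDerivAt 𝓘(ℝ, E) 𝓘(ℝ, ℝ) g (extChartAt 𝓘(ℝ, E) c x) _ :=
    hg.hasFDerivAt.hasMFDerivAt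
  have h2 := (h1.comp x h0).mfderiv
  refine Eq.trans h2 ?_
  rw [← frame_eq_mfderiv hx]
  rfl

namespace PoissonStructure

variable (α : PoissonStructure E M)

/-- The matrix of a Poisson structure in the chart centred at `c`. -/
abbrev coord (c : M) : E → (E →L[ℝ] ℝ) →L[ℝ] E := coordBivector α.toMap c

theorem coord_skew (c : M) (y : E) (ξ ζ : E →L[ℝ] ℝ) :
    ξ (α.coord c y ζ) = -ζ (α.coord c y ξ) :=
  α.skew _ (ξ ∘L frame c _) (ζ ∘L frame c _)

theorem contDiffAt_coord {c : M} {y : E} (hy : y ∈ (extChartAt 𝓘(ℝ, E) c).target) :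
    ContDiffAt ℝ ∞ (α.coord c) y :=
  (α.smooth c).contDiffAt ((isOpen_extChartAt_target c).mem_nhds hy)

theorem differentiableAt_coord {c : M} {y : E} (hy : y ∈ (extChartAt 𝓘(ℝ, E) c).target) :
    DifferentiableAt ℝ (α.coord c) y :=
  (α.contDiffAt_coord hy).differentiableAt (by simp)

/-- Both sides are derivatives of the two sides of the skewness identity with ξ and ζ held fixed. -/
theorem fderiv_coord_skew {c : M} {y : E} (hy : y ∈ (extChartAt 𝓘(ℝ, E) c).target)
    (w : E) (ξ ζ : E →L[ℝ] ℝ) :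
    ξ (fderiv ℝ (α.coord c) y w ζ) = -ζ (fderiv ℝ (α.coord c) y w ξ) := by
  have hA := (α.differentiableAt_coord hy).hasFDerivAt
  have h1 : HasFDerivAt (fun z => ξ (α.coord c z ζ)) _ y :=
    ξ.hasFDerivAt.comp y (hA.clm_apply (hasFDerivAt_const ζ y))
  have h2 : HasFDerivAt (fun z => -ζ (α.coord c z ξ)) _ y :=
    (ζ.hasFDerivAt.comp y (hA.clm_apply (hasFDerivAt_const ξ y))).neg
  have h3 : (fun z => ξ (α.coord c z ζ)) = fun z => -ζ (α.coord c z ξ) :=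
    funext fun z => α.coord_skew c z ξ ζ
  rw [h3] at h1
  simpa using congrArg (fun L : E →L[ℝ] ℝ => L w) (h1.unique h2)

/-- The Jacobi identity in coordinates. -/
theorem coord_jacobi [FiniteDimensional ℝ E] [T2Space M] {c : M} {y : E}
    (hy : y ∈ (extChartAt 𝓘(ℝ, E) c).target) (ξ ζ θ : E →L[ℝ] ℝ) :
    ζ (fderiv ℝ (α.coord c) y (α.coord c y ξ) θ) + θ (fderiv ℝ (α.coord c) y (α.coord c y ζ) ξ) +
      ξ (fderiv ℝ (α.coord c) y (α.coord c y θ) ζ) = 0 := by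
  obtain ⟨x, hx, rfl⟩ : ∃ x ∈ (chartAt E c).source, extChartAt 𝓘(ℝ, E) c x = y :=
    ⟨_, symm_mem_source hy, (extChartAt 𝓘(ℝ, E) c).right_inv hy⟩
  obtain ⟨b, hb⟩ : ∃ b : SmoothBumpFunction 𝓘(ℝ, E) x, tsupport b ⊆ (chartAt E c).source := by
    obtain ⟨b, -, hb⟩ := (SmoothBumpFunction.nhds_basis_tsupport x :
      (𝓝 x).HasBasis (fun _ : SmoothBumpFunction 𝓘(ℝ, E) x => True) fun f => tsupport f).mem_iff.1
      ((chartAt E c).open_source.mem_nhds hx)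
    exact ⟨b, hb⟩
  -- The Jacobi identity is assumed for global smooth functions only, so linear coordinate functions
  -- are multiplied by a bump function equal to 1 near x.
  set F : (E →L[ℝ] ℝ) → M → ℝ := fun η z => b z * η (extChartAt 𝓘(ℝ, E) c z) with hF
  have hsmooth : ∀ η, ContMDiff 𝓘(ℝ, E) 𝓘(ℝ, ℝ) ∞ (F η) := fun η => by
    refine contMDiff_of_tsupport fun z hz => ?_
    have hz' : z ∈ (chartAt E c).source := hb (closure_mono (Function.support_mul_subset_left _ _) hz)
    have h1 : ContMDiffAt 𝓘(ℝ, E) 𝓘(ℝ, E) ∞ (extChartAt 𝓘(ℝ, E) c) z := contMDiffAt_extChartAt' hz'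
    exact b.contMDiff.contMDiffAt.mul (η.contMDiff.contMDiffAt.comp z h1)
  have hev : ∀ η, ∀ᶠ z in 𝓝 x, F η =ᶠ[𝓝 z] fun w => η (extChartAt 𝓘(ℝ, E) c w) := fun η => by
    refine eventually_eventually_nhds.2 ?_
    filter_upwards [b.eventuallyEq_one] with z hz
    simp [hF, hz]
  have hsrc : ∀ᶠ z in 𝓝 x, z ∈ (chartAt E c).source := (chartAt E c).open_source.mem_nhds hx
  have hd : ∀ η, ∀ᶠ z in 𝓝 x,
      (mfderiv 𝓘(ℝ, E) 𝓘(ℝ, ℝ) (F η) z : CoTangent E z) = η ∘L frame c z := fun η => by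
    filter_upwards [hev η, hsrc] with z hz hz'
    rw [mfderiv_comp_extChartAt hz' hz η.differentiableAt, η.fderiv]
  have hbr : ∀ η κ, bracket α.toMap (F η) (F κ) =ᶠ[𝓝 x]
      fun z => η (α.coord c (extChartAt 𝓘(ℝ, E) c z) κ) := fun η κ => by
    filter_upwards [hd η, hd κ, hsrc] with z h1 h2 h3
    unfold bracket
    rw [h1, h2, coordBivector_apply _ h3]
    rfl
  -- The inner bracket is ζ(A θ) near x; skewness moves its differential to the other slot, leaving
  -- a derivative of A along A ξ.
  have hbb : ∀ ξ ζ θ : E →L[ℝ] ℝ, bracket α.toMap (F ξ) (bracket α.toMap (F ζ) (F θ)) x =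
      -ζ (fderiv ℝ (α.coord c) (extChartAt 𝓘(ℝ, E) c x)
        (α.coord c (extChartAt 𝓘(ℝ, E) c x) ξ) θ) := fun ξ ζ θ => by
    have hA := (α.differentiableAt_coord hy).hasFDerivAt
    have h1 : HasFDerivAt (fun z => ζ (α.coord c z θ)) _ (extChartAt 𝓘(ℝ, E) c x) :=
      ζ.hasFDerivAt.comp _ (hA.clm_apply (hasFDerivAt_const θ _))
    have h2 := mfderiv_comp_extChartAt hx (hbr ζ θ) h1.differentiableAt
    have h3 : bracket α.toMap (F ξ) (bracket α.toMap (F ζ) (F θ)) x =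
      ξ (α.coord c (extChartAt 𝓘(ℝ, E) c x)
        (fderiv ℝ (fun z => ζ (α.coord c z θ)) (extChartAt 𝓘(ℝ, E) c x))) := by
      rw [coordBivector_apply _ hx, ← h2]
      conv_lhs => unfold bracket
      rw [(hd ξ).self_of_nhds]
      rfl
    rw [h3, α.coord_skew, h1.fderiv]
    simp
  have := α.jacobi (F ξ) (F ζ) (F θ) (hsmooth ξ) (hsmooth ζ) (hsmooth θ) x
  rw [hbb, hbb, hbb] at this
  linarith

end PoissonStructure

/-- The change of coordinates from the chart centred at `c'` to the one centred at `c`. -/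
def transition (c c' : M) : E → E := extChartAt 𝓘(ℝ, E) c ∘ (extChartAt 𝓘(ℝ, E) c').symm

theorem transition_extChartAt {c c' x : M} (hx' : x ∈ (chartAt E c').source) :
    transition c c' (extChartAt 𝓘(ℝ, E) c' x) = extChartAt 𝓘(ℝ, E) c x := by
  unfold transition
  rw [Function.comp, symm_extChartAt hx']

theorem contDiffAt_transition {c c' x : M} (hx : x ∈ (chartAt E c).source)
    (hx' : x ∈ (chartAt E c').source) :
    ContDiffAt ℝ ∞ (transition (E := E) c c') (extChartAt 𝓘(ℝ, E) c' x) := by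
  have h := contDiffWithinAt_ext_coord_change (n := ∞) c c'
    (y := extChartAt 𝓘(ℝ, E) c' x) (by
      rw [PartialEquiv.trans_source'', PartialEquiv.symm_symm, PartialEquiv.symm_target]
      exact mem_image_of_mem _ (by simpa using ⟨hx', hx⟩))
  simpa [transition, contDiffWithinAt_univ] using h

theorem hasFDerivAt_transition {c c' x : M} (hx : x ∈ (chartAt E c).source)
    (hx' : x ∈ (chartAt E c').source) :
    HasFDerivAt (transition (E := E) c c') (frame c x ∘L coframe c' x)
      (extChartAt 𝓘(ℝ, E) c' x) := by
  have h1 : HasMFDerivWithinAt 𝓘(ℝ, E) 𝓘(ℝ, E) (extChartAt 𝓘(ℝ, E) c').symm (range 𝓘(ℝ, E))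
      (extChartAt 𝓘(ℝ, E) c' x) _ :=
    (mdifferentiableWithinAt_extChartAt_symm (extChartAt_mem_target hx')).hasMFDerivWithinAt
  have h0 : HasMFDerivAt 𝓘(ℝ, E) 𝓘(ℝ, E) (extChartAt 𝓘(ℝ, E) c)
      ((extChartAt 𝓘(ℝ, E) c').symm (extChartAt 𝓘(ℝ, E) c' x)) _ :=
    (mdifferentiableAt_extChartAt (by rwa [symm_extChartAt hx'])).hasMFDerivAt
  have h2 : HasFDerivWithinAt (transition (E := E) c c') _ (range 𝓘(ℝ, E))
      (extChartAt 𝓘(ℝ, E) c' x) := (h0.comp_hasMFDerivWithinAt _ h1).hasFDerivWithinAt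
  rw [← coframe_eq_mfderivWithin hx', symm_extChartAt hx', ← frame_eq_mfderiv hx] at h2
  rw [modelWithCornersSelf_coe, range_id] at h2
  exact h2.hasFDerivAt_of_univ

theorem coordCovector_transition {c c' : M} {p : CoTangentBundle E M}
    (hx : p.proj ∈ (chartAt E c).source) (hx' : p.proj ∈ (chartAt E c').source) :
    coordCovector c' p =
      coordCovector c p ∘L fderiv ℝ (transition c c') (extChartAt 𝓘(ℝ, E) c' p.proj) := by
  rw [(hasFDerivAt_transition hx hx').fderiv]
  ext v
  change p.2 (coframe c' _ v) = p.2 (coframe c _ (frame c _ (coframe c' _ v)))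
  rw [coframe_frame hx]

/-- The intrinsic map α(x) is conjugated by the two frames, and the derivative of the transition map
is the frame of one chart composed with the coframe of the other. -/
theorem coord_transition (α : PoissonStructure E M) {c c' x : M}
    (hx : x ∈ (chartAt E c).source) (hx' : x ∈ (chartAt E c').source) (ξ : E →L[ℝ] ℝ) :
    α.coord c (extChartAt 𝓘(ℝ, E) c x) ξ =
      fderiv ℝ (transition c c') (extChartAt 𝓘(ℝ, E) c' x) (α.coord c' (extChartAt 𝓘(ℝ, E) c' x)
        (ξ ∘L fderiv ℝ (transition c c') (extChartAt 𝓘(ℝ, E) c' x))) := by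
  rw [(hasFDerivAt_transition hx hx').fderiv, coordBivector_apply _ hx, coordBivector_apply _ hx']
  have : (ξ ∘L frame c x ∘L coframe c' x) ∘L frame c' x = ξ ∘L frame c x := by
    ext v
    change ξ (frame c x (coframe c' x (frame c' x v))) = _
    rw [coframe_frame hx']
    rfl
  rw [this]
  change _ = frame c x (coframe c' x (frame c' x _))
  rw [coframe_frame hx']

end Coordinates

/-! ### The gauge equations at a point and their independence of the chart. -/

section Coordinates

variable {E : Type*} [NormedAddCommGroup E] [NormedSpace ℝ E]
variable {M : Type*} [TopologicalSpace M] [ChartedSpace E M] [IsManifold 𝓘(ℝ, E) ∞ M]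

/-- The square `[0,1] × [0,1]`. -/
abbrev unitSquare : Set (ℝ × ℝ) := Icc 0 1 ×ˢ Icc 0 1

theorem tendsto_mk_right {s u : ℝ} (hs : s ∈ Icc (0 : ℝ) 1) :
    Filter.Tendsto (fun v => (s, v)) (𝓝[Icc 0 1] u) (𝓝[unitSquare] (s, u)) :=
  tendsto_nhdsWithin_iff.2 ⟨(by fun_prop : Continuous fun v : ℝ => (s, v)).continuousAt.mono_left
    nhdsWithin_le_nhds, eventually_mem_nhdsWithin.mono fun _ hv => ⟨hs, hv⟩⟩

theorem tendsto_mk_left {s u : ℝ} (hu : u ∈ Icc (0 : ℝ) 1) :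
    Filter.Tendsto (fun r => (r, u)) (𝓝[Icc 0 1] s) (𝓝[unitSquare] (s, u)) :=
  tendsto_nhdsWithin_iff.2 ⟨(by fun_prop : Continuous fun r : ℝ => (r, u)).continuousAt.mono_left
    nhdsWithin_le_nhds, eventually_mem_nhdsWithin.mono fun _ hv => ⟨hv, hu⟩⟩

/-- The equations of an infinitesimal gauge transformation at the point `(s, u)`, in the chart
centred at `c`, where `b'` is the derivative of the parameter in the direction of `u`. -/
structure GaugeEq (α : PoissonStructure E M) (Z B : ℝ → ℝ → CoTangentBundle E M) (c : M)
    (b' : E →L[ℝ] ℝ) (s u : ℝ) : Prop where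
  mem_source : (Z s u).proj ∈ (chartAt E c).source
  base_right : HasDerivWithinAt (fun v => extChartAt 𝓘(ℝ, E) c (Z s v).proj)
    (-(α.coord c (extChartAt 𝓘(ℝ, E) c (Z s u).proj) (coordCovector c (Z s u)))) (Icc 0 1) u
  base_left : HasDerivWithinAt (fun r => extChartAt 𝓘(ℝ, E) c (Z r u).proj)
    (-(α.coord c (extChartAt 𝓘(ℝ, E) c (Z s u).proj) (coordCovector c (B s u)))) (Icc 0 1) s
  param_right : HasDerivWithinAt (fun v => coordCovector c (B s v)) b' (Icc 0 1) u
  form_left : HasDerivWithinAt (fun r => coordCovector c (Z r u))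
    (b' + (coordCovector c (Z s u)) ∘L ((fderiv ℝ (α.coord c)
      (extChartAt 𝓘(ℝ, E) c (Z s u).proj)).flip (coordCovector c (B s u)))) (Icc 0 1) s

/-- The equations involve one-sided germs along the row and the column through the point, both of
which lie in the unit square. -/
theorem GaugeEq.congr {α : PoissonStructure E M} {Z B Z' B' : ℝ → ℝ → CoTangentBundle E M} {c : M}
    {b' : E →L[ℝ] ℝ} {s u : ℝ} (h : GaugeEq α Z B c b' s u) (hs : s ∈ Icc (0 : ℝ) 1)
    (hu : u ∈ Icc (0 : ℝ) 1)
    (he : ∀ᶠ q in 𝓝[unitSquare] (s, u), Z' q.1 q.2 = Z q.1 q.2 ∧ B' q.1 q.2 = B q.1 q.2) :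
    GaugeEq α Z' B' c b' s u := by
  obtain ⟨hZ, hB⟩ := he.self_of_nhdsWithin ⟨hs, hu⟩
  have h1 := (tendsto_mk_right (u := u) hs).eventually he
  have h2 := (tendsto_mk_left (s := s) hu).eventually he
  dsimp only at hZ hB h1 h2
  constructor
  · rw [hZ]; exact h.mem_source
  · rw [hZ]
    exact h.base_right.congr_of_eventuallyEq (h1.mono fun v hv => by simp only [hv.1]) (by simp only [hZ])
  · rw [hZ, hB]
    exact h.base_left.congr_of_eventuallyEq (h2.mono fun v hv => by simp only [hv.1]) (by simp only [hZ])
  · exact h.param_right.congr_of_eventuallyEq (h1.mono fun v hv => by simp only [hv.2]) (by simp only [hB])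
  · rw [hZ, hB]
    exact h.form_left.congr_of_eventuallyEq (h2.mono fun v hv => by simp only [hv.1]) (by simp only [hZ])

/-- The second derivative term in the transformation law of `∂ᵤ βᵢ`. -/
def paramTransition (α : PoissonStructure E M) (Z B : ℝ → ℝ → CoTangentBundle E M) (c c' : M)
    (b' : E →L[ℝ] ℝ) (s u : ℝ) : E →L[ℝ] ℝ :=
  b' ∘L fderiv ℝ (transition c c') (extChartAt 𝓘(ℝ, E) c' (Z s u).proj) +
    coordCovector c (B s u) ∘L fderiv ℝ (fderiv ℝ (transition c c'))
      (extChartAt 𝓘(ℝ, E) c' (Z s u).proj)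
      (-(α.coord c' (extChartAt 𝓘(ℝ, E) c' (Z s u).proj) (coordCovector c' (Z s u))))

theorem hasDerivWithinAt_extChartAt_change {c c' : M} {f : ℝ → M} {D : Set ℝ} {t : ℝ} {v : E}
    (hc : ContinuousWithinAt f D t)
    (h : f t ∈ (chartAt E c).source) (h' : f t ∈ (chartAt E c').source)
    (hf : HasDerivWithinAt (fun r => extChartAt 𝓘(ℝ, E) c (f r)) v D t) :
    HasDerivWithinAt (fun r => extChartAt 𝓘(ℝ, E) c' (f r))
      (fderiv ℝ (transition c' c) (extChartAt 𝓘(ℝ, E) c (f t)) v) D t := by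
  have h1 := ((contDiffAt_transition h' h).differentiableAt (by simp)).hasFDerivAt.comp_hasDerivWithinAt
    t hf
  refine h1.congr_of_eventuallyEq ?_ (transition_extChartAt h).symm
  filter_upwards [hc ((chartAt E c).open_source.mem_nhds h)] with r hr
  exact (transition_extChartAt hr).symm

theorem fderiv_transition_comp {c c' x : M} (hx : x ∈ (chartAt E c).source)
    (hx' : x ∈ (chartAt E c').source) (v : E) :
    fderiv ℝ (transition c' c) (extChartAt 𝓘(ℝ, E) c x)
      (fderiv ℝ (transition c c') (extChartAt 𝓘(ℝ, E) c' x) v) = v := by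
  rw [(hasFDerivAt_transition hx hx').fderiv, (hasFDerivAt_transition hx' hx).fderiv]
  change frame c' x (coframe c x (frame c x (coframe c' x v))) = v
  rw [coframe_frame hx, frame_coframe hx']

/-- Product rule applied to the covector law: the Jacobian of the transition map varies with the
base point, which produces the second derivative term. -/
theorem hasDerivWithinAt_coordCovector_change {c c' : M} {f : ℝ → CoTangentBundle E M} {D : Set ℝ}
    {t : ℝ} {v : E} {w : E →L[ℝ] ℝ} (hc : ContinuousWithinAt (fun r => (f r).proj) D t)
    (h : (f t).proj ∈ (chartAt E c).source) (h' : (f t).proj ∈ (chartAt E c').source)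
    (hf : HasDerivWithinAt (fun r => extChartAt 𝓘(ℝ, E) c' (f r).proj) v D t)
    (hw : HasDerivWithinAt (fun r => coordCovector c (f r)) w D t) :
    HasDerivWithinAt (fun r => coordCovector c' (f r))
      (w ∘L fderiv ℝ (transition c c') (extChartAt 𝓘(ℝ, E) c' (f t).proj) +
        coordCovector c (f t) ∘L fderiv ℝ (fderiv ℝ (transition c c'))
          (extChartAt 𝓘(ℝ, E) c' (f t).proj) v) D t := by
  have h2 : DifferentiableAt ℝ (fderiv ℝ (transition c c')) (extChartAt 𝓘(ℝ, E) c' (f t).proj) :=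
    ((contDiffAt_transition h h').fderiv_right (m := 1) (by norm_cast)).differentiableAt (by simp)
  have h3 := h2.hasFDerivAt.comp_hasDerivWithinAt t hf
  refine (hw.clm_comp h3).congr_of_eventuallyEq ?_ (coordCovector_transition h h')
  filter_upwards [hc ((chartAt E c).open_source.mem_nhds h),
    hc ((chartAt E c').open_source.mem_nhds h')] with r hr hr'
  exact coordCovector_transition hr hr'

set_option synthInstance.maxHeartbeats 200000 in
/-- Derivative of the transformation law of the bivector field. -/
theorem fderiv_coord_transition (α : PoissonStructure E M) {c c' x : M}
    (hx : x ∈ (chartAt E c).source) (hx' : x ∈ (chartAt E c').source) (ξ ζ : E →L[ℝ] ℝ) (w : E) :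
    let θ := transition (E := E) c c'
    let y := extChartAt 𝓘(ℝ, E) c' x
    ξ (fderiv ℝ (α.coord c) (extChartAt 𝓘(ℝ, E) c x) (fderiv ℝ θ y w) ζ) =
      ξ (fderiv ℝ (fderiv ℝ θ) y w (α.coord c' y (ζ ∘L fderiv ℝ θ y))) +
      (ξ ∘L fderiv ℝ θ y) (fderiv ℝ (α.coord c') y w (ζ ∘L fderiv ℝ θ y)) -
      ζ (fderiv ℝ (fderiv ℝ θ) y w (α.coord c' y (ξ ∘L fderiv ℝ θ y))) := by
  intro θ y
  have hθ : ContDiffAt ℝ ∞ θ y := contDiffAt_transition hx hx'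
  have hθ1 : HasFDerivAt θ (fderiv ℝ θ y) y := (hθ.differentiableAt (by simp)).hasFDerivAt
  have hθ2 : HasFDerivAt (fderiv ℝ θ) (fderiv ℝ (fderiv ℝ θ) y) y :=
    ((hθ.fderiv_right (m := 1) (by norm_cast)).differentiableAt (by simp)).hasFDerivAt
  have hA' : HasFDerivAt (α.coord c') (fderiv ℝ (α.coord c') y) y :=
    (α.differentiableAt_coord (extChartAt_mem_target hx')).hasFDerivAt
  have hy : θ y = extChartAt 𝓘(ℝ, E) c x := transition_extChartAt hx'
  have hA : HasFDerivAt (α.coord c) (fderiv ℝ (α.coord c) (θ y)) (θ y) :=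
    (α.differentiableAt_coord (by rw [hy]; exact extChartAt_mem_target hx)).hasFDerivAt
  have hAθ : HasFDerivAt (fun z => α.coord c (θ z))
      (fderiv ℝ (α.coord c) (θ y) ∘L fderiv ℝ θ y) y :=
    HasFDerivAt.comp (g := α.coord c) (f := θ) y hA hθ1
  -- The claim is obtained by differentiating, in the source chart, the two sides of the
  -- transformation law of the bivector field.
  have hL : HasFDerivAt (fun z => ξ (α.coord c (θ z) ζ)) _ y :=
    ξ.hasFDerivAt.comp y (hAθ.clm_apply (hasFDerivAt_const ζ y))
  have hR : HasFDerivAt (fun z => ξ (fderiv ℝ θ z (α.coord c' z (ζ ∘L fderiv ℝ θ z)))) _ y :=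
    ξ.hasFDerivAt.comp y (hθ2.clm_apply (hA'.clm_apply ((hasFDerivAt_const ζ y).clm_comp hθ2)))
  have hev : (fun z => ξ (fderiv ℝ θ z (α.coord c' z (ζ ∘L fderiv ℝ θ z)))) =ᶠ[𝓝 y]
      fun z => ξ (α.coord c (θ z) ζ) := by
    have h1 : ∀ᶠ z in 𝓝 y, z ∈ (extChartAt 𝓘(ℝ, E) c').target :=
      (isOpen_extChartAt_target c').mem_nhds (extChartAt_mem_target hx')
    have h2 : ∀ᶠ z in 𝓝 y, (extChartAt 𝓘(ℝ, E) c').symm z ∈ (chartAt E c).source := by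
      refine (continuousAt_extChartAt_symm'' (extChartAt_mem_target hx')) ?_
      rw [symm_extChartAt hx']
      exact (chartAt E c).open_source.mem_nhds hx
    filter_upwards [h1, h2] with z hz hz'
    have := coord_transition α hz' (symm_mem_source hz) ζ
    rw [(extChartAt 𝓘(ℝ, E) c').right_inv hz] at this
    rw [← this]
    rfl
  have := congrArg (fun L : E →L[ℝ] ℝ => L w) ((hL.congr_of_eventuallyEq hev).unique hR)
  rw [← hy]
  simp only [ContinuousLinearMap.comp_apply, add_apply,
    ContinuousLinearMap.flip_apply, map_add, ContinuousLinearMap.comp_zero,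
    zero_add, add_zero, ContinuousLinearMap.compL_apply] at this ⊢
  rw [this]
  -- The derivative falling on the covector slot gives a term which skewness rewrites as a pairing
  -- with ζ, the last summand of the claim.
  have h5 := α.coord_skew c' y (ξ ∘L fderiv ℝ θ y) (ζ ∘L fderiv ℝ (fderiv ℝ θ) y w)
  simp only [ContinuousLinearMap.comp_apply] at h5
  rw [h5]
  ring

theorem fderiv_fderiv_transition_symm {c c' x : M}
    (hx : x ∈ (chartAt E c).source) (hx' : x ∈ (chartAt E c').source) (v w : E) :
    fderiv ℝ (fderiv ℝ (transition (E := E) c c')) (extChartAt 𝓘(ℝ, E) c' x) v w =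
      fderiv ℝ (fderiv ℝ (transition (E := E) c c')) (extChartAt 𝓘(ℝ, E) c' x) w v := by
  have h : ContDiffAt ℝ ∞ (transition (E := E) c c') (extChartAt 𝓘(ℝ, E) c' x) :=
    contDiffAt_transition hx hx'
  exact (h.isSymmSndFDerivAt (by
    simpa using WithTop.coe_le_coe.2 (le_top : (2 : ℕ∞) ≤ ⊤))) v w

/-- The gauge equations do not depend on the chart. -/
theorem GaugeEq.change {α : PoissonStructure E M} {Z B : ℝ → ℝ → CoTangentBundle E M} {c : M}
    {b' : E →L[ℝ] ℝ} {s u : ℝ} (h : GaugeEq α Z B c b' s u) (hs : s ∈ Icc (0 : ℝ) 1)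
    (hu : u ∈ Icc (0 : ℝ) 1)
    (hZ : ContinuousWithinAt (fun q : ℝ × ℝ => (Z q.1 q.2).proj) unitSquare (s, u))
    (hB : ∀ s ∈ Icc (0 : ℝ) 1, ∀ u ∈ Icc (0 : ℝ) 1, (B s u).proj = (Z s u).proj)
    {c' : M} (hc' : (Z s u).proj ∈ (chartAt E c').source) :
    GaugeEq α Z B c' (paramTransition α Z B c c' b' s u) s u := by
  have hc := h.mem_source
  have hZ1 : ContinuousWithinAt (fun v => (Z s v).proj) (Icc 0 1) u :=
    hZ.tendsto.comp (tendsto_mk_right hs)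
  have hZ2 : ContinuousWithinAt (fun r => (Z r u).proj) (Icc 0 1) s :=
    hZ.tendsto.comp (tendsto_mk_left hu)
  have hBsu := hB s hs u hu
  have e1 : ∀ p : CoTangentBundle E M, p.proj = (Z s u).proj →
      fderiv ℝ (transition c' c) (extChartAt 𝓘(ℝ, E) c (Z s u).proj)
        (-(α.coord c (extChartAt 𝓘(ℝ, E) c (Z s u).proj) (coordCovector c p))) =
      -(α.coord c' (extChartAt 𝓘(ℝ, E) c' (Z s u).proj) (coordCovector c' p)) := fun p hp => by
    rw [coord_transition α hc hc', map_neg, fderiv_transition_comp hc hc', ← hp,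
      ← coordCovector_transition (by rw [hp]; exact hc) (by rw [hp]; exact hc')]
  have hbr := hasDerivWithinAt_extChartAt_change hZ1 hc hc' h.base_right
  have hbl := hasDerivWithinAt_extChartAt_change hZ2 hc hc' h.base_left
  rw [e1 _ rfl] at hbr
  rw [e1 _ hBsu] at hbl
  refine ⟨hc', hbr, hbl, ?_, ?_⟩
  · have hev : (fun v => extChartAt 𝓘(ℝ, E) c' (B s v).proj) =ᶠ[𝓝[Icc 0 1] u]
        fun v => extChartAt 𝓘(ℝ, E) c' (Z s v).proj :=
      eventually_mem_nhdsWithin.mono fun v hv => by simp only [hB s hs v hv]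
    have hev2 : (fun v => (B s v).proj) =ᶠ[𝓝[Icc 0 1] u] fun v => (Z s v).proj :=
      eventually_mem_nhdsWithin.mono fun v hv => by simp only [hB s hs v hv]
    have := hasDerivWithinAt_coordCovector_change (f := fun v => B s v) (c := c) (c' := c')
      (hZ1.congr_of_eventuallyEq hev2 hBsu) (by rwa [hBsu]) (by rwa [hBsu])
      (hbr.congr_of_eventuallyEq hev (by simp only [hBsu])) h.param_right
    simp only [hBsu] at this
    exact this
  · have := hasDerivWithinAt_coordCovector_change (f := fun r => Z r u) hZ2 hc hc' hbl h.form_left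
    refine this.congr_deriv ?_
    unfold paramTransition
    ext w
    have hp := coordCovector_transition (p := Z s u) hc hc'
    have hb := coordCovector_transition (p := B s u) (by rwa [hBsu]) (by rwa [hBsu] : _ ∈ (chartAt E c').source)
    rw [hBsu] at hb
    -- The second derivative terms of the bivector law meet those of the covector laws for η and for
    -- β. By symmetry of second derivatives, the term paired with η cancels and the one paired with
    -- β is the correction in `paramTransition`.
    have key := fderiv_coord_transition α hc hc' (coordCovector c (Z s u))
      (coordCovector c (B s u)) w
    simp only [← hp, ← hb] at key
    have hb' := congrArg (fun L : E →L[ℝ] ℝ => L w) hb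
    simp only [add_apply, ContinuousLinearMap.comp_apply,
      ContinuousLinearMap.flip_apply, map_neg, neg_apply] at key ⊢
    rw [key, fderiv_fderiv_transition_symm hc hc' (α.coord c' _ _) w,
      fderiv_fderiv_transition_symm hc hc' (α.coord c' _ _) w]
    ring

end Coordinates

/-! ### Gauge squares: gauge curves described near each point in one chart. -/

section Coordinates

variable {E : Type*} [NormedAddCommGroup E] [NormedSpace ℝ E]
variable {M : Type*} [TopologicalSpace M] [ChartedSpace E M] [IsManifold 𝓘(ℝ, E) ∞ M]

/-- The gauge equations hold near `(s, u)` in some chart, with a parameter whose derivative is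
continuous at `(s, u)`. -/
def GaugeEqNear (α : PoissonStructure E M) (Z B : ℝ → ℝ → CoTangentBundle E M) (s u : ℝ) : Prop :=
  ∃ (c : M) (b' : ℝ × ℝ → E →L[ℝ] ℝ), ContinuousWithinAt b' unitSquare (s, u) ∧
    ∀ᶠ q in 𝓝[unitSquare] (s, u), GaugeEq α Z B c (b' q) q.1 q.2

theorem eventually_eventually_unitSquare {q : ℝ × ℝ} {p : ℝ × ℝ → Prop}
    (h : ∀ᶠ r in 𝓝[unitSquare] q, p r) :
    ∀ᶠ r in 𝓝[unitSquare] q, r ∈ unitSquare ∧ ∀ᶠ r' in 𝓝[unitSquare] r, p r' :=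
  eventually_mem_nhdsWithin.and (eventually_eventually_nhdsWithin.2 h)

theorem GaugeEqNear.congr {α : PoissonStructure E M} {Z B Z' B' : ℝ → ℝ → CoTangentBundle E M}
    {s u : ℝ} (h : GaugeEqNear α Z B s u)
    (he : ∀ᶠ q in 𝓝[unitSquare] (s, u), Z' q.1 q.2 = Z q.1 q.2 ∧ B' q.1 q.2 = B q.1 q.2) :
    GaugeEqNear α Z' B' s u := by
  obtain ⟨c, b', hb, h⟩ := h
  refine ⟨c, b', hb, ?_⟩
  filter_upwards [h, eventually_eventually_unitSquare he] with q h1 h2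
  exact h1.congr h2.1.1 h2.1.2 h2.2

/-- A family of solutions `Z(s, ·)` with parameters `B(s, ·)` satisfying the gauge equations. -/
structure GaugeSquare (α : PoissonStructure E M) (Z B : ℝ → ℝ → CoTangentBundle E M) : Prop where
  continuousOn_curve : ContinuousOn (fun q : ℝ × ℝ => Z q.1 q.2) unitSquare
  continuousOn_param : ContinuousOn (fun q : ℝ × ℝ => B q.1 q.2) unitSquare
  proj_param : ∀ s ∈ Icc (0 : ℝ) 1, ∀ u ∈ Icc (0 : ℝ) 1, (B s u).proj = (Z s u).proj
  param_zero : ∀ s ∈ Icc (0 : ℝ) 1, (B s 0).2 = 0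
  param_one : ∀ s ∈ Icc (0 : ℝ) 1, (B s 1).2 = 0
  gaugeEqNear : ∀ s ∈ Icc (0 : ℝ) 1, ∀ u ∈ Icc (0 : ℝ) 1, GaugeEqNear α Z B s u

theorem continuous_proj_cotangent :
    Continuous (fun p : CoTangentBundle E M => p.proj) :=
  FiberBundle.continuous_proj (E →L[ℝ] ℝ) (fun x : M => TangentSpace 𝓘(ℝ, E) x →L[ℝ] ℝ)

namespace GaugeSquare

variable {α : PoissonStructure E M} {Z B Z' B' : ℝ → ℝ → CoTangentBundle E M}

theorem congr (h : GaugeSquare α Z B)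
    (hZ : ∀ s ∈ Icc (0 : ℝ) 1, ∀ u ∈ Icc (0 : ℝ) 1, Z' s u = Z s u)
    (hB : ∀ s ∈ Icc (0 : ℝ) 1, ∀ u ∈ Icc (0 : ℝ) 1, B' s u = B s u) : GaugeSquare α Z' B' where
  continuousOn_curve := h.continuousOn_curve.congr fun q hq => hZ _ hq.1 _ hq.2
  continuousOn_param := h.continuousOn_param.congr fun q hq => hB _ hq.1 _ hq.2
  proj_param s hs u hu := by rw [hZ s hs u hu, hB s hs u hu, h.proj_param s hs u hu]
  param_zero s hs := by rw [hB s hs 0 (by simp)]; exact h.param_zero s hs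
  param_one s hs := by rw [hB s hs 1 (by simp)]; exact h.param_one s hs
  gaugeEqNear s hs u hu := (h.gaugeEqNear s hs u hu).congr
    (eventually_mem_nhdsWithin.mono fun q hq => ⟨hZ _ hq.1 _ hq.2, hB _ hq.1 _ hq.2⟩)

theorem continuousOn_proj (h : GaugeSquare α Z B) :
    ContinuousOn (fun q : ℝ × ℝ => (Z q.1 q.2).proj) unitSquare :=
  continuous_proj_cotangent.comp_continuousOn h.continuousOn_curve

theorem eventually_mem_source (h : GaugeSquare α Z B) {s u : ℝ} (hq : (s, u) ∈ unitSquare) {c : M}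
    (hc : (Z s u).proj ∈ (chartAt E c).source) :
    ∀ᶠ q in 𝓝[unitSquare] (s, u), (Z q.1 q.2).proj ∈ (chartAt E c).source :=
  h.continuousOn_proj (s, u) hq ((chartAt E c).open_source.mem_nhds hc)

/-- The gauge equations hold near every point, in every chart. -/
theorem exists_gaugeEq (h : GaugeSquare α Z B) {s u : ℝ} (hq : (s, u) ∈ unitSquare) {c : M}
    (hc : (Z s u).proj ∈ (chartAt E c).source) :
    ∃ b' : ℝ × ℝ → E →L[ℝ] ℝ, ContinuousWithinAt b' unitSquare (s, u) ∧
      ∀ᶠ q in 𝓝[unitSquare] (s, u), GaugeEq α Z B c (b' q) q.1 q.2 := by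
  obtain ⟨c₀, b', hb', he⟩ := h.gaugeEqNear s hq.1 u hq.2
  refine ⟨fun q => paramTransition α Z B c₀ c (b' q) q.1 q.2, ?_, ?_⟩
  · have hc₀ := (he.self_of_nhdsWithin hq).mem_source
    have hZ := h.continuousOn_curve (s, u) hq
    have hB := h.continuousOn_param (s, u) hq
    have hBp := h.proj_param s hq.1 u hq.2
    have hx : ContinuousWithinAt (fun q : ℝ × ℝ => extChartAt 𝓘(ℝ, E) c (Z q.1 q.2).proj)
        unitSquare (s, u) :=
      (continuousWithinAt_proj_iff c (h.eventually_mem_source hq hc) hc).1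
        (h.continuousOn_proj (s, u) hq)
    have hp := ((continuousWithinAt_cotangent_iff c (f := fun q : ℝ × ℝ => Z q.1 q.2) hc).1 hZ).2
    have hb := ((continuousWithinAt_cotangent_iff c₀ (f := fun q : ℝ × ℝ => B q.1 q.2)
      (z := (s, u)) (by rwa [hBp])).1 hB).2
    have hθ : ContDiffAt ℝ ∞ (transition (E := E) c₀ c) (extChartAt 𝓘(ℝ, E) c (Z s u).proj) :=
      contDiffAt_transition hc₀ hc
    have hθ1 : ContDiffAt ℝ ∞ (fderiv ℝ (transition (E := E) c₀ c)) _ :=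
      hθ.fderiv_right (by simp)
    have hθ2 : ContDiffAt ℝ ∞ (fderiv ℝ (fderiv ℝ (transition (E := E) c₀ c))) _ :=
      hθ1.fderiv_right (by simp)
    have k1 := ContinuousAt.comp_continuousWithinAt (x := (s, u))
      (f := fun q : ℝ × ℝ => extChartAt 𝓘(ℝ, E) c (Z q.1 q.2).proj) hθ1.continuousAt hx
    have k2 := ContinuousAt.comp_continuousWithinAt (x := (s, u))
      (f := fun q : ℝ × ℝ => extChartAt 𝓘(ℝ, E) c (Z q.1 q.2).proj) hθ2.continuousAt hx
    have k3 := ContinuousAt.comp_continuousWithinAt (x := (s, u))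
      (f := fun q : ℝ × ℝ => extChartAt 𝓘(ℝ, E) c (Z q.1 q.2).proj)
      (α.contDiffAt_coord (extChartAt_mem_target hc)).continuousAt hx
    exact (hb'.clm_comp k1).add (hb.clm_comp (k2.clm_apply (k3.clm_apply hp).neg))
  · filter_upwards [he, h.eventually_mem_source hq hc, eventually_mem_nhdsWithin] with q h1 h2 h3
    exact h1.change h3.1 h3.2 (h.continuousOn_proj q h3) h.proj_param h2

/-- One chart near each point is transported to all charts. Uniqueness of derivatives within the
interval identifies the continuous function b' with the derivative required of a gauge curve. -/
theorem isGaugeCurve {Γ : ℝ → Constraint α} {β : ℝ → ℝ → CoTangentBundle E M}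
    (h : GaugeSquare α (fun s u => ext01 (Γ s).toMap u) β) : IsGaugeCurve Γ β where
  continuousOn_curve := h.continuousOn_curve
  continuousOn_param := h.continuousOn_param
  proj_param := h.proj_param
  param_zero := h.param_zero
  param_one := h.param_one
  differentiable_param c s hs u hu hc := by
    obtain ⟨b', -, hb⟩ := h.exists_gaugeEq ⟨hs, hu⟩ hc
    exact (hb.self_of_nhdsWithin ⟨hs, hu⟩).param_right.differentiableWithinAt
  continuousOn_deriv_param c := by
    rintro ⟨s, u⟩ ⟨hq, hc⟩
    obtain ⟨b', hb', hb⟩ := h.exists_gaugeEq hq hc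
    refine (hb'.congr_of_eventuallyEq ?_ ?_).mono fun q hq => hq.1
    · filter_upwards [hb, eventually_mem_nhdsWithin] with q h1 h2
      exact h1.param_right.derivWithin (uniqueDiffOn_Icc_zero_one _ h2.2)
    · exact (hb.self_of_nhdsWithin hq).param_right.derivWithin (uniqueDiffOn_Icc_zero_one _ hq.2)
  velocity_base c s hs u hu hc := by
    obtain ⟨b', -, hb⟩ := h.exists_gaugeEq ⟨hs, hu⟩ hc
    exact (hb.self_of_nhdsWithin ⟨hs, hu⟩).base_left
  velocity_form c s hs u hu hc := by
    obtain ⟨b', -, hb⟩ := h.exists_gaugeEq ⟨hs, hu⟩ hc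
    have := hb.self_of_nhdsWithin ⟨hs, hu⟩
    have h2 := this.param_right.derivWithin (uniqueDiffOn_Icc_zero_one _ hu)
    dsimp only at h2 ⊢
    rw [h2]
    exact this.form_left

end GaugeSquare

/-- The chart centred at the base point of the solution is enough near each point; the equation in
the direction of u is the constraint itself. -/
theorem IsGaugeCurve.gaugeSquare {α : PoissonStructure E M} {Γ : ℝ → Constraint α}
    {β : ℝ → ℝ → CoTangentBundle E M} (h : IsGaugeCurve Γ β) :
    GaugeSquare α (fun s u => ext01 (Γ s).toMap u) β where
  continuousOn_curve := h.continuousOn_curve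
  continuousOn_param := h.continuousOn_param
  proj_param := h.proj_param
  param_zero := h.param_zero
  param_one := h.param_one
  gaugeEqNear s hs u hu := by
    set c := (ext01 (Γ s).toMap u).proj with hc
    have hcs : (ext01 (Γ s).toMap u).proj ∈ (chartAt E c).source := mem_chart_source _ _
    have hev : ∀ᶠ q : ℝ × ℝ in 𝓝[unitSquare] (s, u),
        (ext01 (Γ q.1).toMap q.2).proj ∈ (chartAt E c).source :=
      (continuous_proj_cotangent.comp_continuousOn h.continuousOn_curve) (s, u) ⟨hs, hu⟩
        ((chartAt E c).open_source.mem_nhds hcs)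
    refine ⟨c, fun p => derivWithin (fun v => coordCovector c (β p.1 v)) (Icc 0 1) p.2, ?_, ?_⟩
    · refine (h.continuousOn_deriv_param c (s, u) ⟨⟨hs, hu⟩, hcs⟩).mono_of_mem_nhdsWithin ?_
      filter_upwards [hev, eventually_mem_nhdsWithin] with q h1 h2
      exact ⟨h2, h1⟩
    · filter_upwards [hev, eventually_mem_nhdsWithin] with q h1 h2
      refine ⟨h1, ?_, h.velocity_base c _ h2.1 _ h2.2 h1,
        (h.differentiable_param c _ h2.1 _ h2.2 h1).hasDerivWithinAt,
        h.velocity_form c _ h2.1 _ h2.2 h1⟩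
      exact ((hasMFDerivWithinAt_iff_hasDerivWithinAt α.toMap c h1).1 ((Γ q.1).gauss _ h2.2)).2

namespace Constraint

variable {α : PoissonStructure E M}

theorem ext {P Q : Constraint α} (h : ∀ u ∈ Icc (0 : ℝ) 1, ext01 P.toMap u = ext01 Q.toMap u) :
    P = Q := by
  obtain ⟨f, hf⟩ := P
  obtain ⟨g, hg⟩ := Q
  congr
  ext1 u
  simpa [ext01] using h u u.2

theorem ext01_mk {f : ℝ → CoTangentBundle E M} {t : ℝ} (ht : t ∈ Icc (0 : ℝ) 1) :
    ext01 (fun u : I => f u) t = f t := by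
  simp only [ext01, projIcc_of_mem _ ht]

/-- The solution defined by a map on the real line that satisfies the constraint in charts. -/
def ofMap (f : ℝ → CoTangentBundle E M) (hf : ContinuousOn f (Icc 0 1))
    (h : ∀ t ∈ Icc (0 : ℝ) 1, ∃ c : M, (f t).proj ∈ (chartAt E c).source ∧
      HasDerivWithinAt (fun τ => extChartAt 𝓘(ℝ, E) c (f τ).proj)
        (-(α.coord c (extChartAt 𝓘(ℝ, E) c (f t).proj) (coordCovector c (f t)))) (Icc 0 1) t) :
    Constraint α where
  toMap := ⟨fun u => f u, hf.comp_continuous continuous_subtype_val fun u => u.2⟩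
  gauss t ht := by
    obtain ⟨c, hc, hd⟩ := h t ht
    have h1 := (hasMFDerivWithinAt_iff_hasDerivWithinAt α.toMap c hc).2
      ⟨continuous_proj_cotangent.continuousAt.comp_continuousWithinAt (hf t ht), hd⟩
    have h2 : ∀ τ ∈ Icc (0 : ℝ) 1, ext01 (fun u : I => f u) τ = f τ := fun τ hτ => ext01_mk hτ
    have h3 := h1.congr_mono (t := Icc 0 1) (f₁ := fun τ => (ext01 (fun u : I => f u) τ).proj)
      (fun τ hτ => by rw [h2 τ hτ]) (by rw [h2 t ht]) subset_rfl
    change HasMFDerivWithinAt 𝓘(ℝ, ℝ) 𝓘(ℝ, E) (fun τ => (ext01 (fun u : I => f u) τ).proj) _ _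
      ((1 : ℝ →L[ℝ] ℝ).smulRight (-(α.toMap _ (ext01 (fun u : I => f u) t).2)))
    rw [h2 t ht]
    exact h3

end Constraint

namespace GaugeSquare

variable {α : PoissonStructure E M} {Z B : ℝ → ℝ → CoTangentBundle E M}

/-- The solution `Z(s, ·)`. -/
def row (h : GaugeSquare α Z B) (s : ℝ) (hs : s ∈ Icc (0 : ℝ) 1) : Constraint α :=
  Constraint.ofMap (Z s)
    (h.continuousOn_curve.comp (f := fun u => (s, u)) (by fun_prop) fun u hu => ⟨hs, hu⟩)
    fun u hu => by
      obtain ⟨c, b', -, hb⟩ := h.gaugeEqNear s hs u hu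
      have := hb.self_of_nhdsWithin ⟨hs, hu⟩
      exact ⟨c, this.mem_source, this.base_right⟩

theorem ext01_row (h : GaugeSquare α Z B) {s : ℝ} (hs : s ∈ Icc (0 : ℝ) 1) {u : ℝ}
    (hu : u ∈ Icc (0 : ℝ) 1) : ext01 (h.row s hs).toMap u = Z s u :=
  Constraint.ext01_mk hu

theorem gaugeRelated_row (h : GaugeSquare α Z B) :
    GaugeRelated (h.row 0 (by simp)) (h.row 1 (by simp)) := by
  -- A gauge curve needs a solution for every real s, while rows are solutions only for s in [0,1];
  -- clamping s changes nothing there.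
  refine ⟨fun s => h.row (projIcc 0 1 zero_le_one s) (projIcc 0 1 zero_le_one s).2, B,
    GaugeSquare.isGaugeCurve (h.congr (fun s hs u hu => ?_) fun _ _ _ _ => rfl), ?_, ?_⟩
  · rw [h.ext01_row _ hu, projIcc_of_mem _ hs]
  · simp
  · simp

theorem gaugeRelated (h : GaugeSquare α Z B) {P Q : Constraint α}
    (hP : ∀ u ∈ Icc (0 : ℝ) 1, ext01 P.toMap u = Z 0 u)
    (hQ : ∀ u ∈ Icc (0 : ℝ) 1, ext01 Q.toMap u = Z 1 u) : GaugeRelated P Q := by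
  have h1 : P = h.row 0 (by simp) := Constraint.ext fun u hu => by rw [hP u hu, h.ext01_row _ hu]
  have h2 : Q = h.row 1 (by simp) := Constraint.ext fun u hu => by rw [hQ u hu, h.ext01_row _ hu]
  rw [h1, h2]
  exact h.gaugeRelated_row

end GaugeSquare

end Coordinates

/-! ### Pullback of solutions and gauge curves by maps of the interval. -/

section Coordinates

variable {E : Type*} [NormedAddCommGroup E] [NormedSpace ℝ E]
variable {M : Type*} [TopologicalSpace M] [ChartedSpace E M] [IsManifold 𝓘(ℝ, E) ∞ M]

theorem continuous_scale_uncurried :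
    Continuous (fun q : ℝ × CoTangentBundle E M => scale q.1 q.2) := by
  refine continuous_iff_continuousAt.2 fun q => ?_
  rw [← continuousWithinAt_univ]
  set c : M := q.2.proj with hc
  have hq : q.2.proj ∈ (chartAt E c).source := mem_chart_source E q.2.proj
  have h := ((continuousWithinAt_cotangent_iff c
    (f := fun q : ℝ × CoTangentBundle E M => q.2) (s := univ) (z := q) hq).1
      continuous_snd.continuousWithinAt).2
  have h2 : ContinuousWithinAt
      (fun q : ℝ × CoTangentBundle E M => q.1 • coordCovector c q.2) univ q :=
    continuous_fst.continuousWithinAt.smul h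
  have h1 : ContinuousWithinAt (fun q : ℝ × CoTangentBundle E M => q.2.proj) univ q :=
    (continuous_proj_cotangent.comp continuous_snd).continuousWithinAt
  exact (continuousWithinAt_cotangent_iff c
    (f := fun q : ℝ × CoTangentBundle E M => scale q.1 q.2) hq).2 ⟨h1, h2⟩

/-- The constraint equation in charts, as a property of maps on the real line. -/
def IsSolutionAt (α : PoissonStructure E M) (f : ℝ → CoTangentBundle E M) (c : M) (t : ℝ) : Prop :=
  HasDerivWithinAt (fun τ => extChartAt 𝓘(ℝ, E) c (f τ).proj)
    (-(α.coord c (extChartAt 𝓘(ℝ, E) c (f t).proj) (coordCovector c (f t)))) (Icc 0 1) t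

theorem Constraint.isSolutionAt {α : PoissonStructure E M} (P : Constraint α) {c : M} {t : ℝ}
    (ht : t ∈ Icc (0 : ℝ) 1) (hc : (ext01 P.toMap t).proj ∈ (chartAt E c).source) :
    IsSolutionAt α (ext01 P.toMap) c t :=
  ((hasMFDerivWithinAt_iff_hasDerivWithinAt α.toMap c hc).1 (P.gauss t ht)).2

theorem hasDerivAt_of_contDiff {ρ : ℝ → ℝ} (h : ContDiff ℝ 1 ρ) (t : ℝ) :
    HasDerivAt ρ (deriv ρ t) t :=
  (h.differentiable (by simp) t).hasDerivAt

theorem HasDerivWithinAt.comp_contDiff {F : Type*} [NormedAddCommGroup F] [NormedSpace ℝ F]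
    {f : ℝ → F} {f' : F} {ρ : ℝ → ℝ} (hρ : ContDiff ℝ 1 ρ)
    (hm : MapsTo ρ (Icc 0 1) (Icc 0 1)) {t : ℝ}
    (hf : HasDerivWithinAt f f' (Icc 0 1) (ρ t)) :
    HasDerivWithinAt (fun τ => f (ρ τ)) (deriv ρ t • f') (Icc 0 1) t :=
  hf.scomp t (hasDerivAt_of_contDiff hρ t).hasDerivWithinAt hm

namespace Constraint

variable {α : PoissonStructure E M}

/-- The pullback of a solution by a map `[0,1] → [0,1]`. -/
def reparam (P : Constraint α) (ρ : ℝ → ℝ) (hρ : ContDiff ℝ 1 ρ)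
    (hm : MapsTo ρ (Icc 0 1) (Icc 0 1)) : Constraint α :=
  ofMap (fun u => scale (deriv ρ u) (ext01 P.toMap (ρ u)))
    (continuous_scale_uncurried.comp ((hρ.continuous_deriv le_rfl).prodMk
      (P.continuous_ext01.comp hρ.continuous))).continuousOn
    fun t ht => by
      refine ⟨(ext01 P.toMap (ρ t)).proj, mem_chart_source _ _, ?_⟩
      have h := HasDerivWithinAt.comp_contDiff hρ hm (P.isSolutionAt (hm ht) (mem_chart_source _ _))
      refine h.congr_deriv ?_
      rw [coordCovector_scale, map_smul, smul_neg]
      rfl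

theorem ext01_reparam (P : Constraint α) {ρ : ℝ → ℝ} (hρ : ContDiff ℝ 1 ρ)
    (hm : MapsTo ρ (Icc 0 1) (Icc 0 1)) {t : ℝ} (ht : t ∈ Icc (0 : ℝ) 1) :
    ext01 (P.reparam ρ hρ hm).toMap t = scale (deriv ρ t) (ext01 P.toMap (ρ t)) :=
  ext01_mk (f := fun u => scale (deriv ρ u) (ext01 P.toMap (ρ u))) ht

end Constraint

/-- Gauge equations pull back under a change of the variable `u`. -/
theorem GaugeSquare.gaugeEqNear_reparam {α : PoissonStructure E M}
    {Z B Z' B' : ℝ → ℝ → CoTangentBundle E M} (h : GaugeSquare α Z B) {ρ : ℝ → ℝ}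
    (hρ : ContDiff ℝ 1 ρ) (hm : MapsTo ρ (Icc 0 1) (Icc 0 1)) {s u : ℝ} (hs : s ∈ Icc (0 : ℝ) 1)
    (hu : u ∈ Icc (0 : ℝ) 1)
    (he : ∀ᶠ q in 𝓝[unitSquare] (s, u),
      Z' q.1 q.2 = scale (deriv ρ q.2) (Z q.1 (ρ q.2)) ∧ B' q.1 q.2 = B q.1 (ρ q.2)) :
    GaugeEqNear α Z' B' s u := by
  refine GaugeEqNear.congr (Z := fun s u => scale (deriv ρ u) (Z s (ρ u)))
    (B := fun s u => B s (ρ u)) ?_ he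
  obtain ⟨c, b', hb', hb⟩ := h.gaugeEqNear s hs (ρ u) (hm hu)
  have hρc : Continuous fun q : ℝ × ℝ => (q.1, ρ q.2) := by
    have := hρ.continuous
    fun_prop
  have htend : Filter.Tendsto (fun q : ℝ × ℝ => (q.1, ρ q.2)) (𝓝[unitSquare] (s, u))
      (𝓝[unitSquare] (s, ρ u)) :=
    tendsto_nhdsWithin_iff.2 ⟨hρc.continuousAt.mono_left nhdsWithin_le_nhds,
      eventually_mem_nhdsWithin.mono fun q hq => ⟨hq.1, hm hq.2⟩⟩
  refine ⟨c, fun q => deriv ρ q.2 • b' (q.1, ρ q.2), ?_, ?_⟩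
  · exact ((hρ.continuous_deriv le_rfl).comp continuous_snd).continuousWithinAt.smul
      (hb'.tendsto.comp htend)
  · filter_upwards [htend.eventually hb, eventually_mem_nhdsWithin] with q h1 h2
    refine ⟨h1.mem_source, ?_, h1.base_left, ?_, ?_⟩
    · refine (HasDerivWithinAt.comp_contDiff hρ hm h1.base_right).congr_deriv ?_
      rw [coordCovector_scale, map_smul, smul_neg]
      rfl
    · exact HasDerivWithinAt.comp_contDiff hρ hm h1.param_right
    · refine (h1.form_left.const_smul (deriv ρ q.2)).congr_deriv ?_
      rw [smul_add, ← ContinuousLinearMap.smul_comp]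
      rfl

/-- The pulled back parameter must vanish at both ends, so ρ has to send end points to end points.
No orientation is imposed, in order to include the reversal and loops that return to their starting
point. -/
theorem GaugeSquare.reparam {α : PoissonStructure E M} {Z B : ℝ → ℝ → CoTangentBundle E M}
    (h : GaugeSquare α Z B) {ρ : ℝ → ℝ} (hρ : ContDiff ℝ 1 ρ)
    (hm : MapsTo ρ (Icc 0 1) (Icc 0 1)) (h0 : ρ 0 = 0 ∨ ρ 0 = 1) (h1 : ρ 1 = 0 ∨ ρ 1 = 1) :
    GaugeSquare α (fun s u => scale (deriv ρ u) (Z s (ρ u))) (fun s u => B s (ρ u)) where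
  continuousOn_curve := by
    refine continuous_scale_uncurried.comp_continuousOn
      (((hρ.continuous_deriv le_rfl).comp continuous_snd).continuousOn.prodMk
        (h.continuousOn_curve.comp (f := fun q : ℝ × ℝ => (q.1, ρ q.2)) ?_
          fun q hq => ⟨hq.1, hm hq.2⟩))
    exact (continuous_fst.prodMk (hρ.continuous.comp continuous_snd)).continuousOn
  continuousOn_param := by
    refine h.continuousOn_param.comp (f := fun q : ℝ × ℝ => (q.1, ρ q.2)) ?_
      fun q hq => ⟨hq.1, hm hq.2⟩
    exact (continuous_fst.prodMk (hρ.continuous.comp continuous_snd)).continuousOn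
  proj_param s hs u hu := h.proj_param s hs _ (hm hu)
  param_zero s hs := by
    rcases h0 with h0 | h0 <;> rw [h0]
    exacts [h.param_zero s hs, h.param_one s hs]
  param_one s hs := by
    rcases h1 with h1 | h1 <;> rw [h1]
    exacts [h.param_zero s hs, h.param_one s hs]
  gaugeEqNear s hs u hu :=
    h.gaugeEqNear_reparam hρ hm hs hu (Filter.Eventually.of_forall fun _ => ⟨rfl, rfl⟩)

theorem GaugeRelated.reparam {α : PoissonStructure E M} {P Q : Constraint α}
    (h : GaugeRelated P Q) {ρ : ℝ → ℝ} (hρ : ContDiff ℝ 1 ρ)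
    (hm : MapsTo ρ (Icc 0 1) (Icc 0 1)) (h0 : ρ 0 = 0 ∨ ρ 0 = 1) (h1 : ρ 1 = 0 ∨ ρ 1 = 1) :
    GaugeRelated (P.reparam ρ hρ hm) (Q.reparam ρ hρ hm) := by
  obtain ⟨Γ, β, hΓ, rfl, rfl⟩ := h
  exact (hΓ.gaugeSquare.reparam hρ hm h0 h1).gaugeRelated
    (fun u hu => Constraint.ext01_reparam _ hρ hm hu)
    (fun u hu => Constraint.ext01_reparam _ hρ hm hu)

theorem mapsTo_one_sub : MapsTo (fun u : ℝ => 1 - u) (Icc 0 1) (Icc 0 1) :=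
  fun u hu => ⟨by linarith [hu.2], by linarith [hu.1]⟩

theorem reverse_eq_reparam {α : PoissonStructure E M} (P : Constraint α) :
    P.reverse = P.reparam (fun u => 1 - u) (by fun_prop) mapsTo_one_sub := by
  refine Constraint.ext fun u hu => ?_
  rw [Constraint.ext01_reparam _ _ _ hu]
  have h1 : deriv (fun u : ℝ => 1 - u) u = -1 := by simp
  have h2 : (1 - u) ∈ Icc (0 : ℝ) 1 := ⟨by linarith [hu.2], by linarith [hu.1]⟩
  rw [h1]
  change scale (-1) (P.toMap (σ (projIcc 0 1 zero_le_one u))) = scale (-1) (P.toMap _)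
  congr 2
  apply Subtype.ext
  rw [unitInterval.coe_symm_eq, projIcc_of_mem _ hu, projIcc_of_mem _ h2]

/-- The endpoints of the base path are constant along a gauge square. -/
theorem GaugeSquare.proj_const {α : PoissonStructure E M} {Z B : ℝ → ℝ → CoTangentBundle E M}
    (h : GaugeSquare α Z B) {u : ℝ} (hu : u ∈ Icc (0 : ℝ) 1)
    (hB : ∀ s ∈ Icc (0 : ℝ) 1, (B s u).2 = 0) {a b : ℝ} (ha : a ∈ Icc (0 : ℝ) 1)
    (hb : b ∈ Icc (0 : ℝ) 1) : (Z a u).proj = (Z b u).proj := by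
  have hc : ContinuousOn (fun s => (Z s u).proj) (Icc 0 1) :=
    h.continuousOn_proj.comp (f := fun s : ℝ => (s, u)) (by fun_prop) fun s hs => ⟨hs, hu⟩
  -- Where the parameter vanishes, the s-derivative of the base point is zero in a chart, so the
  -- base point is locally constant in s; connectedness of [0,1] concludes.
  have hloc : ∀ s ∈ Icc (0 : ℝ) 1, ∀ᶠ r in 𝓝[Icc 0 1] s, (Z r u).proj = (Z s u).proj := by
    intro s hs
    set c := (Z s u).proj with hcdef
    have hsrc : ∀ᶠ r in 𝓝[Icc 0 1] s, (Z r u).proj ∈ (chartAt E c).source :=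
      hc s hs ((chartAt E c).open_source.mem_nhds (mem_chart_source _ _))
    obtain ⟨ε, hε, hball⟩ := Metric.mem_nhdsWithin_iff.1 hsrc
    have hder : ∀ r ∈ Metric.ball s ε ∩ Icc 0 1,
        HasDerivWithinAt (fun r => extChartAt 𝓘(ℝ, E) c (Z r u).proj) 0
          (Metric.ball s ε ∩ Icc 0 1) r := by
      intro r hr
      obtain ⟨b', -, hb⟩ := h.exists_gaugeEq (s := r) (u := u) ⟨hr.2, hu⟩ (hball hr)
      have := (hb.self_of_nhdsWithin ⟨hr.2, hu⟩).base_left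
      rw [coordCovector_of_snd_eq_zero c (hB r hr.2), map_zero, neg_zero] at this
      exact this.mono inter_subset_right
    have hconv : Convex ℝ (Metric.ball s ε ∩ Icc 0 1) := (convex_ball s ε).inter (convex_Icc 0 1)
    refine Metric.mem_nhdsWithin_iff.2 ⟨ε, hε, fun r hr => ?_⟩
    have h0 := hconv.norm_image_sub_le_of_norm_hasDerivWithin_le (C := 0) hder (by simp)
      (show s ∈ Metric.ball s ε ∩ Icc 0 1 from ⟨Metric.mem_ball_self hε, hs⟩) hr
    rw [zero_mul, norm_le_zero_iff, sub_eq_zero] at h0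
    have h1 := (extChartAt 𝓘(ℝ, E) c).injOn (by simpa using hball hr)
      (by simp [hcdef]) h0
    exact h1
  exact isPreconnected_Icc.induction₂ (fun r s => (Z r u).proj = (Z s u).proj)
    (fun s hs => (hloc s hs).mono fun r hr => hr.symm) (fun _ _ _ _ _ _ => Eq.trans)
    (fun _ _ _ _ => Eq.symm) ha hb

end Coordinates

/-! ### Homotopy invariance of pullbacks of smooth solutions. -/

section Coordinates

variable {E : Type*} [NormedAddCommGroup E] [NormedSpace ℝ E]
variable {M : Type*} [TopologicalSpace M] [ChartedSpace E M] [IsManifold 𝓘(ℝ, E) ∞ M]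

/-- Every condition on a gauge square is local in the unit square or concerns single points, so a
square may be assembled from pieces that agree with genuine squares locally. -/
theorem GaugeSquare.of_locally_eq {α : PoissonStructure E M}
    {Z B : ℝ → ℝ → CoTangentBundle E M}
    (h : ∀ s ∈ Icc (0 : ℝ) 1, ∀ u ∈ Icc (0 : ℝ) 1, ∃ Z₁ B₁, GaugeSquare α Z₁ B₁ ∧
      ∀ᶠ q in 𝓝[unitSquare] (s, u), Z q.1 q.2 = Z₁ q.1 q.2 ∧ B q.1 q.2 = B₁ q.1 q.2) :
    GaugeSquare α Z B where
  continuousOn_curve := by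
    rintro ⟨s, u⟩ hq
    obtain ⟨Z₁, B₁, h1, he⟩ := h s hq.1 u hq.2
    exact (h1.continuousOn_curve _ hq).congr_of_eventuallyEq (he.mono fun _ hr => hr.1)
      (he.self_of_nhdsWithin hq).1
  continuousOn_param := by
    rintro ⟨s, u⟩ hq
    obtain ⟨Z₁, B₁, h1, he⟩ := h s hq.1 u hq.2
    exact (h1.continuousOn_param _ hq).congr_of_eventuallyEq (he.mono fun _ hr => hr.2)
      (he.self_of_nhdsWithin hq).2
  proj_param s hs u hu := by
    obtain ⟨Z₁, B₁, h1, he⟩ := h s hs u hu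
    have h2 := he.self_of_nhdsWithin ⟨hs, hu⟩
    dsimp only at h2
    rw [h2.1, h2.2, h1.proj_param s hs u hu]
  param_zero s hs := by
    obtain ⟨Z₁, B₁, h1, he⟩ := h s hs 0 (by simp)
    have h2 := (he.self_of_nhdsWithin ⟨hs, by simp⟩).2
    dsimp only at h2
    rw [h2, h1.param_zero s hs]
  param_one s hs := by
    obtain ⟨Z₁, B₁, h1, he⟩ := h s hs 1 (by simp)
    have h2 := (he.self_of_nhdsWithin ⟨hs, by simp⟩).2
    dsimp only at h2
    rw [h2, h1.param_one s hs]
  gaugeEqNear s hs u hu := by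
    obtain ⟨Z₁, B₁, h1, he⟩ := h s hs u hu
    exact (h1.gaugeEqNear s hs u hu).congr he

theorem Constraint.Smooth.contDiffWithinAt {α : PoissonStructure E M} {P : Constraint α}
    (hP : P.Smooth) {c : M} {t : ℝ} (ht : t ∈ Icc (0 : ℝ) 1)
    (hc : (ext01 P.toMap t).proj ∈ (chartAt E c).source) :
    ContDiffWithinAt ℝ ∞ (fun τ => coordCovector c (ext01 P.toMap τ)) (Icc 0 1) t :=
  ((contMDiffWithinAt_cotangent_iff c hc
    (continuous_proj_cotangent.comp P.continuous_ext01).continuousWithinAt).1 (hP t ht)).2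

/-- Pullbacks of a smooth solution by maps of the interval with the same endpoints are gauge
equivalent. -/
theorem Constraint.Smooth.gaugeRelated_reparam {α : PoissonStructure E M} {P : Constraint α}
    (hP : P.Smooth) {ρ₀ ρ₁ : ℝ → ℝ} (h₀ : ContDiff ℝ 1 ρ₀) (h₁ : ContDiff ℝ 1 ρ₁)
    (m₀ : MapsTo ρ₀ (Icc 0 1) (Icc 0 1)) (m₁ : MapsTo ρ₁ (Icc 0 1) (Icc 0 1))
    (e₀ : ρ₀ 0 = ρ₁ 0) (e₁ : ρ₀ 1 = ρ₁ 1) :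
    GaugeRelated (P.reparam ρ₀ h₀ m₀) (P.reparam ρ₁ h₁ m₁) := by
  -- The convex homotopy φ stays in [0,1]. Moving s displaces the base curve by ∂ₛφ · X'(φ) =
  -- -A(X)(d η(φ)), so the gauge parameter is forced to be d η(φ), with d = ρ₁ - ρ₀.
  set φ : ℝ → ℝ → ℝ := fun s u => (1 - s) * ρ₀ u + s * ρ₁ u with hφ
  set φ' : ℝ → ℝ → ℝ := fun s u => (1 - s) * deriv ρ₀ u + s * deriv ρ₁ u with hφ'
  set d : ℝ → ℝ := fun u => ρ₁ u - ρ₀ u with hd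
  set Z : ℝ → ℝ → CoTangentBundle E M := fun s u => scale (φ' s u) (ext01 P.toMap (φ s u))
  set B : ℝ → ℝ → CoTangentBundle E M := fun s u => scale (d u) (ext01 P.toMap (φ s u))
  have c0 := h₀.continuous
  have c1 := h₁.continuous
  have c0' := h₀.continuous_deriv le_rfl
  have c1' := h₁.continuous_deriv le_rfl
  have cφ : Continuous fun q : ℝ × ℝ => φ q.1 q.2 := by simp only [hφ]; fun_prop
  have cφ' : Continuous fun q : ℝ × ℝ => φ' q.1 q.2 := by simp only [hφ']; fun_prop
  have cd : Continuous d := by simp only [hd]; fun_prop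
  have mφ : ∀ q ∈ unitSquare, φ q.1 q.2 ∈ Icc (0 : ℝ) 1 := fun q hq =>
    convex_Icc (0 : ℝ) 1 (m₀ hq.2) (m₁ hq.2) (by linarith [hq.1.2]) hq.1.1 (by ring)
  have dφ : ∀ s u, HasDerivAt (φ s) (φ' s u) u := fun s u =>
    ((hasDerivAt_of_contDiff h₀ u).const_mul (1 - s)).add
      ((hasDerivAt_of_contDiff h₁ u).const_mul s)
  have dφs : ∀ s u, HasDerivAt (fun r => φ r u) (d u) s := fun s u => by
    have := (((hasDerivAt_id s).const_sub 1).mul_const (ρ₀ u)).add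
      ((hasDerivAt_id s).mul_const (ρ₁ u))
    exact this.congr_deriv (by simp only [hd]; ring)
  have dφ's : ∀ s u, HasDerivAt (fun r => φ' r u) (deriv ρ₁ u - deriv ρ₀ u) s := fun s u => by
    have := (((hasDerivAt_id s).const_sub 1).mul_const (deriv ρ₀ u)).add
      ((hasDerivAt_id s).mul_const (deriv ρ₁ u))
    exact this.congr_deriv (by ring)
  have dd : ∀ u, HasDerivAt d (deriv ρ₁ u - deriv ρ₀ u) u := fun u =>
    (hasDerivAt_of_contDiff h₁ u).sub (hasDerivAt_of_contDiff h₀ u)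
  have hsq : GaugeSquare α Z B := by
    refine ⟨?_, ?_, fun s _ u _ => rfl, fun s _ => ?_, fun s _ => ?_, fun s hs u hu => ?_⟩
    · exact (continuous_scale_uncurried.comp
        (cφ'.prodMk (P.continuous_ext01.comp cφ))).continuousOn
    · exact (continuous_scale_uncurried.comp
        ((cd.comp continuous_snd).prodMk (P.continuous_ext01.comp cφ))).continuousOn
    · have h0 : d 0 = 0 := by simp only [hd, e₀, sub_self]
      change d 0 • (ext01 P.toMap (φ s 0)).2 = 0
      rw [h0]
      exact zero_smul ℝ _
    · have h0 : d 1 = 0 := by simp only [hd, e₁, sub_self]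
      change d 1 • (ext01 P.toMap (φ s 1)).2 = 0
      rw [h0]
      exact zero_smul ℝ _
    set c : M := (ext01 P.toMap (φ s u)).proj
    have hc : (ext01 P.toMap (φ s u)).proj ∈ (chartAt E c).source := mem_chart_source _ _
    set p : ℝ → E →L[ℝ] ℝ := fun τ => coordCovector c (ext01 P.toMap τ) with hp
    have hpd : ContinuousWithinAt (derivWithin p (Icc 0 1)) (Icc 0 1) (φ s u) :=
      (ContDiffWithinAt.fderivWithin_right (m := 0)
        (hP.contDiffWithinAt (mφ (s, u) ⟨hs, hu⟩) hc) uniqueDiffOn_Icc_zero_one (by simp)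
        (mφ (s, u) ⟨hs, hu⟩)).continuousWithinAt.clm_apply continuousWithinAt_const
    have htend : Filter.Tendsto (fun q : ℝ × ℝ => φ q.1 q.2) (𝓝[unitSquare] (s, u))
        (𝓝[Icc 0 1] (φ s u)) :=
      tendsto_nhdsWithin_iff.2 ⟨cφ.continuousAt.mono_left nhdsWithin_le_nhds,
        eventually_mem_nhdsWithin.mono mφ⟩
    have hpc : Filter.Tendsto (fun q : ℝ × ℝ => p (φ q.1 q.2)) (𝓝[unitSquare] (s, u))
        (𝓝 (p (φ s u))) :=
      (hP.contDiffWithinAt (mφ (s, u) ⟨hs, hu⟩) hc).continuousWithinAt.tendsto.comp htend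
    refine ⟨c, fun q => d q.2 • (φ' q.1 q.2 • derivWithin p (Icc 0 1) (φ q.1 q.2)) +
      (deriv ρ₁ q.2 - deriv ρ₀ q.2) • p (φ q.1 q.2), ?_, ?_⟩
    · refine ((cd.comp continuous_snd).continuousWithinAt.smul
        (cφ'.continuousWithinAt.smul (hpd.tendsto.comp htend))).add
        (((c1'.comp continuous_snd).sub (c0'.comp continuous_snd)).continuousWithinAt.smul hpc)
    · have hsrc : ∀ᶠ τ in 𝓝[Icc 0 1] (φ s u), (ext01 P.toMap τ).proj ∈ (chartAt E c).source :=
        (continuous_proj_cotangent.comp P.continuous_ext01).continuousWithinAt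
          ((chartAt E c).open_source.mem_nhds hc)
      filter_upwards [htend.eventually hsrc, eventually_mem_nhdsWithin] with q h1 h2
      have hx := P.isSolutionAt (mφ q h2) h1
      have hpq := ((hP.contDiffWithinAt (mφ q h2) h1).differentiableWithinAt
        (by simp)).hasDerivWithinAt
      have mr : MapsTo (fun v => φ q.1 v) (Icc 0 1) (Icc 0 1) := fun v hv => mφ (q.1, v) ⟨h2.1, hv⟩
      have ml : MapsTo (fun r => φ r q.2) (Icc 0 1) (Icc 0 1) := fun r hr => mφ (r, q.2) ⟨hr, h2.2⟩
      have hpr := hpq.scomp q.2 (dφ q.1 q.2).hasDerivWithinAt mr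
      have hpl := HasDerivWithinAt.scomp (h := fun r => φ r q.2) q.1 hpq
        (dφs q.1 q.2).hasDerivWithinAt ml
      refine ⟨h1, ?_, ?_, ?_, ?_⟩
      · refine (hx.scomp q.2 (dφ q.1 q.2).hasDerivWithinAt mr).congr_deriv ?_
        simp only [Z, coordCovector_scale, map_smul, smul_neg]
        rfl
      · refine (HasDerivWithinAt.scomp (h := fun r => φ r q.2) q.1 hx
          (dφs q.1 q.2).hasDerivWithinAt ml).congr_deriv ?_
        simp only [B, Z, coordCovector_scale, map_smul, smul_neg]
        rfl
      · exact (dd q.2).hasDerivWithinAt.smul hpr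
      · refine ((dφ's q.1 q.2).hasDerivWithinAt.smul hpl).congr_deriv ?_
        ext w
        -- The form and the parameter are multiples of the same covector, so the quadratic term
        -- vanishes by skewness of the derivative of A.
        have hsk := α.fderiv_coord_skew (extChartAt_mem_target h1) w (p (φ q.1 q.2)) (p (φ q.1 q.2))
        have hsk' : p (φ q.1 q.2) (fderiv ℝ (α.coord c)
            (extChartAt 𝓘(ℝ, E) c (ext01 P.toMap (φ q.1 q.2)).proj) w (p (φ q.1 q.2))) = 0 := by
          linarith
        have e1 : coordCovector c (Z q.1 q.2) = φ' q.1 q.2 • p (φ q.1 q.2) := rfl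
        have e2 : coordCovector c (B q.1 q.2) = d q.2 • p (φ q.1 q.2) := rfl
        have e3 : (Z q.1 q.2).proj = (ext01 P.toMap (φ q.1 q.2)).proj := rfl
        rw [e1, e2, e3]
        simp only [add_apply, ContinuousLinearMap.comp_apply, ContinuousLinearMap.flip_apply,
          smul_apply, map_smul, hsk', smul_eq_mul, Function.comp]
        ring
  refine hsq.gaugeRelated (fun u hu => ?_) (fun u hu => ?_)
  · rw [Constraint.ext01_reparam _ _ _ hu]
    simp [Z, hφ, hφ']
  · rw [Constraint.ext01_reparam _ _ _ hu]
    simp [Z, hφ, hφ']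

end Coordinates

/-! ### Flattening near the end points and concatenation of gauge curves. -/

section Coordinates

variable {E : Type*} [NormedAddCommGroup E] [NormedSpace ℝ E]
variable {M : Type*} [TopologicalSpace M] [ChartedSpace E M] [IsManifold 𝓘(ℝ, E) ∞ M]

/-- A smooth map `ℝ → [0,1]` equal to `0` before `1/3` and to `1` after `2/3`. -/
def flatten (u : ℝ) : ℝ := Real.smoothTransition (3 * u - 1)

theorem contDiff_flatten : ContDiff ℝ ∞ flatten :=
  Real.smoothTransition.contDiff.comp (by fun_prop)

theorem flatten_mem (u : ℝ) : flatten u ∈ Icc (0 : ℝ) 1 :=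
  ⟨Real.smoothTransition.nonneg _, Real.smoothTransition.le_one _⟩

theorem flatten_of_le {u : ℝ} (h : u ≤ 1 / 3) : flatten u = 0 :=
  Real.smoothTransition.zero_of_nonpos (by linarith)

theorem flatten_of_ge {u : ℝ} (h : 2 / 3 ≤ u) : flatten u = 1 :=
  Real.smoothTransition.one_of_one_le (by linarith)

theorem deriv_flatten_of_lt {u : ℝ} (h : u < 1 / 3) : deriv flatten u = 0 := by
  have : flatten =ᶠ[𝓝 u] fun _ => 0 := by
    filter_upwards [Iio_mem_nhds h] with v hv using flatten_of_le (le_of_lt hv)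
  rw [this.deriv_eq, deriv_const]

theorem deriv_flatten_of_gt {u : ℝ} (h : 2 / 3 < u) : deriv flatten u = 0 := by
  have : flatten =ᶠ[𝓝 u] fun _ => 1 := by
    filter_upwards [Ioi_mem_nhds h] with v hv using flatten_of_ge (le_of_lt hv)
  rw [this.deriv_eq, deriv_const]

/-- `flatten` on the subinterval with affine coordinate `k u - a`. -/
def flattenAt (k a u : ℝ) : ℝ := flatten (k * u - a)

theorem contDiff_flattenAt (k a : ℝ) : ContDiff ℝ 1 (flattenAt k a) :=
  (contDiff_flatten.of_le (by simp)).comp (by fun_prop)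

theorem mapsTo_flattenAt (k a : ℝ) : MapsTo (flattenAt k a) (Icc 0 1) (Icc 0 1) :=
  fun _ _ => flatten_mem _

theorem flattenAt_of_le {k a u : ℝ} (h : k * u - a ≤ 1 / 3) : flattenAt k a u = 0 :=
  flatten_of_le h

theorem flattenAt_of_ge {k a u : ℝ} (h : 2 / 3 ≤ k * u - a) : flattenAt k a u = 1 :=
  flatten_of_ge h

theorem hasDerivAt_flattenAt (k a u : ℝ) :
    HasDerivAt (flattenAt k a) (k * deriv flatten (k * u - a)) u := by
  have h1 : HasDerivAt (fun u => k * u - a) k u := by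
    simpa using ((hasDerivAt_id u).const_mul k).sub_const a
  have h2 := hasDerivAt_of_contDiff (contDiff_flatten.of_le (by simp)) (k * u - a)
  exact (h2.comp u h1).congr_deriv (by ring)

theorem deriv_flattenAt (k a u : ℝ) :
    deriv (flattenAt k a) u = k * deriv flatten (k * u - a) :=
  (hasDerivAt_flattenAt k a u).deriv

theorem deriv_flattenAt_of_lt {k a u : ℝ} (h : k * u - a < 1 / 3) : deriv (flattenAt k a) u = 0 := by
  rw [deriv_flattenAt, deriv_flatten_of_lt h, mul_zero]

theorem deriv_flattenAt_of_gt {k a u : ℝ} (h : 2 / 3 < k * u - a) : deriv (flattenAt k a) u = 0 := by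
  rw [deriv_flattenAt, deriv_flatten_of_gt h, mul_zero]

theorem scale_zero_congr {p q : CoTangentBundle E M} (h : p.proj = q.proj) :
    scale 0 p = scale 0 q := by
  obtain ⟨x, ξ⟩ := p
  obtain ⟨y, ζ⟩ := q
  change x = y at h
  subst h
  change (⟨x, (0 : ℝ) • ξ⟩ : CoTangentBundle E M) = ⟨x, (0 : ℝ) • ζ⟩
  rw [zero_smul, zero_smul]

theorem eq_of_snd_eq_zero {p q : CoTangentBundle E M} (h : p.proj = q.proj) (hp : p.2 = 0)
    (hq : q.2 = 0) : p = q := by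
  obtain ⟨x, ξ⟩ := p
  obtain ⟨y, ζ⟩ := q
  change x = y at h
  subst h
  change ξ = 0 at hp
  change ζ = 0 at hq
  rw [hp, hq]

theorem scale_scale (a b : ℝ) (p : CoTangentBundle E M) : scale a (scale b p) = scale (a * b) p := by
  obtain ⟨x, ξ⟩ := p
  change (⟨x, a • b • ξ⟩ : CoTangentBundle E M) = ⟨x, (a * b) • ξ⟩
  rw [smul_smul]

theorem scale_one (p : CoTangentBundle E M) : scale 1 p = p := by
  obtain ⟨x, ξ⟩ := p
  change (⟨x, (1 : ℝ) • ξ⟩ : CoTangentBundle E M) = ⟨x, ξ⟩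
  rw [one_smul]

theorem scale_proj (a : ℝ) (p : CoTangentBundle E M) : (scale a p).proj = p.proj := rfl

theorem scale_of_snd_eq_zero {p : CoTangentBundle E M} (h : p.2 = 0) (a : ℝ) : scale a p = p :=
  eq_of_snd_eq_zero rfl (by
    change a • p.2 = 0
    rw [h]
    exact smul_zero (A := TangentSpace 𝓘(ℝ, E) p.proj →L[ℝ] ℝ) a) h

theorem scale_zero_snd (p : CoTangentBundle E M) : (scale 0 p).2 = 0 :=
  zero_smul ℝ (A := TangentSpace 𝓘(ℝ, E) p.proj →L[ℝ] ℝ) p.2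

/-- Concatenation of two families of solutions, flattened near their endpoints. -/
def glue (D₁ D₂ : ℝ → ℝ) (Z₁ Z₂ : ℝ → ℝ → CoTangentBundle E M) (s u : ℝ) : CoTangentBundle E M :=
  if u ≤ 1 / 2 then scale (D₁ u) (Z₁ s (flattenAt 2 0 u)) else
    scale (D₂ u) (Z₂ s (flattenAt 2 1 u))

/-- After flattening, the first family rests at its end point for u ≥ 1/3 and the second at its
starting point for u ≤ 2/3, both with zero form. Near 1/2 they coincide, so around every point the
glued family equals one of the two pulled back squares. -/
theorem GaugeSquare.glue {α : PoissonStructure E M} {Z₁ B₁ Z₂ B₂ : ℝ → ℝ → CoTangentBundle E M}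
    (h₁ : GaugeSquare α Z₁ B₁) (h₂ : GaugeSquare α Z₂ B₂)
    (h : ∀ s ∈ Icc (0 : ℝ) 1, (Z₁ s 1).proj = (Z₂ s 0).proj) :
    GaugeSquare α (glue (deriv (flattenAt 2 0)) (deriv (flattenAt 2 1)) Z₁ Z₂)
      (PoissonSigma.glue 1 1 B₁ B₂) := by
  have g₁ := h₁.reparam (contDiff_flattenAt 2 0) (mapsTo_flattenAt 2 0)
    (Or.inl (flattenAt_of_le (by norm_num))) (Or.inr (flattenAt_of_ge (by norm_num)))
  have g₂ := h₂.reparam (contDiff_flattenAt 2 1) (mapsTo_flattenAt 2 1)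
    (Or.inl (flattenAt_of_le (by norm_num))) (Or.inr (flattenAt_of_ge (by norm_num)))
  refine GaugeSquare.of_locally_eq fun s hs u hu => ?_
  -- The regions u < 7/12 and u > 5/12 are open, cover the interval and meet the other half only
  -- inside (1/3, 2/3), where both families are at rest.
  rcases lt_or_ge u (7 / 12) with hu' | hu'
  · refine ⟨_, _, g₁, ?_⟩
    have hn : ∀ᶠ q : ℝ × ℝ in 𝓝[unitSquare] (s, u), q.2 < 7 / 12 :=
      nhdsWithin_le_nhds (continuous_snd.continuousAt.eventually (Iio_mem_nhds hu'))
    filter_upwards [hn, eventually_mem_nhdsWithin] with q h1 h2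
    unfold PoissonSigma.glue
    split_ifs with h3
    · exact ⟨rfl, scale_one _⟩
    · push Not at h3
      rw [deriv_flattenAt_of_lt (by linarith), deriv_flattenAt_of_gt (by linarith),
        flattenAt_of_ge (k := 2) (a := 0) (by linarith),
        flattenAt_of_le (k := 2) (a := 1) (by linarith)]
      refine ⟨scale_zero_congr (h _ h2.1).symm, ?_⟩
      rw [Pi.one_apply, scale_one]
      exact eq_of_snd_eq_zero (by
        rw [h₂.proj_param _ h2.1 _ (by simp), h₁.proj_param _ h2.1 _ (by simp), h _ h2.1])
        (h₂.param_zero _ h2.1) (h₁.param_one _ h2.1)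
  · refine ⟨_, _, g₂, ?_⟩
    have hn : ∀ᶠ q : ℝ × ℝ in 𝓝[unitSquare] (s, u), 5 / 12 < q.2 :=
      nhdsWithin_le_nhds (continuous_snd.continuousAt.eventually (Ioi_mem_nhds (by linarith)))
    filter_upwards [hn, eventually_mem_nhdsWithin] with q h1 h2
    unfold PoissonSigma.glue
    split_ifs with h3
    · rw [deriv_flattenAt_of_gt (by linarith), deriv_flattenAt_of_lt (by linarith),
        flattenAt_of_ge (k := 2) (a := 0) (by linarith),
        flattenAt_of_le (k := 2) (a := 1) (by linarith)]
      refine ⟨scale_zero_congr (h _ h2.1), ?_⟩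
      rw [Pi.one_apply, scale_one]
      exact eq_of_snd_eq_zero (by
        rw [h₂.proj_param _ h2.1 _ (by simp), h₁.proj_param _ h2.1 _ (by simp), h _ h2.1])
        (h₁.param_one _ h2.1) (h₂.param_zero _ h2.1)
    · exact ⟨rfl, scale_one _⟩

theorem Constraint.ext01_zero {α : PoissonStructure E M} (P : Constraint α) :
    ext01 P.toMap 0 = P.toMap 0 := by simp [ext01]

theorem Constraint.ext01_one {α : PoissonStructure E M} (P : Constraint α) :
    ext01 P.toMap 1 = P.toMap 1 := by simp [ext01]

namespace Constraint

variable {α : PoissonStructure E M}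

/-- Pullback by `flatten`: its one-form vanishes near the endpoints. -/
def flat (P : Constraint α) : Constraint α :=
  P.reparam (flattenAt 1 0) (contDiff_flattenAt 1 0) (mapsTo_flattenAt 1 0)

theorem left_eq (P : Constraint α) : P.left = (ext01 P.toMap 0).proj := by
  rw [ext01_zero]; rfl

theorem right_eq (P : Constraint α) : P.right = (ext01 P.toMap 1).proj := by
  rw [ext01_one]; rfl

theorem reparam_left (P : Constraint α) {ρ : ℝ → ℝ} (hρ : ContDiff ℝ 1 ρ)
    (hm : MapsTo ρ (Icc 0 1) (Icc 0 1)) : (P.reparam ρ hρ hm).left = (ext01 P.toMap (ρ 0)).proj := by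
  rw [left_eq, ext01_reparam _ _ _ (by simp), scale_proj]

theorem reparam_right (P : Constraint α) {ρ : ℝ → ℝ} (hρ : ContDiff ℝ 1 ρ)
    (hm : MapsTo ρ (Icc 0 1) (Icc 0 1)) :
    (P.reparam ρ hρ hm).right = (ext01 P.toMap (ρ 1)).proj := by
  rw [right_eq, ext01_reparam _ _ _ (by simp), scale_proj]

theorem flat_left (P : Constraint α) : P.flat.left = P.left := by
  rw [flat, reparam_left, flattenAt_of_le (by norm_num), left_eq]

theorem flat_right (P : Constraint α) : P.flat.right = P.right := by
  rw [flat, reparam_right, flattenAt_of_ge (by norm_num), right_eq]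

theorem flat_normalized (P : Constraint α) : P.flat.Normalized := by
  constructor
  · rw [← ext01_zero, flat, ext01_reparam _ _ _ (by simp), deriv_flattenAt_of_lt (by norm_num)]
    exact scale_zero_snd _
  · rw [← ext01_one, flat, ext01_reparam _ _ _ (by simp), deriv_flattenAt_of_gt (by norm_num)]
    exact scale_zero_snd _

theorem ext01_concat_of_le (P Q : Constraint α) (hP : P.Normalized) (hQ : Q.Normalized)
    (h : P.right = Q.left) {u : ℝ} (h0 : 0 ≤ u) (h1 : u ≤ 1 / 2) :
    ext01 (P.concat Q hP hQ h).toMap u = scale 2 (ext01 P.toMap (2 * u)) :=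
  (ext01_mk (f := concatMap P Q) ⟨h0, by linarith⟩).trans (concatMap_of_le P Q h1)

theorem ext01_concat_of_ge (P Q : Constraint α) (hP : P.Normalized) (hQ : Q.Normalized)
    (h : P.right = Q.left) {u : ℝ} (h0 : 1 / 2 ≤ u) (h1 : u ≤ 1) :
    ext01 (P.concat Q hP hQ h).toMap u = scale 2 (ext01 Q.toMap (2 * u - 1)) :=
  (ext01_mk (f := concatMap P Q) ⟨by linarith, h1⟩).trans (concatMap_of_ge P Q hP hQ h h0)

theorem concat_left (P Q : Constraint α) (hP : P.Normalized) (hQ : Q.Normalized)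
    (h : P.right = Q.left) : (P.concat Q hP hQ h).left = P.left := by
  rw [left_eq, ext01_concat_of_le _ _ _ _ _ le_rfl (by norm_num), scale_proj, mul_zero, left_eq]

theorem concat_right (P Q : Constraint α) (hP : P.Normalized) (hQ : Q.Normalized)
    (h : P.right = Q.left) : (P.concat Q hP hQ h).right = Q.right := by
  rw [right_eq, ext01_concat_of_ge _ _ _ _ _ (by norm_num) le_rfl, scale_proj, right_eq]
  norm_num

theorem concat_normalized (P Q : Constraint α) (hP : P.Normalized) (hQ : Q.Normalized)
    (h : P.right = Q.left) : (P.concat Q hP hQ h).Normalized := by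
  constructor
  · rw [← ext01_zero, ext01_concat_of_le _ _ _ _ _ le_rfl (by norm_num), mul_zero, ext01_zero,
      scale_of_snd_eq_zero hP.1]
    exact hP.1
  · rw [← ext01_one, ext01_concat_of_ge _ _ _ _ _ (by norm_num) le_rfl]
    rw [show (2 * 1 - 1 : ℝ) = 1 by norm_num, ext01_one, scale_of_snd_eq_zero hQ.2]
    exact hQ.2

/-- Concatenation of flattened solutions. -/
def flatConcat (P Q : Constraint α) (h : P.right = Q.left) : Constraint α :=
  P.flat.concat Q.flat P.flat_normalized Q.flat_normalized (by rw [flat_right, flat_left, h])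

/-- The factor 2 of the concatenation and the derivative of the flattening combine into the
derivative of `flattenAt 2 0` or `flattenAt 2 1`. In this form the solution is a row of a glued
square. -/
theorem ext01_flatConcat (P Q : Constraint α) (h : P.right = Q.left) {u : ℝ}
    (hu : u ∈ Icc (0 : ℝ) 1) : ext01 (flatConcat P Q h).toMap u =
      glue (deriv (flattenAt 2 0)) (deriv (flattenAt 2 1)) (fun _ => ext01 P.toMap)
        (fun _ => ext01 Q.toMap) 0 u := by
  unfold glue flatConcat
  split_ifs with h1
  · rw [ext01_concat_of_le _ _ _ _ _ hu.1 h1, flat,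
      ext01_reparam _ _ _ ⟨by linarith [hu.1], by linarith⟩, scale_scale]
    congr 1
    · rw [deriv_flattenAt, deriv_flattenAt]; ring_nf
    · unfold flattenAt; ring_nf
  · push Not at h1
    rw [ext01_concat_of_ge _ _ _ _ _ h1.le hu.2, flat,
      ext01_reparam _ _ _ ⟨by linarith [hu.1], by linarith [hu.2]⟩, scale_scale]
    congr 1
    · rw [deriv_flattenAt, deriv_flattenAt]; ring_nf
    · unfold flattenAt; ring_nf

end Constraint

theorem IsGaugeCurve.left_eq {α : PoissonStructure E M} {Γ : ℝ → Constraint α}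
    {β : ℝ → ℝ → CoTangentBundle E M} (h : IsGaugeCurve Γ β) {a b : ℝ} (ha : a ∈ Icc (0 : ℝ) 1)
    (hb : b ∈ Icc (0 : ℝ) 1) : (Γ a).left = (Γ b).left := by
  rw [Constraint.left_eq, Constraint.left_eq]
  exact h.gaugeSquare.proj_const (by simp) h.param_zero ha hb

theorem IsGaugeCurve.right_eq {α : PoissonStructure E M} {Γ : ℝ → Constraint α}
    {β : ℝ → ℝ → CoTangentBundle E M} (h : IsGaugeCurve Γ β) {a b : ℝ} (ha : a ∈ Icc (0 : ℝ) 1)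
    (hb : b ∈ Icc (0 : ℝ) 1) : (Γ a).right = (Γ b).right := by
  rw [Constraint.right_eq, Constraint.right_eq]
  exact h.gaugeSquare.proj_const (by simp) h.param_one ha hb

theorem GaugeRelated.left_eq {α : PoissonStructure E M} {P Q : Constraint α}
    (h : GaugeRelated P Q) : P.left = Q.left := by
  obtain ⟨Γ, β, hΓ, rfl, rfl⟩ := h
  exact hΓ.left_eq (by simp) (by simp)

theorem GaugeRelated.right_eq {α : PoissonStructure E M} {P Q : Constraint α}
    (h : GaugeRelated P Q) : P.right = Q.right := by
  obtain ⟨Γ, β, hΓ, rfl, rfl⟩ := h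
  exact hΓ.right_eq (by simp) (by simp)

/-- The constant gauge square. -/
theorem Constraint.gaugeSquare {α : PoissonStructure E M} (P : Constraint α) :
    GaugeSquare α (fun _ => ext01 P.toMap) (fun _ u => scale 0 (ext01 P.toMap u)) where
  continuousOn_curve := (P.continuous_ext01.comp continuous_snd).continuousOn
  continuousOn_param :=
    ((continuous_scale 0).comp (P.continuous_ext01.comp continuous_snd)).continuousOn
  proj_param _ _ _ _ := rfl
  param_zero _ _ := scale_zero_snd _
  param_one _ _ := scale_zero_snd _
  gaugeEqNear s hs u hu := by
    refine ⟨(ext01 P.toMap u).proj, 0, continuousWithinAt_const, ?_⟩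
    have hsrc : ∀ᶠ q : ℝ × ℝ in 𝓝[unitSquare] (s, u), (ext01 P.toMap q.2).proj ∈
        (chartAt E (ext01 P.toMap u).proj).source :=
      nhdsWithin_le_nhds (((continuous_proj_cotangent.comp P.continuous_ext01).comp
        continuous_snd).continuousAt ((chartAt E _).open_source.mem_nhds (mem_chart_source _ _)))
    filter_upwards [hsrc, eventually_mem_nhdsWithin] with q h1 h2
    have h0 : ∀ v, coordCovector (ext01 P.toMap u).proj (scale 0 (ext01 P.toMap v)) = 0 := fun v =>
      coordCovector_of_snd_eq_zero _ (scale_zero_snd _)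
    refine ⟨h1, P.isSolutionAt h2.2 h1, ?_, ?_, ?_⟩
    · rw [h0, map_zero, neg_zero]
      exact hasDerivWithinAt_const _ _ _
    · simp only [h0]
      exact hasDerivWithinAt_const _ _ _
    · rw [h0, map_zero, ContinuousLinearMap.comp_zero, add_zero]
      exact hasDerivWithinAt_const _ _ _

/-- A gauge curve is glued to the constant square of the other factor. The end point of the varying
solution is constant along the curve, so composability persists. -/
theorem GaugeRelated.flatConcat_left {α : PoissonStructure E M} {P P' Q : Constraint α}
    (hP : GaugeRelated P P') (h : P.right = Q.left) (h' : P'.right = Q.left) :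
    GaugeRelated (P.flatConcat Q h) (P'.flatConcat Q h') := by
  obtain ⟨Γ, β, hΓ, rfl, rfl⟩ := hP
  refine (hΓ.gaugeSquare.glue Q.gaugeSquare fun s hs => ?_).gaugeRelated
    (fun u hu => Constraint.ext01_flatConcat _ _ _ hu)
    (fun u hu => Constraint.ext01_flatConcat _ _ _ hu)
  rw [← Constraint.right_eq, ← Constraint.left_eq, ← h, hΓ.right_eq (b := 0) hs (by simp)]

theorem GaugeRelated.flatConcat_right {α : PoissonStructure E M} {P Q Q' : Constraint α}
    (hQ : GaugeRelated Q Q') (h : P.right = Q.left) (h' : P.right = Q'.left) :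
    GaugeRelated (P.flatConcat Q h) (P.flatConcat Q' h') := by
  obtain ⟨Γ, β, hΓ, rfl, rfl⟩ := hQ
  refine (P.gaugeSquare.glue hΓ.gaugeSquare fun s hs => ?_).gaugeRelated
    (fun u hu => Constraint.ext01_flatConcat _ _ _ hu)
    (fun u hu => Constraint.ext01_flatConcat _ _ _ hu)
  rw [← Constraint.right_eq, ← Constraint.left_eq, h, hΓ.left_eq (b := 0) hs (by simp)]

theorem PhaseSpace.mk_eq_of_gaugeRelated {α : PoissonStructure E M} {P Q : Constraint α}
    (h : GaugeRelated P Q) : PhaseSpace.mk P = PhaseSpace.mk Q :=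
  Quotient.sound (Relation.EqvGen.rel _ _ h)

theorem PhaseSpace.lift_eq {α : PoissonStructure E M} {X : Type*} (f : Constraint α → X)
    (hf : ∀ P Q, GaugeRelated P Q → f P = f Q) {P Q : Constraint α}
    (h : Relation.EqvGen GaugeRelated P Q) : f P = f Q := by
  induction h with
  | rel _ _ h => exact hf _ _ h
  | refl => rfl
  | symm _ _ _ ih => exact ih.symm
  | trans _ _ _ _ _ ih1 ih2 => exact ih1.trans ih2

theorem PhaseSpace.eqvGen_of_mk_eq {α : PoissonStructure E M} {P Q : Constraint α}
    (h : PhaseSpace.mk P = PhaseSpace.mk Q) : Relation.EqvGen GaugeRelated P Q :=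
  Quotient.exact h

theorem PhaseSpace.mk_reparam_congr {α : PoissonStructure E M} {P Q : Constraint α}
    (h : PhaseSpace.mk P = PhaseSpace.mk Q) {ρ : ℝ → ℝ} (hρ : ContDiff ℝ 1 ρ)
    (hm : MapsTo ρ (Icc 0 1) (Icc 0 1)) (h0 : ρ 0 = 0 ∨ ρ 0 = 1) (h1 : ρ 1 = 0 ∨ ρ 1 = 1) :
    PhaseSpace.mk (P.reparam ρ hρ hm) = PhaseSpace.mk (Q.reparam ρ hρ hm) :=
  PhaseSpace.lift_eq (fun P : Constraint α => PhaseSpace.mk (P.reparam ρ hρ hm))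
    (fun _ _ h => PhaseSpace.mk_eq_of_gaugeRelated (h.reparam hρ hm h0 h1))
    (PhaseSpace.eqvGen_of_mk_eq h)

open Classical in
/-- The class of the concatenation of two composable solutions. -/
def concatClass {α : PoissonStructure E M} (P Q : Constraint α) : PhaseSpace α :=
  if h : P.right = Q.left then PhaseSpace.mk (P.flatConcat Q h) else PhaseSpace.mk P

theorem concatClass_of_eq {α : PoissonStructure E M} {P Q : Constraint α} (h : P.right = Q.left) :
    concatClass P Q = PhaseSpace.mk (P.flatConcat Q h) := dif_pos h

end Coordinates

/-! ### The groupoid laws, given that every class has a smooth representative. -/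

section Coordinates

variable {E : Type*} [NormedAddCommGroup E] [NormedSpace ℝ E]
variable {M : Type*} [TopologicalSpace M] [ChartedSpace E M] [IsManifold 𝓘(ℝ, E) ∞ M]

theorem concatClass_congr_left {α : PoissonStructure E M} {P P' : Constraint α}
    (h : Relation.EqvGen GaugeRelated P P') (Q : Constraint α) :
    concatClass P Q = concatClass P' Q :=
  PhaseSpace.lift_eq (fun P => concatClass P Q) (fun P P' hP => by
    by_cases h : P.right = Q.left
    · have h' : P'.right = Q.left := hP.right_eq ▸ h
      rw [concatClass_of_eq h, concatClass_of_eq h']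
      exact PhaseSpace.mk_eq_of_gaugeRelated (hP.flatConcat_left h h')
    · have h' : ¬ P'.right = Q.left := hP.right_eq ▸ h
      rw [concatClass, concatClass, dif_neg h, dif_neg h']
      exact PhaseSpace.mk_eq_of_gaugeRelated hP) h

theorem concatClass_congr_right {α : PoissonStructure E M} (P : Constraint α) {Q Q' : Constraint α}
    (h : Relation.EqvGen GaugeRelated Q Q') : concatClass P Q = concatClass P Q' :=
  PhaseSpace.lift_eq (fun Q => concatClass P Q) (fun Q Q' hQ => by
    by_cases h : P.right = Q.left
    · have h' : P.right = Q'.left := hQ.left_eq ▸ h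
      rw [concatClass_of_eq h, concatClass_of_eq h']
      exact PhaseSpace.mk_eq_of_gaugeRelated (hQ.flatConcat_right h h')
    · have h' : ¬ P.right = Q'.left := hQ.left_eq ▸ h
      rw [concatClass, concatClass, dif_neg h, dif_neg h']) h

namespace PhaseSpace

variable {α : PoissonStructure E M}

/-- The source map. -/
def left : PhaseSpace α → M :=
  Quotient.lift Constraint.left fun _ _ h => lift_eq _ (fun _ _ h => h.left_eq) h

/-- The target map. -/
def right : PhaseSpace α → M :=
  Quotient.lift Constraint.right fun _ _ h => lift_eq _ (fun _ _ h => h.right_eq) h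

theorem mk_reverse_congr {P Q : Constraint α} (h : mk P = mk Q) : mk P.reverse = mk Q.reverse := by
  rw [reverse_eq_reparam, reverse_eq_reparam]
  exact mk_reparam_congr h _ _ (Or.inr (by norm_num)) (Or.inl (by norm_num))

/-- The inversion. -/
def inv : PhaseSpace α → PhaseSpace α :=
  Quotient.lift (fun P : Constraint α => mk P.reverse) fun _ _ h => mk_reverse_congr (Quotient.sound h)

/-- The composition law. -/
def comp (g h : PhaseSpace α) : PhaseSpace α :=
  Quotient.liftOn₂ g h concatClass fun _ _ _ _ h1 h2 =>
    (concatClass_congr_left h1 _).trans (concatClass_congr_right _ h2)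

theorem comp_mk {P Q : Constraint α} (h : P.right = Q.left) :
    comp (mk P) (mk Q) = mk (P.flatConcat Q h) := concatClass_of_eq h

variable (hsm : ∀ P : Constraint α, ∃ Q : Constraint α, Q.Smooth ∧ mk Q = mk P)
include hsm

/-- Both pullbacks depend only on the class of P, since the maps send end points to end points; for
a smooth representative they are joined by the convex homotopy. -/
theorem mk_reparam_eq (P : Constraint α) {ρ₀ ρ₁ : ℝ → ℝ} (h₀ : ContDiff ℝ 1 ρ₀)
    (h₁ : ContDiff ℝ 1 ρ₁) (m₀ : MapsTo ρ₀ (Icc 0 1) (Icc 0 1))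
    (m₁ : MapsTo ρ₁ (Icc 0 1) (Icc 0 1)) (e₀ : ρ₀ 0 = ρ₁ 0) (e₁ : ρ₀ 1 = ρ₁ 1)
    (b₀ : ρ₀ 0 = 0 ∨ ρ₀ 0 = 1) (b₁ : ρ₀ 1 = 0 ∨ ρ₀ 1 = 1) :
    mk (P.reparam ρ₀ h₀ m₀) = mk (P.reparam ρ₁ h₁ m₁) := by
  obtain ⟨Q, hQ, hPQ⟩ := hsm P
  rw [← mk_reparam_congr hPQ h₀ m₀ b₀ b₁, ← mk_reparam_congr hPQ h₁ m₁ (e₀ ▸ b₀) (e₁ ▸ b₁)]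
  exact mk_eq_of_gaugeRelated (hQ.gaugeRelated_reparam h₀ h₁ m₀ m₁ e₀ e₁)

theorem mk_reparam (P : Constraint α) {ρ : ℝ → ℝ} (hρ : ContDiff ℝ 1 ρ)
    (hm : MapsTo ρ (Icc 0 1) (Icc 0 1)) (h0 : ρ 0 = 0) (h1 : ρ 1 = 1) :
    mk (P.reparam ρ hρ hm) = mk P := by
  rw [mk_reparam_eq hsm P hρ contDiff_id hm (mapsTo_id _) h0 h1 (Or.inl h0) (Or.inr h1)]
  congr 1
  refine Constraint.ext fun u hu => ?_
  rw [Constraint.ext01_reparam _ _ _ hu]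
  simp [scale_one]

theorem mk_flat (P : Constraint α) : mk P.flat = mk P :=
  mk_reparam hsm P _ _ (flattenAt_of_le (by norm_num)) (flattenAt_of_ge (by norm_num))

/-- The composition is defined through flattened factors. That flattened concatenation is itself a
pullback of the plain one by a map with ends 0 and 1, hence has the same class. -/
theorem comp_mk_concat (P Q : Constraint α) (hP : P.Normalized) (hQ : Q.Normalized)
    (h : P.right = Q.left) : comp (mk P) (mk Q) = mk (P.concat Q hP hQ h) := by
  -- This map runs over [0, 1/2] while the first flattening moves and over [1/2, 1] while the second
  -- moves; at most one of them is moving at any time.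
  set ρ : ℝ → ℝ := fun u => (flattenAt 2 0 u + flattenAt 2 1 u) / 2 with hρ
  have cρ : ContDiff ℝ 1 ρ :=
    ((contDiff_flattenAt 2 0).add (contDiff_flattenAt 2 1)).div_const 2
  have mρ : MapsTo ρ (Icc 0 1) (Icc 0 1) := fun u hu => by
    have h1 := mapsTo_flattenAt 2 0 hu
    have h2 := mapsTo_flattenAt 2 1 hu
    exact ⟨by simp only [hρ]; linarith [h1.1, h2.1], by simp only [hρ]; linarith [h1.2, h2.2]⟩
  have dρ : ∀ u, deriv ρ u = (deriv (flattenAt 2 0) u + deriv (flattenAt 2 1) u) / 2 := fun u =>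
    ((((hasDerivAt_of_contDiff (contDiff_flattenAt 2 0) u)).add
      (hasDerivAt_of_contDiff (contDiff_flattenAt 2 1) u)).div_const 2).deriv
  rw [comp_mk h, ← mk_reparam hsm (P.concat Q hP hQ h) cρ mρ
    (by simp only [hρ]; rw [flattenAt_of_le (by norm_num), flattenAt_of_le (by norm_num)]; norm_num)
    (by simp only [hρ]; rw [flattenAt_of_ge (by norm_num), flattenAt_of_ge (by norm_num)]; norm_num)]
  congr 1
  refine Constraint.ext fun u hu => ?_
  rw [Constraint.ext01_flatConcat _ _ _ hu, Constraint.ext01_reparam _ _ _ hu, dρ]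
  unfold glue
  have k0 := flatten_mem (2 * u - 0)
  have k1 := flatten_mem (2 * u - 1)
  split_ifs with h1
  · simp only [hρ]
    rw [deriv_flattenAt_of_lt (k := 2) (a := 1) (by linarith),
      flattenAt_of_le (k := 2) (a := 1) (by linarith),
      Constraint.ext01_concat_of_le _ _ _ _ _ (by unfold flattenAt; linarith [k0.1])
        (by unfold flattenAt; linarith [k0.2]), scale_scale]
    congr 1
    · ring
    · congr 1; ring
  · push Not at h1
    simp only [hρ]
    rw [deriv_flattenAt_of_gt (k := 2) (a := 0) (by linarith),
      flattenAt_of_ge (k := 2) (a := 0) (by linarith),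
      Constraint.ext01_concat_of_ge _ _ _ _ _ (by unfold flattenAt; linarith [k1.1])
        (by unfold flattenAt; linarith [k1.2]), scale_scale]
    congr 1
    · ring
    · congr 1; ring

/-- The two bracketings run through the same three solutions at different speeds. Each is pulled
back to a common schedule in which P, Q and R are traversed during successive thirds with rests in
between, and the pullbacks are equal. -/
theorem mk_concat_assoc (P Q R : Constraint α) (hP : P.Normalized) (hQ : Q.Normalized)
    (hR : R.Normalized) (h : P.right = Q.left) (h' : Q.right = R.left) :
    mk ((P.concat Q hP hQ h).concat R (P.concat_normalized Q hP hQ h) hR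
      (by rw [Constraint.concat_right, h'])) =
    mk (P.concat (Q.concat R hQ hR h') hP (Q.concat_normalized R hQ hR h')
      (by rw [Constraint.concat_left, h])) := by
  have c0 := contDiff_flattenAt 3 0
  have c1 := contDiff_flattenAt 3 1
  have c2 := contDiff_flattenAt 3 2
  set a := flattenAt 3 0 with ha
  set b := flattenAt 3 1 with hb
  set c := flattenAt 3 2 with hc
  have ma : ∀ u, a u ∈ Icc (0 : ℝ) 1 := fun u => flatten_mem _
  have mb : ∀ u, b u ∈ Icc (0 : ℝ) 1 := fun u => flatten_mem _
  have mc : ∀ u, c u ∈ Icc (0 : ℝ) 1 := fun u => flatten_mem _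
  have comb : ∀ x y z : ℝ, 0 ≤ x → 0 ≤ y → 0 ≤ z → x + y + z = 1 →
      ∃ hρ : ContDiff ℝ 1 (fun u => x * a u + y * b u + z * c u),
      ∃ hm : MapsTo (fun u => x * a u + y * b u + z * c u) (Icc 0 1) (Icc 0 1),
      (∀ P : Constraint α, mk (P.reparam _ hρ hm) = mk P) ∧
      ∀ u, deriv (fun u => x * a u + y * b u + z * c u) u =
        x * deriv a u + y * deriv b u + z * deriv c u := by
    intro x y z hx hy hz hxyz
    have hρ : ContDiff ℝ 1 (fun u => x * a u + y * b u + z * c u) :=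
      ((contDiff_const.mul c0).add (contDiff_const.mul c1)).add (contDiff_const.mul c2)
    have hm : MapsTo (fun u => x * a u + y * b u + z * c u) (Icc 0 1) (Icc 0 1) := fun u _ => by
      constructor
      · have := mul_nonneg hx (ma u).1
        have := mul_nonneg hy (mb u).1
        have := mul_nonneg hz (mc u).1
        linarith
      · have := mul_le_mul_of_nonneg_left (ma u).2 hx
        have := mul_le_mul_of_nonneg_left (mb u).2 hy
        have := mul_le_mul_of_nonneg_left (mc u).2 hz
        linarith
    refine ⟨hρ, hm, fun P => mk_reparam hsm P hρ hm ?_ ?_, fun u => ?_⟩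
    · rw [ha, hb, hc, flattenAt_of_le (by norm_num), flattenAt_of_le (by norm_num),
        flattenAt_of_le (by norm_num)]
      ring
    · rw [ha, hb, hc, flattenAt_of_ge (by norm_num), flattenAt_of_ge (by norm_num),
        flattenAt_of_ge (by norm_num)]
      linarith
    · exact ((((hasDerivAt_of_contDiff c0 u).const_mul x).add
        ((hasDerivAt_of_contDiff c1 u).const_mul y)).add
        ((hasDerivAt_of_contDiff c2 u).const_mul z)).deriv
  -- The weights are the lengths of the subintervals that P, Q and R occupy: 1/4, 1/4, 1/2 in (PQ)R
  -- and 1/2, 1/4, 1/4 in P(QR).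
  obtain ⟨hρ, hm, hmk, hd⟩ := comb (1 / 4) (1 / 4) (1 / 2) (by norm_num) (by norm_num)
    (by norm_num) (by norm_num)
  obtain ⟨hρ', hm', hmk', hd'⟩ := comb (1 / 2) (1 / 4) (1 / 4) (by norm_num) (by norm_num)
    (by norm_num) (by norm_num)
  rw [← hmk, ← hmk' (P.concat _ _ _ _)]
  congr 1
  refine Constraint.ext fun u hu => ?_
  rw [Constraint.ext01_reparam _ _ _ hu, Constraint.ext01_reparam _ _ _ hu, hd, hd']
  have ma := ma u
  have mb := mb u
  have mc := mc u
  -- The maps a, b, c move only inside [1/9, 2/9], [4/9, 5/9] and [7/9, 8/9]. The cuts 7/18 and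
  -- 11/18 lie in the rests between them, so at most one map moves in each case.
  rcases le_or_gt u (7 / 18) with h1 | h1
  · have eb : b u = 0 := flattenAt_of_le (by linarith)
    have ec : c u = 0 := flattenAt_of_le (by linarith)
    have db : deriv b u = 0 := deriv_flattenAt_of_lt (by linarith)
    have dc : deriv c u = 0 := deriv_flattenAt_of_lt (by linarith)
    rw [eb, ec, db, dc, Constraint.ext01_concat_of_le _ _ _ _ _ (by linarith [ma.1])
        (by linarith [ma.2]), Constraint.ext01_concat_of_le _ _ _ _ _ (by linarith [ma.1])
        (by linarith [ma.2]), Constraint.ext01_concat_of_le _ _ _ _ _ (by linarith [ma.1])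
        (by linarith [ma.2]), scale_scale, scale_scale, scale_scale]
    ring_nf
  rcases le_or_gt u (11 / 18) with h2 | h2
  · have ea : a u = 1 := flattenAt_of_ge (by linarith)
    have ec : c u = 0 := flattenAt_of_le (by linarith)
    have da : deriv a u = 0 := deriv_flattenAt_of_gt (by linarith)
    have dc : deriv c u = 0 := deriv_flattenAt_of_lt (by linarith)
    rw [ea, ec, da, dc, Constraint.ext01_concat_of_le _ _ _ _ _ (by linarith [mb.1])
        (by linarith [mb.2]), Constraint.ext01_concat_of_ge _ _ _ _ _ (by linarith [mb.1])
        (by linarith [mb.2]), Constraint.ext01_concat_of_ge _ _ _ _ _ (by linarith [mb.1])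
        (by linarith [mb.2]), Constraint.ext01_concat_of_le _ _ _ _ _ (by linarith [mb.1])
        (by linarith [mb.2]), scale_scale, scale_scale, scale_scale, scale_scale]
    ring_nf
  · have ea : a u = 1 := flattenAt_of_ge (by linarith)
    have eb : b u = 1 := flattenAt_of_ge (by linarith)
    have da : deriv a u = 0 := deriv_flattenAt_of_gt (by linarith)
    have db : deriv b u = 0 := deriv_flattenAt_of_gt (by linarith)
    rw [ea, eb, da, db, Constraint.ext01_concat_of_ge _ _ _ _ _ (by linarith [mc.1])
        (by linarith [mc.2]), Constraint.ext01_concat_of_ge _ _ _ _ _ (by linarith [mc.1])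
        (by linarith [mc.2]), Constraint.ext01_concat_of_ge _ _ _ _ _ (by linarith [mc.1])
        (by linarith [mc.2]), scale_scale, scale_scale, scale_scale]
    ring_nf

omit hsm in
theorem ext01_const (x : M) (u : ℝ) : ext01 (Constraint.const α x).toMap u = ⟨x, 0⟩ := rfl

omit hsm in
theorem scale_const (x : M) (r : ℝ) :
    scale r (⟨x, 0⟩ : CoTangentBundle E M) = ⟨x, 0⟩ := scale_of_snd_eq_zero rfl r

omit hsm in
theorem scale_zero_eq (p : CoTangentBundle E M) : scale 0 p = ⟨p.proj, 0⟩ :=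
  eq_of_snd_eq_zero rfl (scale_zero_snd p) rfl

/-- Flattened concatenation with a constant solution is the pullback of P by `flattenAt 2 1`, which
waits at 0 during the first half. -/
theorem const_comp (P : Constraint α) : comp (mk (Constraint.const α P.left)) (mk P) = mk P := by
  rw [comp_mk (show (Constraint.const α P.left).right = P.left from rfl),
    ← mk_reparam hsm P (contDiff_flattenAt 2 1) (mapsTo_flattenAt 2 1)
      (flattenAt_of_le (by norm_num)) (flattenAt_of_ge (by norm_num))]
  congr 1
  refine Constraint.ext fun u hu => ?_
  rw [Constraint.ext01_flatConcat _ _ _ hu, Constraint.ext01_reparam _ _ _ hu]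
  unfold glue
  split_ifs with h1
  · change scale _ (ext01 (Constraint.const α P.left).toMap _) = _
    rw [ext01_const, scale_const, deriv_flattenAt_of_lt (by linarith),
      flattenAt_of_le (by linarith), scale_zero_eq, Constraint.left_eq]
  · rfl

theorem comp_const (P : Constraint α) : comp (mk P) (mk (Constraint.const α P.right)) = mk P := by
  rw [comp_mk (show P.right = (Constraint.const α P.right).left from rfl),
    ← mk_reparam hsm P (contDiff_flattenAt 2 0) (mapsTo_flattenAt 2 0)
      (flattenAt_of_le (by norm_num)) (flattenAt_of_ge (by norm_num))]
  congr 1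
  refine Constraint.ext fun u hu => ?_
  rw [Constraint.ext01_flatConcat _ _ _ hu, Constraint.ext01_reparam _ _ _ hu]
  unfold glue
  split_ifs with h1
  · rfl
  · push Not at h1
    change scale _ (ext01 (Constraint.const α P.right).toMap _) = _
    rw [ext01_const, scale_const, deriv_flattenAt_of_gt (by linarith),
      flattenAt_of_ge (by linarith), scale_zero_eq, Constraint.right_eq]

omit hsm in
theorem ext01_reverse (P : Constraint α) {u : ℝ} (hu : u ∈ Icc (0 : ℝ) 1) :
    ext01 P.reverse.toMap u = scale (-1) (ext01 P.toMap (1 - u)) := by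
  rw [reverse_eq_reparam, Constraint.ext01_reparam _ _ _ hu]
  simp

omit hsm in
theorem reverse_left (P : Constraint α) : P.reverse.left = P.right := by
  rw [Constraint.left_eq, ext01_reverse _ (by simp), scale_proj, Constraint.right_eq, sub_zero]

omit hsm in
theorem reverse_right (P : Constraint α) : P.reverse.right = P.left := by
  rw [Constraint.right_eq, ext01_reverse _ (by simp), scale_proj, Constraint.left_eq, sub_self]

omit hsm in
theorem reverse_reverse (P : Constraint α) : P.reverse.reverse = P := by
  refine Constraint.ext fun u hu => ?_
  rw [ext01_reverse _ hu, ext01_reverse _ (mapsTo_one_sub hu), scale_scale]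
  norm_num [scale_one]

/-- A path followed by its reverse is a pullback of P by a map that rises from 0 to 1 and returns to
0. It has the same end values as the constant map 0, whose pullback is the constant solution. -/
theorem comp_reverse (P : Constraint α) :
    comp (mk P) (mk P.reverse) = mk (Constraint.const α P.left) := by
  set ρ : ℝ → ℝ := fun u => flattenAt 2 0 u - flattenAt 2 1 u with hρ
  have cρ : ContDiff ℝ 1 ρ := (contDiff_flattenAt 2 0).sub (contDiff_flattenAt 2 1)
  have dρ : ∀ u, deriv ρ u = deriv (flattenAt 2 0) u - deriv (flattenAt 2 1) u := fun u =>
    ((hasDerivAt_of_contDiff (contDiff_flattenAt 2 0) u).sub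
      (hasDerivAt_of_contDiff (contDiff_flattenAt 2 1) u)).deriv
  have mρ : MapsTo ρ (Icc 0 1) (Icc 0 1) := fun u hu => by
    have h1 := mapsTo_flattenAt 2 0 hu
    have h2 := mapsTo_flattenAt 2 1 hu
    rcases le_or_gt u (1 / 2) with h | h
    · simp only [hρ]
      rwa [flattenAt_of_le (k := 2) (a := 1) (by linarith), sub_zero]
    · simp only [hρ]
      rw [flattenAt_of_ge (k := 2) (a := 0) (by linarith)]
      exact mapsTo_one_sub h2
  have e0 : ρ 0 = 0 := by
    simp only [hρ]; rw [flattenAt_of_le (by norm_num), flattenAt_of_le (by norm_num), sub_zero]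
  have e1 : ρ 1 = 0 := by
    simp only [hρ]; rw [flattenAt_of_ge (by norm_num), flattenAt_of_ge (by norm_num), sub_self]
  have m0 : MapsTo (fun _ : ℝ => (0 : ℝ)) (Icc 0 1) (Icc 0 1) := fun _ _ => by simp
  have hconst : P.reparam (fun _ => 0) contDiff_const m0 =
      Constraint.const α P.left := by
    refine Constraint.ext fun u hu => ?_
    rw [Constraint.ext01_reparam _ _ _ hu, deriv_const, scale_zero_eq, ext01_const,
      Constraint.left_eq]
  rw [comp_mk (reverse_left P).symm, ← hconst,
    ← mk_reparam_eq hsm P cρ contDiff_const mρ m0 e0 e1 (Or.inl e0) (Or.inl e1)]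
  congr 1
  refine Constraint.ext fun u hu => ?_
  rw [Constraint.ext01_flatConcat _ _ _ hu, Constraint.ext01_reparam _ _ _ hu, dρ]
  unfold glue
  split_ifs with h1
  · simp only [hρ]
    rw [deriv_flattenAt_of_lt (k := 2) (a := 1) (by linarith),
      flattenAt_of_le (k := 2) (a := 1) (by linarith), sub_zero, sub_zero]
  · push Not at h1
    simp only [hρ]
    rw [deriv_flattenAt_of_gt (k := 2) (a := 0) (by linarith),
      flattenAt_of_ge (k := 2) (a := 0) (by linarith), ext01_reverse _ (mapsTo_flattenAt 2 1 hu),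
      scale_scale]
    congr 1
    ring

theorem isGroupoid : IsGroupoid (fun x => mk (Constraint.const α x)) left right inv
    (fun g h _ => comp g h) where
  unit_left _ := rfl
  unit_right _ := rfl
  comp_left := by
    rintro ⟨P⟩ ⟨Q⟩ (p : P.right = Q.left)
    change left (comp (mk P) (mk Q)) = _
    rw [comp_mk p]
    exact (Constraint.concat_left _ _ _ _ _).trans P.flat_left
  comp_right := by
    rintro ⟨P⟩ ⟨Q⟩ (p : P.right = Q.left)
    change right (comp (mk P) (mk Q)) = _
    rw [comp_mk p]
    exact (Constraint.concat_right _ _ _ _ _).trans Q.flat_right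
  unit_comp := by
    rintro ⟨P⟩ -
    exact const_comp hsm P
  comp_unit := by
    rintro ⟨P⟩ -
    exact comp_const hsm P
  inv_left := by
    rintro ⟨P⟩
    exact reverse_left P
  inv_right := by
    rintro ⟨P⟩
    exact reverse_right P
  comp_inv := by
    rintro ⟨P⟩ -
    exact comp_reverse hsm P
  inv_comp := by
    rintro ⟨P⟩ -
    have := comp_reverse hsm P.reverse
    rw [reverse_reverse, reverse_left] at this
    exact this
  assoc := by
    rintro ⟨P⟩ ⟨Q⟩ ⟨R⟩ (p : P.right = Q.left) (q : Q.right = R.left) - -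
    change comp (comp (mk P) (mk Q)) (mk R) = comp (mk P) (comp (mk Q) (mk R))
    -- Flattened representatives are normalized, so all four compositions become plain
    -- concatenations.
    rw [← mk_flat hsm P, ← mk_flat hsm Q, ← mk_flat hsm R]
    rw [comp_mk_concat hsm _ _ P.flat_normalized Q.flat_normalized
        (by rw [Constraint.flat_right, Constraint.flat_left, p]),
      comp_mk_concat hsm _ _ Q.flat_normalized R.flat_normalized
        (by rw [Constraint.flat_right, Constraint.flat_left, q]),
      comp_mk_concat hsm _ _ (Constraint.concat_normalized _ _ _ _ _) R.flat_normalized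
        (by rw [Constraint.concat_right, Constraint.flat_right, Constraint.flat_left, q]),
      comp_mk_concat hsm _ _ P.flat_normalized (Constraint.concat_normalized _ _ _ _ _)
        (by rw [Constraint.concat_left, Constraint.flat_right, Constraint.flat_left, p])]
    exact mk_concat_assoc hsm _ _ _ _ _ _ _ _

end PhaseSpace

end Coordinates

/-! ### Smoothness of implicit functions on a neighbourhood. -/

section ImplicitFunction

variable {E₁ E₂ F : Type*} [NormedAddCommGroup E₁] [NormedSpace ℝ E₁] [CompleteSpace E₁]
  [NormedAddCommGroup E₂] [NormedSpace ℝ E₂] [CompleteSpace E₂]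
  [NormedAddCommGroup F] [NormedSpace ℝ F] [CompleteSpace F]

/-- The implicit function of a smooth equation is smooth at all points near the base point. -/
theorem exists_eventually_contDiffAt_implicit {f : E₁ × E₂ → F} (hf : ContDiff ℝ ∞ f)
    (hinv : ∀ v, (fderiv ℝ f v ∘L .inr ℝ E₁ E₂).IsInvertible) {u : E₁ × E₂} (hu : f u = 0) :
    ∃ ψ : E₁ → E₂, ψ u.1 = u.2 ∧ ∀ᶠ z in 𝓝 u.1, ContDiffAt ℝ ∞ ψ z ∧ f (z, ψ z) = 0 := by
  have h0 : (∞ : WithTop ℕ∞) ≠ 0 := by simp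
  set ψ := hf.contDiffAt.implicitFunction (u := u) h0 (hinv u) with hψ
  have h1 : ψ u.1 = u.2 := ContDiffAt.implicitFunction_apply_self _ _ _
  have h2 : ∀ᶠ z in 𝓝 u.1, f (z, ψ z) = 0 := by
    simpa [hu] using ContDiffAt.eventually_apply_implicitFunction hf.contDiffAt h0 (hinv u)
  have hc : ContinuousAt ψ u.1 :=
    (ContDiffAt.contDiffAt_implicitFunction hf.contDiffAt h0 (hinv u)).continuousAt
  have h3 : ∀ᶠ v in 𝓝 u, ∀ᶠ w in 𝓝 v, f w = 0 ↔ ψ w.1 = w.2 := by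
    simpa [hu] using eventually_eventually_nhds.2
      (ContDiffAt.eventually_apply_eq_iff_implicitFunction hf.contDiffAt h0 (hinv u))
  have ht : Filter.Tendsto (fun z => (z, ψ z)) (𝓝 u.1) (𝓝 u) := by
    have := continuousAt_id.prodMk hc
    unfold ContinuousAt at this
    simpa [h1] using this
  refine ⟨ψ, h1, ?_⟩
  filter_upwards [h2, ht.eventually h3] with z hz hz3
  refine ⟨?_, hz⟩
  -- Infinite differentiability at one point need not spread to a neighbourhood. The implicit
  -- function is therefore constructed again at the nearby point, and local uniqueness at the
  -- original point identifies the two near z.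
  set φ := hf.contDiffAt.implicitFunction (u := (z, ψ z)) h0 (hinv _) with hφ
  have hφd : ContDiffAt ℝ ∞ φ z :=
    ContDiffAt.contDiffAt_implicitFunction hf.contDiffAt h0 (hinv (z, ψ z))
  have hφ1 : φ z = ψ z :=
    ContDiffAt.implicitFunction_apply_self hf.contDiffAt h0 (hinv (z, ψ z))
  have hφ2 : ∀ᶠ w in 𝓝 z, f (w, φ w) = 0 := by
    simpa [hz] using ContDiffAt.eventually_apply_implicitFunction hf.contDiffAt h0 (hinv (z, ψ z))
  have ht' : Filter.Tendsto (fun w => (w, φ w)) (𝓝 z) (𝓝 (z, ψ z)) := by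
    have := continuousAt_id.prodMk hφd.continuousAt
    unfold ContinuousAt at this
    simpa [hφ1] using this
  refine hφd.congr_of_eventuallyEq ?_
  filter_upwards [hφ2, ht'.eventually hz3] with w hw hw3
  exact hw3.1 hw

end ImplicitFunction

/-! ### Superposition operators on continuous paths. -/

section Superposition

/-- Continuous maps from the unit interval to a normed space. -/
abbrev PathSpace (F : Type*) [NormedAddCommGroup F] : Type _ := C(I, F)

/-- Pointwise application of a continuous family of linear maps to a continuous map. -/
def pointwiseApply (F G : Type*) [NormedAddCommGroup F] [NormedSpace ℝ F]
    [NormedAddCommGroup G] [NormedSpace ℝ G] : PathSpace (F →L[ℝ] G) →L[ℝ] PathSpace F →L[ℝ] PathSpace G :=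
  let app : PathSpace (F →L[ℝ] G) →ₗ[ℝ] PathSpace F →ₗ[ℝ] PathSpace G :=
    { toFun := fun A =>
        { toFun := fun f => ⟨fun u => A u (f u), A.continuous.clm_apply f.continuous⟩
          map_add' := fun f g => ContinuousMap.ext fun u => (A u).map_add (f u) (g u)
          map_smul' := fun r f => ContinuousMap.ext fun u => (A u).map_smul r (f u) }
      map_add' := fun A B => rfl
      map_smul' := fun r A => rfl }
  app.mkContinuous₂ 1 fun A f => by
    rw [one_mul]
    refine (ContinuousMap.norm_le _ (mul_nonneg (norm_nonneg A) (norm_nonneg f))).2 fun u => ?_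
    exact ((A u).le_opNorm (f u)).trans (mul_le_mul (A.norm_coe_le_norm u)
      (f.norm_coe_le_norm u) (norm_nonneg _) (norm_nonneg _))

/-- The derivative of a map of class `C¹`, as a continuous map. -/
def derivMap {F G : Type*} [NormedAddCommGroup F] [NormedSpace ℝ F]
    [NormedAddCommGroup G] [NormedSpace ℝ G] (f : C(F, G)) (hf : ContDiff ℝ 1 f) :
    C(F, F →L[ℝ] G) := ⟨fderiv ℝ f, hf.continuous_fderiv (by simp)⟩

/-- Continuity of postcomposition in the compact-open topology, which on paths is the sup norm; this
gives uniformity along the path without uniform continuity of g. -/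
theorem exists_forall_norm_comp_sub_lt {F H : Type*} [NormedAddCommGroup F]
    [NormedAddCommGroup H] (g : C(F, H)) (X : PathSpace F) {ε : ℝ} (hε : 0 < ε) :
    ∃ δ > 0, ∀ Y : PathSpace F, ‖Y - X‖ < δ → ∀ u, ‖g (Y u) - g (X u)‖ < ε := by
  have hc : Continuous (fun Y : PathSpace F => g.comp Y) := ContinuousMap.continuous_postcomp _
  obtain ⟨δ, hδ, h⟩ := Metric.continuous_iff.1 hc X ε hε
  refine ⟨δ, hδ, fun Y hY u => ?_⟩
  have h1 := h Y (by rwa [dist_eq_norm])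
  rw [← dist_eq_norm]
  exact (ContinuousMap.dist_apply_le_dist (f := g.comp Y) (g := g.comp X) u).trans_lt h1

/-- The mean value inequality is applied at each u, with a bound on the variation of the derivative
of f that does not depend on u. -/
theorem hasFDerivAt_comp_left {F G : Type*} [NormedAddCommGroup F] [NormedSpace ℝ F]
    [NormedAddCommGroup G] [NormedSpace ℝ G] (f : C(F, G)) (hf : ContDiff ℝ 1 f) (X : PathSpace F) :
    HasFDerivAt (fun Y : PathSpace F => f.comp Y) (pointwiseApply F G ((derivMap f hf).comp X)) X := by
  rw [hasFDerivAt_iff_isLittleO_nhds_zero, Asymptotics.isLittleO_iff]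
  intro ε hε
  obtain ⟨δ, hδ, h⟩ := exists_forall_norm_comp_sub_lt (derivMap f hf) X hε
  filter_upwards [Metric.ball_mem_nhds (0 : PathSpace F) hδ] with V hV
  rw [mem_ball_zero_iff] at hV
  rw [ContinuousMap.norm_le _ (by positivity)]
  intro u
  have hball : ∀ y ∈ Metric.ball (X u) δ, ‖fderiv ℝ f y - fderiv ℝ f (X u)‖ ≤ ε := by
    intro y hy
    -- A constant translate of X passes through any prescribed y at time u, which turns the estimate
    -- on nearby paths into an estimate on a ball around X u.
    have h1 := h (X + ContinuousMap.const I (y - X u)) (by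
      rw [add_sub_cancel_left]
      refine lt_of_le_of_lt ((ContinuousMap.norm_le _ (norm_nonneg (y - X u))).2 fun _ => le_rfl) ?_
      rwa [← dist_eq_norm]) u
    have h2 : (X + ContinuousMap.const I (y - X u)) u = y := add_sub_cancel _ _
    rw [h2] at h1
    exact h1.le
  have h3 : X u + V u ∈ Metric.ball (X u) δ := by
    rw [mem_ball_iff_norm, add_sub_cancel_left]
    exact (V.norm_coe_le_norm u).trans_lt hV
  have h4 := (convex_ball (X u) δ).norm_image_sub_le_of_norm_fderiv_le'
    (fun y _ => hf.differentiable (by simp) y) hball (Metric.mem_ball_self hδ) h3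
  rw [add_sub_cancel_left] at h4
  refine le_trans (le_of_eq ?_) (h4.trans (mul_le_mul_of_nonneg_left (V.norm_coe_le_norm u) hε.le))
  rfl

theorem contDiff_continuousLinearMap {H X : Type*} [NormedAddCommGroup H] [NormedSpace ℝ H]
    [NormedAddCommGroup X] [NormedSpace ℝ X] (L : PathSpace H →L[ℝ] X) {n : WithTop ℕ∞} :
    ContDiff ℝ n L := L.contDiff

/-- The derivative of the superposition operator of f is that of the derivative of f followed by a
continuous linear map. The induction therefore has to run over all targets at once, which keeps
source and target in one universe. -/
theorem contDiff_nat_comp_left {F : Type u} [NormedAddCommGroup F] [NormedSpace ℝ F] (n : ℕ) :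
    ∀ {G : Type u} [NormedAddCommGroup G] [NormedSpace ℝ G] (f : C(F, G)), ContDiff ℝ n f →
    ContDiff ℝ n (fun Y : PathSpace F => f.comp Y) := by
  induction n with
  | zero =>
    intro G _ _ f _
    simp only [Nat.cast_zero, contDiff_zero]
    exact ContinuousMap.continuous_postcomp f
  | succ n ih =>
    intro G _ _ f hf
    have hf1 : ContDiff ℝ 1 f := hf.of_le (by simp)
    have hd : ContDiff ℝ n (derivMap f hf1) := by
      have := (contDiff_succ_iff_fderiv (n := n)).1 (by simpa using hf)
      exact this.2.2
    push_cast
    exact contDiff_succ_iff_hasFDerivAt.2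
      ⟨fun X => pointwiseApply F G ((derivMap f hf1).comp X),
        ContDiff.comp (contDiff_continuousLinearMap (X := PathSpace F →L[ℝ] PathSpace G)
          (pointwiseApply F G)) (ih _ hd), fun X => hasFDerivAt_comp_left f hf1 X⟩

theorem contDiff_comp_left {F G : Type u} [NormedAddCommGroup F] [NormedSpace ℝ F]
    [NormedAddCommGroup G] [NormedSpace ℝ G] (f : C(F, G)) (hf : ContDiff ℝ ∞ f) :
    ContDiff ℝ ∞ (fun Y : PathSpace F => f.comp Y) :=
  contDiff_infty.2 fun n => contDiff_nat_comp_left n f (contDiff_infty.1 hf n)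

end Superposition

/-! ### Integration of paths and Volterra operators. -/

section Primitive

variable {F G : Type*} [NormedAddCommGroup F] [NormedSpace ℝ F] [CompleteSpace F]
  [NormedAddCommGroup G] [NormedSpace ℝ G] [CompleteSpace G]

variable (F) in
/-- The primitive `u ↦ ∫₀ᵘ f`, as a continuous linear map. -/
def primitive : PathSpace F →L[ℝ] PathSpace F :=
  LinearMap.mkContinuous
    { toFun := fun f => ⟨fun u => ∫ t in (0 : ℝ)..u, ext01 f t,
        (intervalIntegral.continuous_primitive (fun a b =>
          (f.continuous.comp continuous_projIcc).intervalIntegrable a b) 0).comp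
            continuous_subtype_val⟩
      map_add' := fun f g => by
        ext u
        exact intervalIntegral.integral_add
          ((f.continuous.comp continuous_projIcc).intervalIntegrable _ _)
          ((g.continuous.comp continuous_projIcc).intervalIntegrable _ _)
      map_smul' := fun r f => by
        ext u
        exact intervalIntegral.integral_smul r _ } 1 fun f => by
    rw [one_mul, ContinuousMap.norm_le _ (norm_nonneg _)]
    intro u
    refine (intervalIntegral.norm_integral_le_of_norm_le_const (C := ‖f‖)
      fun t _ => f.norm_coe_le_norm _).trans ?_
    rw [sub_zero, abs_of_nonneg u.2.1]
    exact mul_le_of_le_one_right (norm_nonneg _) u.2.2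

theorem primitive_apply (f : PathSpace F) (u : I) :
    primitive F f u = ∫ t in (0 : ℝ)..u, ext01 f t := rfl

theorem primitive_zero (f : PathSpace F) : primitive F f 0 = 0 := by
  rw [primitive_apply]
  exact intervalIntegral.integral_same

theorem hasDerivWithinAt_primitive (f : PathSpace F) {t : ℝ} (ht : t ∈ Icc (0 : ℝ) 1) :
    HasDerivWithinAt (ext01 (primitive F f)) (ext01 f t) (Icc 0 1) t := by
  have hc : Continuous (ext01 f) := f.continuous.comp continuous_projIcc
  refine ((intervalIntegral.integral_hasDerivAt_right (hc.intervalIntegrable 0 t)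
    hc.stronglyMeasurable.stronglyMeasurableAtFilter hc.continuousAt).hasDerivWithinAt).congr
      (fun v hv => ?_) ?_
  · simp only [ext01, projIcc_of_mem _ hv]; rfl
  · simp only [ext01, projIcc_of_mem _ ht]; rfl

/-- The Volterra operator `V ↦ ∫₀ A V`. -/
def volterra (A : PathSpace (F →L[ℝ] F)) : PathSpace F →L[ℝ] PathSpace F :=
  primitive F ∘L pointwiseApply F F A

/-- The bound at time u carries the factor uⁿ, and integrating it once more yields the next
factorial; a bound by the norm alone would lose this. -/
theorem norm_volterra_pow_apply_le (A : PathSpace (F →L[ℝ] F)) (n : ℕ) (V : PathSpace F) (u : I) :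
    ‖(volterra A ^ n) V u‖ ≤ (‖A‖ * u) ^ n / n.factorial * ‖V‖ := by
  induction n generalizing u with
  | zero => simpa using V.norm_coe_le_norm u
  | succ n ih =>
    rw [pow_succ']
    change ‖∫ t in (0 : ℝ)..u, ext01 (pointwiseApply F F A ((volterra A ^ n) V)) t‖ ≤ _
    have hb : ∀ t ∈ Ioc (0 : ℝ) u, ‖ext01 (pointwiseApply F F A ((volterra A ^ n) V)) t‖ ≤
        ‖A‖ ^ (n + 1) / n.factorial * ‖V‖ * t ^ n := by
      intro t ht
      have htI : t ∈ Icc (0 : ℝ) 1 := ⟨ht.1.le, ht.2.trans u.2.2⟩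
      simp only [ext01, projIcc_of_mem _ htI]
      refine ((A ⟨t, htI⟩).le_opNorm (((volterra A ^ n) V) ⟨t, htI⟩)).trans ?_
      refine (mul_le_mul (A.norm_coe_le_norm _) (ih ⟨t, htI⟩) (norm_nonneg _)
        (norm_nonneg _)).trans (le_of_eq ?_)
      rw [mul_pow]
      ring
    refine (intervalIntegral.norm_integral_le_of_norm_le u.2.1 (Filter.Eventually.of_forall hb)
      ((by fun_prop : Continuous fun t : ℝ =>
        ‖A‖ ^ (n + 1) / n.factorial * ‖V‖ * t ^ n).intervalIntegrable _ _)).trans (le_of_eq ?_)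
    rw [intervalIntegral.integral_const_mul, integral_pow, Nat.factorial_succ]
    push_cast
    have : (n.factorial : ℝ) ≠ 0 := by positivity
    field_simp
    ring

/-- The factorials make some power a strict contraction. Then 1 - Vⁿ is invertible, and it is the
product of 1 - V with a polynomial in V that commutes with it. -/
theorem isUnit_one_sub_volterra (A : PathSpace (F →L[ℝ] F)) : IsUnit (1 - volterra A) := by
  obtain ⟨n, hn⟩ : ∃ n : ℕ, ‖A‖ ^ n / n.factorial < 1 :=
    ((FloorSemiring.tendsto_pow_div_factorial_atTop ‖A‖).eventually (gt_mem_nhds one_pos)).exists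
  have h1 : ‖(volterra A ^ n : PathSpace F →L[ℝ] PathSpace F)‖ < 1 := by
    refine lt_of_le_of_lt (ContinuousLinearMap.opNorm_le_bound (volterra A ^ n)
      (div_nonneg (pow_nonneg (norm_nonneg A) n) (Nat.cast_nonneg _)) fun V => ?_) hn
    refine (ContinuousMap.norm_le _ (mul_nonneg (div_nonneg (pow_nonneg (norm_nonneg A) n)
      (Nat.cast_nonneg _)) (norm_nonneg V))).2 fun u => ?_
    refine (norm_volterra_pow_apply_le A n V u).trans ?_
    gcongr
    · exact mul_nonneg (norm_nonneg A) u.2.1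
    · exact mul_le_of_le_one_right (norm_nonneg A) u.2.2
  have h2 : IsUnit (1 - volterra A ^ n) :=
    isUnit_one_sub_of_norm_lt_one (R := PathSpace F →L[ℝ] PathSpace F) h1
  rw [← mul_neg_geom_sum] at h2
  refine ((Commute.isUnit_mul_iff ?_).1 h2).1
  exact Commute.sum_right _ _ _ fun i _ => ((Commute.one_left _).sub_left (Commute.refl _)).pow_right i

end Primitive

/-! ### Smooth dependence of solutions of integral equations on their data. -/

section IntegralEquation

variable {F G : Type u} [NormedAddCommGroup F] [NormedSpace ℝ F] [CompleteSpace F]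
  [NormedAddCommGroup G] [NormedSpace ℝ G] [CompleteSpace G]

variable (F) in
/-- The inclusion of the constant paths. -/
def constPath : F →L[ℝ] PathSpace F :=
  LinearMap.mkContinuous
    { toFun := fun y => ContinuousMap.const I y
      map_add' := fun _ _ => rfl
      map_smul' := fun _ _ => rfl } 1 fun y => by
    rw [one_mul]
    exact (ContinuousMap.norm_le _ (norm_nonneg y)).2 fun _ => le_rfl

theorem constPath_apply (y : F) (u : I) : constPath F y u = y := rfl

/-- The right hand side `∫₀ f(Y) g` of the integral equation for a path `Y`. -/
def equationRhs (f : C(F, G →L[ℝ] F)) (g : PathSpace G) (Y : PathSpace F) : PathSpace F :=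
  primitive F (pointwiseApply G F (f.comp Y) g)

theorem contDiff_equationRhs (f : C(F, G →L[ℝ] F)) (hf : ContDiff ℝ ∞ f) :
    ContDiff ℝ ∞ (fun v : PathSpace G × PathSpace F => equationRhs f v.1 v.2) := by
  have h1 : ContDiff ℝ ∞ (fun v : PathSpace G × PathSpace F => f.comp v.2) :=
    (contDiff_comp_left f hf).comp contDiff_snd
  have h2 : ContDiff ℝ ∞ (fun v : PathSpace G × PathSpace F => pointwiseApply G F (f.comp v.2)) :=
    ContDiff.comp (contDiff_continuousLinearMap (X := PathSpace G →L[ℝ] PathSpace F)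
      (pointwiseApply G F)) h1
  exact (contDiff_continuousLinearMap (primitive F)).comp (h2.clm_apply contDiff_fst)

/-- The linearization of `y ↦ f(y) g` along a path. -/
def linearization (f : C(F, G →L[ℝ] F)) (hf : ContDiff ℝ ∞ f) (g : PathSpace G)
    (Y : PathSpace F) : PathSpace (F →L[ℝ] F) :=
  ⟨fun u => (derivMap f (hf.of_le (by simp)) (Y u)).flip (g u), by
    refine Continuous.clm_apply ?_ g.continuous
    exact (ContinuousLinearMap.flipₗᵢ ℝ F G F).continuous.comp
      ((derivMap f (hf.of_le (by simp))).continuous.comp Y.continuous)⟩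

/-- The derivative in the path variable is a Volterra operator, so the linearization of the integral
equation is invertible without any smallness condition. -/
theorem hasFDerivAt_equationRhs (f : C(F, G →L[ℝ] F)) (hf : ContDiff ℝ ∞ f) (g : PathSpace G)
    (Y : PathSpace F) :
    HasFDerivAt (fun Y => equationRhs f g Y) (volterra (linearization f hf g Y)) Y := by
  have h1 : HasFDerivAt (fun Y : PathSpace F => f.comp Y)
      (pointwiseApply F (G →L[ℝ] F) ((derivMap f (hf.of_le (by simp))).comp Y)) Y :=
    hasFDerivAt_comp_left f (hf.of_le (by simp)) Y
  have h2 : HasFDerivAt (fun Y : PathSpace F => primitive F (pointwiseApply G F (f.comp Y) g))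
      ((primitive F ∘L (pointwiseApply G F).flip g) ∘L
        (pointwiseApply F (G →L[ℝ] F) ((derivMap f (hf.of_le (by simp))).comp Y))) Y :=
    HasFDerivAt.comp (g := (primitive F ∘L (pointwiseApply G F).flip g)) Y
      (ContinuousLinearMap.hasFDerivAt _) h1
  have h3 : ((primitive F ∘L (pointwiseApply G F).flip g) ∘L
        (pointwiseApply F (G →L[ℝ] F) ((derivMap f (hf.of_le (by simp))).comp Y))) =
      volterra (linearization f hf g Y) :=
    ContinuousLinearMap.ext fun V => congrArg (primitive F) (ContinuousMap.ext fun u => rfl)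
  exact h3 ▸ h2

/-- Solutions of the integral equation `Y = y + ∫₀ f(Y) g` near a given one depend smoothly on
the initial value `y` and on `g`. -/
theorem exists_smooth_solution (f : C(F, G →L[ℝ] F)) (hf : ContDiff ℝ ∞ f) {y₀ : F}
    {g₀ : PathSpace G} {Y₀ : PathSpace F} (h₀ : Y₀ = constPath F y₀ + equationRhs f g₀ Y₀)
    {V : Set (PathSpace F)} (hV : V ∈ 𝓝 Y₀) :
    ∃ S : F × PathSpace G → PathSpace F, ∀ᶠ z in 𝓝 (y₀, g₀), ContDiffAt ℝ ∞ S z ∧ S z ∈ V ∧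
      S z = constPath F z.1 + equationRhs f z.2 (S z) := by
  set Θ : (F × PathSpace G) × PathSpace F → PathSpace F :=
    fun v => v.2 - constPath F v.1.1 - equationRhs f v.1.2 v.2 with hΘ
  have hΘs : ContDiff ℝ ∞ Θ := by
    have h1 : ContDiff ℝ ∞ fun v : (F × PathSpace G) × PathSpace F => constPath F v.1.1 :=
      (constPath F).contDiff.comp (contDiff_fst.comp contDiff_fst)
    have h2 : ContDiff ℝ ∞ fun v : (F × PathSpace G) × PathSpace F => equationRhs f v.1.2 v.2 :=
      ContDiff.comp (f := fun v : (F × PathSpace G) × PathSpace F => (v.1.2, v.2))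
        (contDiff_equationRhs f hf) ((contDiff_snd.comp contDiff_fst).prodMk contDiff_snd)
    exact (contDiff_snd.sub h1).sub h2
  -- Invertibility is established at every point, not only at the given solution, as is needed to
  -- re-centre the implicit function nearby.
  have hinv : ∀ v, (fderiv ℝ Θ v ∘L .inr ℝ (F × PathSpace G) (PathSpace F)).IsInvertible := by
    intro v
    have h1 : HasFDerivAt (fun Y => Θ (v.1, Y))
        (fderiv ℝ Θ v ∘L .inr ℝ (F × PathSpace G) (PathSpace F)) v.2 :=
      HasFDerivAt.comp (g := Θ) (f := fun Y => (v.1, Y)) v.2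
        (hΘs.differentiable (by simp) v).hasFDerivAt (hasFDerivAt_prodMk_right v.1 v.2)
    have h3 : HasFDerivAt (fun Y : PathSpace F => Y - constPath F v.1.1) (1 : _ →L[ℝ] _) v.2 :=
      (hasFDerivAt_id v.2).sub_const _
    have h2 : HasFDerivAt (fun Y => Θ (v.1, Y))
        (1 - volterra (linearization f hf v.1.2 v.2)) v.2 :=
      HasFDerivAt.sub (g := fun Y => equationRhs f v.1.2 Y) h3
        (hasFDerivAt_equationRhs f hf v.1.2 v.2)
    rw [h1.unique h2]
    obtain ⟨e, he⟩ := isUnit_one_sub_volterra (linearization f hf v.1.2 v.2)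
    exact ⟨ContinuousLinearEquiv.ofUnit e, he⟩
  obtain ⟨S, hS0, hS⟩ := exists_eventually_contDiffAt_implicit hΘs hinv (u := ((y₀, g₀), Y₀))
    (by simp only [hΘ]; rw [sub_sub, ← h₀, sub_self])
  refine ⟨S, ?_⟩
  have hc : ContinuousAt S (y₀, g₀) := hS.self_of_nhds.1.continuousAt
  filter_upwards [hS, hc.eventually_mem (by rw [hS0]; exact hV)] with z hz hzV
  refine ⟨hz.1, hzV, ?_⟩
  have := hz.2
  simp only [hΘ] at this
  rwa [sub_sub, sub_eq_zero] at this

end IntegralEquation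

/-! ### Poisson tensors on open sets, cutoffs and uniqueness for differential equations. -/

section PoissonTensor

variable {E : Type u} [NormedAddCommGroup E] [NormedSpace ℝ E]

/-- A smooth family of skew maps `E* → E` on an open set `U` which satisfies the Jacobi
identity. -/
structure IsPoissonOn (A : E → (E →L[ℝ] ℝ) →L[ℝ] E) (U : Set E) : Prop where
  isOpen : IsOpen U
  contDiffAt : ∀ y ∈ U, ContDiffAt ℝ ∞ A y
  skew : ∀ y ∈ U, ∀ ξ ζ : E →L[ℝ] ℝ, ξ (A y ζ) = -ζ (A y ξ)
  fderiv_skew : ∀ y ∈ U, ∀ (w : E) (ξ ζ : E →L[ℝ] ℝ),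
    ξ (fderiv ℝ A y w ζ) = -ζ (fderiv ℝ A y w ξ)
  jacobi : ∀ y ∈ U, ∀ ξ ζ θ : E →L[ℝ] ℝ,
    ζ (fderiv ℝ A y (A y ξ) θ) + θ (fderiv ℝ A y (A y ζ) ξ) + ξ (fderiv ℝ A y (A y θ) ζ) = 0

theorem isPoissonOn_coord [FiniteDimensional ℝ E] {M : Type*} [TopologicalSpace M]
    [ChartedSpace E M] [IsManifold 𝓘(ℝ, E) ∞ M] [T2Space M] (α : PoissonStructure E M) (c : M) :
    IsPoissonOn (α.coord c) (extChartAt 𝓘(ℝ, E) c).target where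
  isOpen := isOpen_extChartAt_target c
  contDiffAt _ hy := α.contDiffAt_coord hy
  skew y _ := α.coord_skew c y
  fderiv_skew _ hy := α.fderiv_coord_skew hy
  jacobi _ hy := α.coord_jacobi hy

/-- The derivative of `y ↦ A(y) ξ` in the direction of a vector, paired with a covector and
considered as a covector in the direction. -/
def pairDeriv (A : E → (E →L[ℝ] ℝ) →L[ℝ] E) (y : E) (ξ ζ : E →L[ℝ] ℝ) : E →L[ℝ] ℝ :=
  ξ ∘L (fderiv ℝ A y).flip ζ

theorem pairDeriv_apply (A : E → (E →L[ℝ] ℝ) →L[ℝ] E) (y : E) (ξ ζ : E →L[ℝ] ℝ) (w : E) :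
    pairDeriv A y ξ ζ w = ξ (fderiv ℝ A y w ζ) := rfl

/-- Superposition operators and Lipschitz bounds need globally defined smooth fields. Agreement on
an open set around K, rather than on K alone, preserves derivatives and hence the Jacobi identity
there. -/
theorem exists_cutoff [FiniteDimensional ℝ E] {Z : Type*} [NormedAddCommGroup Z]
    [NormedSpace ℝ Z] {A : E → Z} {U K : Set E}
    (hU : IsOpen U) (hA : ∀ y ∈ U, ContDiffAt ℝ ∞ A y) (hK : IsCompact K) (hKU : K ⊆ U) :
    ∃ (A' : E → Z) (V : Set E), ContDiff ℝ ∞ A' ∧ HasCompactSupport A' ∧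
      IsOpen V ∧ K ⊆ V ∧ V ⊆ U ∧ EqOn A' A V := by
  obtain ⟨L, hL, hKL, hLU⟩ := exists_compact_between hK hU hKU
  obtain ⟨f, hf1, hf0, -⟩ := exists_contMDiffMap_one_nhds_of_subset_interior 𝓘(ℝ, E) (n := ⊤)
    hK.isClosed hKL
  obtain ⟨V, hV, hKV, hV1⟩ := eventually_nhdsSet_iff_exists.1 hf1
  refine ⟨fun y => f y • A y, V ∩ U, ?_, ?_, hV.inter hU, subset_inter hKV hKU, inter_subset_right,
    fun y hy => by simp [hV1 y hy.1]⟩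
  · refine contDiff_iff_contDiffAt.2 fun y => ?_
    by_cases hy : y ∈ L
    · exact f.contMDiff.contDiff.contDiffAt.smul (hA y (hLU hy))
    · refine (contDiffAt_const (c := 0)).congr_of_eventuallyEq ?_
      filter_upwards [hL.isClosed.isOpen_compl.mem_nhds hy] with z hz
      rw [hf0 z hz, zero_smul]
  · exact HasCompactSupport.intro hL fun y hy => by rw [hf0 y hy, zero_smul]

theorem hasDerivWithinAt_Ici_of_Icc {F : Type*} [NormedAddCommGroup F] [NormedSpace ℝ F]
    {f : ℝ → F} {f' : F} {a b t : ℝ} (ht : t ∈ Ico a b) (h : HasDerivWithinAt f f' (Icc a b) t) :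
    HasDerivWithinAt f f' (Ici t) t := by
  refine h.mono_of_mem_nhdsWithin ?_
  filter_upwards [self_mem_nhdsWithin, nhdsWithin_le_nhds (Iio_mem_nhds ht.2)] with v h1 h2
  exact ⟨ht.1.trans h1, le_of_lt h2⟩

theorem eqOn_of_lipschitzWith {F : Type*} [NormedAddCommGroup F] [NormedSpace ℝ F]
    {v : ℝ → F → F} {K : NNReal} {x y : ℝ → F} {a b : ℝ}
    (hv : ∀ t ∈ Icc a b, LipschitzWith K (v t))
    (hx : ∀ t ∈ Icc a b, HasDerivWithinAt x (v t (x t)) (Icc a b) t)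
    (hy : ∀ t ∈ Icc a b, HasDerivWithinAt y (v t (y t)) (Icc a b) t) (h : x a = y a) :
    EqOn x y (Icc a b) :=
  ODE_solution_unique_of_mem_Icc_right (s := fun _ => univ)
    (fun t ht => (hv t (Ico_subset_Icc_self ht)).lipschitzOnWith)
    (fun t ht => (hx t ht).continuousWithinAt)
    (fun t ht => hasDerivWithinAt_Ici_of_Icc ht (hx t (Ico_subset_Icc_self ht)))
    (fun _ _ => mem_univ _) (fun t ht => (hy t ht).continuousWithinAt)
    (fun t ht => hasDerivWithinAt_Ici_of_Icc ht (hy t (Ico_subset_Icc_self ht)))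
    (fun _ _ => mem_univ _) h

theorem lipschitzWith_neg_clm_apply {X F G : Type*} [NormedAddCommGroup X] [NormedAddCommGroup F]
    [NormedSpace ℝ F] [NormedAddCommGroup G] [NormedSpace ℝ G] {A : X → F →L[ℝ] G} {C : NNReal}
    (hA : LipschitzWith C A) {R : ℝ} {g : F} (hg : ‖g‖ ≤ R) :
    LipschitzWith (C * R.toNNReal) (fun z => -(A z g)) := by
  refine LipschitzWith.of_dist_le_mul fun z w => ?_
  rw [dist_neg_neg, dist_eq_norm, dist_eq_norm, ← sub_apply]
  refine ((A z - A w).le_opNorm g).trans ?_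
  refine (mul_le_mul (hA.norm_sub_le z w) (hg.trans (Real.le_coe_toNNReal R)) (norm_nonneg g)
    (by positivity)).trans (le_of_eq ?_)
  push_cast
  ring

/-- The field is cut off around the compact images of both curves. The new field is globally
Lipschitz and unchanged along both, so the uniqueness theorem applies. -/
theorem eqOn_of_hasDerivWithinAt [FiniteDimensional ℝ E] {F : Type*} [NormedAddCommGroup F]
    [NormedSpace ℝ F] {A : E → F →L[ℝ] E} {U : Set E}
    (hU : IsOpen U) (hA : ∀ y ∈ U, ContDiffAt ℝ ∞ A y) {g : ℝ → F} {x y : ℝ → E} {a b : ℝ}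
    (hg : ContinuousOn g (Icc a b)) (hxU : MapsTo x (Icc a b) U) (hyU : MapsTo y (Icc a b) U)
    (hx : ∀ t ∈ Icc a b, HasDerivWithinAt x (-(A (x t) (g t))) (Icc a b) t)
    (hy : ∀ t ∈ Icc a b, HasDerivWithinAt y (-(A (y t) (g t))) (Icc a b) t) (h : x a = y a) :
    EqOn x y (Icc a b) := by
  have hxc : ContinuousOn x (Icc a b) := fun t ht => (hx t ht).continuousWithinAt
  have hyc : ContinuousOn y (Icc a b) := fun t ht => (hy t ht).continuousWithinAt
  obtain ⟨A', V, hA', hc, -, hKV, -, he⟩ := exists_cutoff hU hA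
    ((isCompact_Icc.image_of_continuousOn hxc).union (isCompact_Icc.image_of_continuousOn hyc))
    (union_subset hxU.image_subset hyU.image_subset)
  obtain ⟨C, hC⟩ := hA'.lipschitzWith_of_hasCompactSupport hc (by simp)
  obtain ⟨R, hR⟩ := isCompact_Icc.exists_bound_of_continuousOn hg
  refine eqOn_of_lipschitzWith (v := fun t z => -(A' z (g t)))
    (fun t ht => lipschitzWith_neg_clm_apply hC (hR t ht)) (fun t ht => ?_) (fun t ht => ?_) h
  · have := he (hKV (Or.inl (mem_image_of_mem x ht)))
    rw [this]
    exact hx t ht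
  · have := he (hKV (Or.inr (mem_image_of_mem y ht)))
    rw [this]
    exact hy t ht

theorem eq_zero_of_hasDerivWithinAt {F : Type*} [NormedAddCommGroup F] [NormedSpace ℝ F]
    {B : ℝ → F →L[ℝ] F} {W : ℝ → F} {a b : ℝ} (hB : ContinuousOn B (Icc a b))
    (hW : ∀ t ∈ Icc a b, HasDerivWithinAt W (B t (W t)) (Icc a b) t) (h : W a = 0) :
    ∀ t ∈ Icc a b, W t = 0 := by
  obtain ⟨R, hR⟩ := isCompact_Icc.exists_bound_of_continuousOn hB
  refine eqOn_of_lipschitzWith (v := fun t z => B t z) (K := R.toNNReal) (y := fun _ => 0)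
    (fun t ht => (B t).lipschitz.weaken ?_) hW (fun t ht => ?_) h
  · rw [← NNReal.coe_le_coe]
    exact (hR t ht).trans (Real.le_coe_toNNReal R)
  · rw [map_zero]
    exact hasDerivWithinAt_const _ _ _

end PoissonTensor

/-! ### Families of solutions whose variation is a gauge transformation. -/

section GaugeFamily

/-- The values of the parameter of a family of solutions, a neighbourhood of `[0,1]`. -/
abbrev paramRange : Set ℝ := Ioo (-1) 2

variable {E : Type u} [NormedAddCommGroup E] [NormedSpace ℝ E]

/-- A family `x s`, `s ∈ (-1, 2)`, of solutions of `x' = -A(x) (g + s δ)` on `[a, b]`, whose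
derivatives with respect to `s` are the infinitesimal gauge transformations with parameter `β`;
here `β₂` is the derivative of `β` with respect to `s`. -/
structure GaugeFamily (A : E → (E →L[ℝ] ℝ) →L[ℝ] E) (U : Set E) (a b : ℝ) (g δ : ℝ → E →L[ℝ] ℝ)
    (x : ℝ → ℝ → E) (β β₂ : ℝ → ℝ → E →L[ℝ] ℝ) : Prop where
  mem : ∀ s ∈ paramRange, ∀ u ∈ Icc a b, x s u ∈ U
  continuousOn_base : ContinuousOn (fun q : ℝ × ℝ => x q.1 q.2) (paramRange ×ˢ Icc a b)
  continuousOn_param : ContinuousOn (fun q : ℝ × ℝ => β q.1 q.2) (paramRange ×ˢ Icc a b)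
  continuousOn_deriv : ContinuousOn (fun q : ℝ × ℝ => β₂ q.1 q.2) (paramRange ×ˢ Icc a b)
  param_init : ∀ s ∈ paramRange, β s a = 0
  contDiffOn_param : ∀ u ∈ Icc a b, ContDiffOn ℝ ∞ (fun r => β r u) paramRange
  base_left : ∀ s ∈ paramRange, ∀ u ∈ Icc a b,
    HasDerivAt (fun r => x r u) (-(A (x s u) (β s u))) s
  param_left : ∀ s ∈ paramRange, ∀ u ∈ Icc a b, HasDerivAt (fun r => β r u) (β₂ s u) s
  -- Derivatives along u ↦ (S(u), u) are recorded because the parameter will be made to depend on u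
  -- through a cutoff. The term with S' is the source of the extra multiple of β in the one-form.
  base_diag : ∀ (S : ℝ → ℝ) (S' : ℝ), ∀ u ∈ Icc a b, S u ∈ paramRange →
    HasDerivWithinAt S S' (Icc a b) u → HasDerivWithinAt (fun v => x (S v) v)
      (-(A (x (S u) u) (g u + S u • δ u + S' • β (S u) u))) (Icc a b) u
  param_diag : ∀ (S : ℝ → ℝ) (S' : ℝ), ∀ u ∈ Icc a b, S u ∈ paramRange →
    HasDerivWithinAt S S' (Icc a b) u → HasDerivWithinAt (fun v => β (S v) v)
      (δ u - pairDeriv A (x (S u) u) (g u + S u • δ u) (β (S u) u) + S' • β₂ (S u) u) (Icc a b) u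

/-- The densities g and δ scale by (b - a)⁻¹ as coefficients of one-forms, while x and β are
functions and are merely composed; this permits constructing families on [0,1] only. -/
theorem GaugeFamily.comp_affine {A : E → (E →L[ℝ] ℝ) →L[ℝ] E} {U : Set E}
    {g δ : ℝ → E →L[ℝ] ℝ} {x : ℝ → ℝ → E} {β β₂ : ℝ → ℝ → E →L[ℝ] ℝ}
    (h : GaugeFamily A U 0 1 g δ x β β₂) {a b : ℝ} (hab : a < b) :
    GaugeFamily A U a b (fun u => (b - a)⁻¹ • g ((u - a) / (b - a)))
      (fun u => (b - a)⁻¹ • δ ((u - a) / (b - a))) (fun s u => x s ((u - a) / (b - a)))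
      (fun s u => β s ((u - a) / (b - a))) (fun s u => β₂ s ((u - a) / (b - a))) := by
  have hL : 0 < b - a := sub_pos.2 hab
  have hm : MapsTo (fun u => (u - a) / (b - a)) (Icc a b) (Icc 0 1) := fun u hu =>
    ⟨div_nonneg (by linarith [hu.1]) hL.le, (div_le_one hL).2 (by linarith [hu.2])⟩
  have hm2 : MapsTo (fun q : ℝ × ℝ => (q.1, (q.2 - a) / (b - a))) (paramRange ×ˢ Icc a b)
      (paramRange ×ˢ Icc 0 1) := fun q hq => ⟨hq.1, hm hq.2⟩
  have hc2 : Continuous (fun q : ℝ × ℝ => (q.1, (q.2 - a) / (b - a))) := by fun_prop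
  have hd : ∀ u, HasDerivAt (fun u => (u - a) / (b - a)) (b - a)⁻¹ u := fun u => by
    simpa using ((hasDerivAt_id u).sub_const a).div_const (b - a)
  -- the inverse change of variable
  have key : ∀ (S : ℝ → ℝ) (S' u : ℝ), u ∈ Icc a b → HasDerivWithinAt S S' (Icc a b) u →
      HasDerivWithinAt (fun t => S (a + (b - a) * t)) ((b - a) * S') (Icc 0 1)
        ((u - a) / (b - a)) := by
    intro S S' u hu hS
    have e : a + (b - a) * ((u - a) / (b - a)) = u := by field_simp; ring
    have h1 : HasDerivWithinAt (fun t => a + (b - a) * t) (b - a) (Icc 0 1)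
        ((u - a) / (b - a)) := by
      simpa using (((hasDerivAt_id ((u - a) / (b - a))).const_mul (b - a)).const_add a).hasDerivWithinAt
    have h2 : MapsTo (fun t => a + (b - a) * t) (Icc (0 : ℝ) 1) (Icc a b) := fun t ht =>
      ⟨by nlinarith [ht.1], by nlinarith [ht.2]⟩
    rw [← e] at hS
    rw [mul_comm]
    exact HasDerivWithinAt.comp ((u - a) / (b - a)) hS h1 h2
  have e : ∀ v, a + (b - a) * ((v - a) / (b - a)) = v := fun v => by field_simp; ring
  refine ⟨fun s hs u hu => h.mem s hs _ (hm hu), h.continuousOn_base.comp hc2.continuousOn hm2,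
    h.continuousOn_param.comp hc2.continuousOn hm2, h.continuousOn_deriv.comp hc2.continuousOn hm2,
    fun s hs => by simpa using h.param_init s hs, fun u hu => h.contDiffOn_param _ (hm hu),
    fun s hs u hu => h.base_left s hs _ (hm hu), fun s hs u hu => h.param_left s hs _ (hm hu),
    fun S S' u hu hSu hS => ?_, fun S S' u hu hSu hS => ?_⟩
  · have h1 := h.base_diag _ _ _ (hm hu) (by simpa only [e] using hSu) (key S S' u hu hS)
    have h2 := h1.scomp u (hd u).hasDerivWithinAt hm
    simp only [Function.comp_def, e] at h2
    refine h2.congr_deriv ?_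
    rw [smul_neg, ← map_smul, smul_add, smul_add, smul_smul _ ((b - a) * S'), smul_comm _ (S u),
      inv_mul_cancel_left₀ hL.ne']
  · have h1 := h.param_diag _ _ _ (hm hu) (by simpa only [e] using hSu) (key S S' u hu hS)
    have h2 := h1.scomp u (hd u).hasDerivWithinAt hm
    simp only [Function.comp_def, e] at h2
    refine h2.congr_deriv ?_
    rw [smul_add, smul_sub, smul_smul _ ((b - a) * S'), inv_mul_cancel_left₀ hL.ne',
      smul_comm (S u), ← smul_add]
    rfl

end GaugeFamily

/-! ### Evaluation of differentiable families of paths. -/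

section Evaluation

variable {F : Type*} [NormedAddCommGroup F] [NormedSpace ℝ F]

theorem continuous_ext01_eval :
    Continuous (fun q : PathSpace F × ℝ => ext01 q.1 q.2) :=
  ContinuousEval.continuous_eval.comp
    (continuous_fst.prodMk ((continuous_projIcc (h := zero_le_one)).comp continuous_snd))

variable (F) in
/-- Evaluation at `u`. -/
def evalPath (u : I) : PathSpace F →L[ℝ] F :=
  LinearMap.mkContinuous
    { toFun := fun f => f u
      map_add' := fun _ _ => rfl
      map_smul' := fun _ _ => rfl } 1 fun f => by
    rw [one_mul]
    exact f.norm_coe_le_norm u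

/-- The increment is split into the change of the path and the change of the point on a fixed path.
The slope of the first part converges uniformly and evaluation is jointly continuous, so joint
differentiability is not needed. -/
theorem hasDerivWithinAt_ext01_diag {c : ℝ → PathSpace F} {c' : PathSpace F} {S : ℝ → ℝ} {S' u : ℝ}
    {d : F} (hc : HasDerivAt c c' (S u)) (hS : HasDerivWithinAt S S' (Icc 0 1) u)
    (hd : HasDerivWithinAt (ext01 (c (S u))) d (Icc 0 1) u) :
    HasDerivWithinAt (fun v => ext01 (c (S v)) v) (S' • ext01 c' u + d) (Icc 0 1) u := by
  have hk : HasDerivWithinAt (fun v => c (S v)) (S' • c') (Icc 0 1) u := hc.scomp_hasDerivWithinAt u hS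
  have h1 : HasDerivWithinAt (fun v => ext01 (c (S v) - c (S u)) v) (S' • ext01 c' u) (Icc 0 1) u := by
    rw [hasDerivWithinAt_iff_tendsto_slope] at hk ⊢
    have h2 : Filter.Tendsto (fun v : ℝ => v) (𝓝[Icc 0 1 \ {u}] u) (𝓝 u) :=
      Filter.tendsto_id.mono_left nhdsWithin_le_nhds
    have h3 := (continuous_ext01_eval (F := F)).continuousAt.tendsto.comp (hk.prodMk_nhds h2)
    refine h3.congr' (Filter.Eventually.of_forall fun v => ?_)
    simp only [Function.comp_def, slope, vsub_eq_sub, sub_self]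
    simp [ext01]
  refine (h1.add hd).congr (fun v _ => ?_) ?_ <;> simp [ext01]

end Evaluation

/-! ### Integral equations as differential equations, and their linearization. -/

section Equations

variable {F G : Type u} [NormedAddCommGroup F] [NormedSpace ℝ F] [CompleteSpace F]
  [NormedAddCommGroup G] [NormedSpace ℝ G] [CompleteSpace G]

theorem hasDerivWithinAt_of_eq_equationRhs {f : C(F, G →L[ℝ] F)} {y : F} {g : PathSpace G}
    {Y : PathSpace F} (h : Y = constPath F y + equationRhs f g Y) {t : ℝ}
    (ht : t ∈ Icc (0 : ℝ) 1) :
    HasDerivWithinAt (ext01 Y) (f (ext01 Y t) (ext01 g t)) (Icc 0 1) t := by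
  have h1 := (hasDerivWithinAt_primitive (pointwiseApply G F (f.comp Y) g) ht).const_add y
  refine h1.congr (fun v _ => ?_) ?_
  · exact congrArg (fun Z : PathSpace F => ext01 Z v) h
  · exact congrArg (fun Z : PathSpace F => ext01 Z t) h

theorem apply_zero_of_eq_equationRhs {f : C(F, G →L[ℝ] F)} {y : F} {g : PathSpace G}
    {Y : PathSpace F} (h : Y = constPath F y + equationRhs f g Y) : Y 0 = y := by
  have h1 : Y 0 = y + primitive F (pointwiseApply G F (f.comp Y) g) 0 :=
    congrArg (fun Z : PathSpace F => Z 0) h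
  rw [h1, primitive_zero, add_zero]

theorem hasDerivAt_equationRhs {f : C(F, G →L[ℝ] F)} (hf : ContDiff ℝ ∞ f) {c : ℝ → PathSpace F}
    {γ : ℝ → PathSpace G} {c' : PathSpace F} {γ' : PathSpace G} {s : ℝ} (hc : HasDerivAt c c' s)
    (hγ : HasDerivAt γ γ' s) :
    HasDerivAt (fun r => equationRhs f (γ r) (c r))
      (primitive F (pointwiseApply F F (linearization f hf (γ s) (c s)) c' +
        pointwiseApply G F (f.comp (c s)) γ')) s := by
  have h1 := (hasFDerivAt_comp_left f (hf.of_le (by simp)) (c s)).comp_hasDerivAt s hc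
  have h2 : HasDerivAt (fun r => pointwiseApply G F (f.comp (c r))) _ s :=
    HasFDerivAt.comp_hasDerivAt (l := pointwiseApply G F) s
      (ContinuousLinearMap.hasFDerivAt _) h1
  exact HasFDerivAt.comp_hasDerivAt (l := primitive F) s (ContinuousLinearMap.hasFDerivAt _)
    (h2.clm_apply hγ)

/-- The linearized equation for the derivative of a family of solutions. -/
theorem eq_primitive_of_eventually_eq {f : C(F, G →L[ℝ] F)} (hf : ContDiff ℝ ∞ f) {y : F}
    {c : ℝ → PathSpace F} {γ : ℝ → PathSpace G} {c' : PathSpace F} {γ' : PathSpace G} {s : ℝ}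
    (hc : HasDerivAt c c' s) (hγ : HasDerivAt γ γ' s)
    (h : ∀ᶠ r in 𝓝 s, c r = constPath F y + equationRhs f (γ r) (c r)) :
    c' = primitive F (pointwiseApply F F (linearization f hf (γ s) (c s)) c' +
        pointwiseApply G F (f.comp (c s)) γ') :=
  hc.unique (((hasDerivAt_equationRhs hf hc hγ).const_add (constPath F y)).congr_of_eventuallyEq h)

end Equations

/-! ### The vector field of the coupled system for x and β. -/

section GaugeField

theorem contDiff_flip_apply {X E F G : Type*} [NormedAddCommGroup X] [NormedSpace ℝ X]
    [NormedAddCommGroup E] [NormedSpace ℝ E] [NormedAddCommGroup F] [NormedSpace ℝ F]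
    [NormedAddCommGroup G] [NormedSpace ℝ G] {D : X → E →L[ℝ] F →L[ℝ] G} {b : X → F}
    (hD : ContDiff ℝ ∞ D) (hb : ContDiff ℝ ∞ b) : ContDiff ℝ ∞ (fun x => (D x).flip (b x)) := by
  have h0 : ContDiff ℝ ∞ (fun L : E →L[ℝ] F →L[ℝ] G => L.flip) :=
    IsBoundedLinearMap.contDiff
      { map_add := fun _ _ => rfl
        map_smul := fun _ _ => rfl
        bound := ⟨1, one_pos, fun L => by rw [one_mul, ContinuousLinearMap.opNorm_flip]⟩ }
  have h1 : ContDiff ℝ ∞ (fun x => (D x).flip) := h0.comp hD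
  exact h1.clm_apply hb

theorem contDiff_fderiv_flip_apply {E F G : Type*} [NormedAddCommGroup E] [NormedSpace ℝ E]
    [NormedAddCommGroup F] [NormedSpace ℝ F] [NormedAddCommGroup G] [NormedSpace ℝ G]
    {A : E → F →L[ℝ] G} (hA : ContDiff ℝ ∞ A) :
    ContDiff ℝ ∞ (fun y : E × F => (fderiv ℝ A y.1).flip y.2) :=
  contDiff_flip_apply ((hA.fderiv_right (m := ∞) (by simp)).comp contDiff_fst) contDiff_snd

theorem contDiff_block {X E F : Type*} [NormedAddCommGroup X] [NormedSpace ℝ X]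
    [NormedAddCommGroup E] [NormedSpace ℝ E] [NormedAddCommGroup F] [NormedSpace ℝ F]
    {a : X → F →L[ℝ] E} {T : X → F →L[ℝ] F} (ha : ContDiff ℝ ∞ a) (hT : ContDiff ℝ ∞ T) :
    ContDiff ℝ ∞ (fun x => ContinuousLinearMap.inl ℝ E F ∘L (-(a x)) ∘L .fst ℝ F F +
      ContinuousLinearMap.inr ℝ E F ∘L (.snd ℝ F F - T x ∘L .fst ℝ F F)) :=
  (contDiff_const.clm_comp (ha.neg.clm_comp contDiff_const)).add
    (contDiff_const.clm_comp (contDiff_const.sub (hT.clm_comp contDiff_const)))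

variable {E : Type u} [NormedAddCommGroup E] [NormedSpace ℝ E]

/-- The right hand side of the equations `x' = -A(x) g`, `b' = d - ⟨g, DA(x) b⟩`, as a linear map
of `(g, d)`. -/
def gaugeField (A : E → (E →L[ℝ] ℝ) →L[ℝ] E) (y : E × (E →L[ℝ] ℝ)) :
    (E →L[ℝ] ℝ) × (E →L[ℝ] ℝ) →L[ℝ] E × (E →L[ℝ] ℝ) :=
  ContinuousLinearMap.inl ℝ E (E →L[ℝ] ℝ) ∘L (-(A y.1)) ∘L .fst ℝ _ _ +
    ContinuousLinearMap.inr ℝ E (E →L[ℝ] ℝ) ∘L (.snd ℝ _ _ -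
      (ContinuousLinearMap.compL ℝ E E ℝ).flip ((fderiv ℝ A y.1).flip y.2) ∘L .fst ℝ _ _)

theorem gaugeField_apply (A : E → (E →L[ℝ] ℝ) →L[ℝ] E) (y : E × (E →L[ℝ] ℝ))
    (g d : E →L[ℝ] ℝ) :
    gaugeField A y (g, d) = (-(A y.1 g), d - pairDeriv A y.1 g y.2) := by
  ext <;> simp [gaugeField, pairDeriv]

theorem contDiff_gaugeField {A : E → (E →L[ℝ] ℝ) →L[ℝ] E} (hA : ContDiff ℝ ∞ A) :
    ContDiff ℝ ∞ (gaugeField A) := by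
  have h1 : ContDiff ℝ ∞ (fun y : E × (E →L[ℝ] ℝ) => A y.1) := hA.comp contDiff_fst
  have h4 : ContDiff ℝ ∞ (fun y : E × (E →L[ℝ] ℝ) =>
      (ContinuousLinearMap.compL ℝ E E ℝ).flip ((fderiv ℝ A y.1).flip y.2)) :=
    contDiff_const.clm_apply (contDiff_fderiv_flip_apply hA)
  exact contDiff_block h1 h4

/-- The vector field of `gaugeField`, as a continuous map. -/
def gaugeFieldMap (A : E → (E →L[ℝ] ℝ) →L[ℝ] E) (hA : ContDiff ℝ ∞ A) :
    C(E × (E →L[ℝ] ℝ), (E →L[ℝ] ℝ) × (E →L[ℝ] ℝ) →L[ℝ] E × (E →L[ℝ] ℝ)) :=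
  ⟨gaugeField A, (contDiff_gaugeField hA).continuous⟩

/-- Only the first component of the linearized system is needed: the variation of x alone is
compared with -A(x)β. -/
theorem fst_fderiv_gaugeField {A : E → (E →L[ℝ] ℝ) →L[ℝ] E} (hA : ContDiff ℝ ∞ A)
    (y w : E × (E →L[ℝ] ℝ)) (g d : E →L[ℝ] ℝ) :
    (fderiv ℝ (gaugeField A) y w (g, d)).1 = -(fderiv ℝ A y.1 w.1 g) := by
  have h1 := ((contDiff_gaugeField hA).differentiable (by simp) y).hasFDerivAt
  have h2 := (h1.clm_apply (hasFDerivAt_const (g, d) y)).fst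
  have h3 : HasFDerivAt (fun z : E × (E →L[ℝ] ℝ) => A z.1) (fderiv ℝ A y.1 ∘L .fst ℝ _ _) y :=
    (hA.differentiable (by simp) y.1).hasFDerivAt.comp y hasFDerivAt_fst
  have h4 := (h3.clm_apply (hasFDerivAt_const g y)).neg
  have h5 := h2.unique (h4.congr_of_eventuallyEq (Filter.Eventually.of_forall fun z =>
    congrArg Prod.fst (gaugeField_apply A z g d)))
  have := congrArg (fun L : E × (E →L[ℝ] ℝ) →L[ℝ] E => L w) h5
  simpa using this

end GaugeField

/-! ### Paths with values in products. -/

section PairPath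

variable {F H : Type*} [NormedAddCommGroup F] [NormedSpace ℝ F] [NormedAddCommGroup H]
  [NormedSpace ℝ H]

/-- Composition of paths with a continuous linear map. -/
def pathMap (L : F →L[ℝ] H) : PathSpace F →L[ℝ] PathSpace H :=
  pointwiseApply F H (ContinuousMap.const I L)

/-- The path `u ↦ (g u, δ u)`. -/
def pairPath (g δ : PathSpace F) : PathSpace (F × F) :=
  pathMap (.inl ℝ F F) g + pathMap (.inr ℝ F F) δ

theorem ext01_pairPath (g δ : PathSpace F) (t : ℝ) :
    ext01 (pairPath g δ) t = (ext01 g t, ext01 δ t) := by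
  change (ContinuousLinearMap.inl ℝ F F (ext01 g t) + ContinuousLinearMap.inr ℝ F F (ext01 δ t)) = _
  simp

theorem continuous_pairPath : Continuous (fun q : PathSpace F × PathSpace F => pairPath q.1 q.2) :=
  ((pathMap (.inl ℝ F F)).continuous.comp continuous_fst).add
    ((pathMap (.inr ℝ F F)).continuous.comp continuous_snd)

theorem contDiff_pairPath (g δ : PathSpace F) :
    ContDiff ℝ ∞ (fun s : ℝ => pairPath (g + s • δ) δ) := by
  have h1 : ContDiff ℝ ∞ (fun s : ℝ => g + s • δ) := contDiff_const.add (contDiff_id.smul contDiff_const)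
  have h2 : ContDiff ℝ ∞ (fun s : ℝ => pathMap (.inl ℝ F F) (g + s • δ)) :=
    (contDiff_continuousLinearMap (pathMap (.inl ℝ F F))).comp h1
  exact h2.add contDiff_const

theorem hasDerivAt_pairPath (g δ : PathSpace F) (s : ℝ) :
    HasDerivAt (fun s : ℝ => pairPath (g + s • δ) δ) (pairPath δ 0) s := by
  have h1 : HasDerivAt (fun s : ℝ => g + s • δ) δ s := by
    simpa using ((hasDerivAt_id s).smul_const δ).const_add g
  have h2 : HasDerivAt (fun s : ℝ => pathMap (.inl ℝ F F) (g + s • δ)) (pathMap (.inl ℝ F F) δ) s :=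
    (pathMap (.inl ℝ F F)).hasFDerivAt.comp_hasDerivAt s h1
  refine (h2.add_const (pathMap (.inr ℝ F F) δ)).congr_deriv ?_
  simp [pairPath]

end PairPath

section Products

variable {F H : Type*} [NormedAddCommGroup F] [NormedSpace ℝ F] [NormedAddCommGroup H]
  [NormedSpace ℝ H]

theorem hasDerivWithinAt_fst {f : ℝ → F × H} {f' : F × H} {s : Set ℝ} {t : ℝ}
    (h : HasDerivWithinAt f f' s t) : HasDerivWithinAt (fun v => (f v).1) f'.1 s t :=
  (ContinuousLinearMap.fst ℝ F H).hasFDerivAt.comp_hasDerivWithinAt t h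

theorem hasDerivWithinAt_snd {f : ℝ → F × H} {f' : F × H} {s : Set ℝ} {t : ℝ}
    (h : HasDerivWithinAt f f' s t) : HasDerivWithinAt (fun v => (f v).2) f'.2 s t :=
  (ContinuousLinearMap.snd ℝ F H).hasFDerivAt.comp_hasDerivWithinAt t h

theorem hasDerivAt_ext01_apply {c : ℝ → PathSpace F} {c' : PathSpace F} {s : ℝ}
    (h : HasDerivAt c c' s) (u : ℝ) : HasDerivAt (fun r => ext01 (c r) u) (ext01 c' u) s :=
  HasFDerivAt.comp_hasDerivAt (l := fun f : PathSpace F => ext01 f u) s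
    (evalPath F (projIcc 0 1 zero_le_one u)).hasFDerivAt h

theorem contDiffOn_ext01_apply {c : ℝ → PathSpace F} {s : Set ℝ} {n : WithTop ℕ∞}
    (h : ContDiffOn ℝ n c s) (u : ℝ) : ContDiffOn ℝ n (fun r => ext01 (c r) u) s :=
  ContDiff.comp_contDiffOn (g := fun f : PathSpace F => ext01 f u)
    (evalPath F (projIcc 0 1 zero_le_one u)).contDiff h

theorem continuousOn_ext01_uncurry {c : ℝ → PathSpace F} {s : Set ℝ} (h : ContinuousOn c s)
    (D : Set ℝ) : ContinuousOn (fun q : ℝ × ℝ => ext01 (c q.1) q.2) (s ×ˢ D) :=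
  (continuous_ext01_eval (F := F)).comp_continuousOn
    ((h.comp continuousOn_fst fun _ hq => hq.1).prodMk continuousOn_snd)

end Products

/-! ### From the differential equation back to the integral equation. -/

section Integral

theorem eq_equationRhs_of_hasDerivWithinAt {F G : Type u} [NormedAddCommGroup F] [NormedSpace ℝ F]
    [CompleteSpace F] [NormedAddCommGroup G] [NormedSpace ℝ G] [CompleteSpace G]
    {f : C(F, G →L[ℝ] F)} {g : PathSpace G} {Y : PathSpace F}
    (h : ∀ t ∈ Icc (0 : ℝ) 1, HasDerivWithinAt (ext01 Y) (f (ext01 Y t) (ext01 g t)) (Icc 0 1) t) :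
    Y = constPath F (Y 0) + equationRhs f g Y := by
  ext u
  have h1 := eq_zero_of_hasDerivWithinAt (a := 0) (b := 1) (B := fun _ => (0 : F →L[ℝ] F))
    continuousOn_const (W := fun t => ext01 Y t - (Y 0 + ext01 (equationRhs f g Y) t))
    (fun t ht => ((h t ht).sub ((hasDerivWithinAt_primitive (pointwiseApply G F (f.comp Y) g)
      ht).const_add (Y 0))).congr_deriv (sub_self _)) ?_ u u.2
  · simpa [ext01, sub_eq_zero, constPath_apply] using h1
  · simp [ext01, equationRhs, primitive_zero]

end Integral

/-! ### Existence of gauge families by the Jacobi identity. -/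

section Poisson

variable {E : Type u} [NormedAddCommGroup E] [NormedSpace ℝ E]

theorem IsPoissonOn.congr {A A' : E → (E →L[ℝ] ℝ) →L[ℝ] E} {U V : Set E} (h : IsPoissonOn A U)
    (hV : IsOpen V) (hVU : V ⊆ U) (he : EqOn A' A V) : IsPoissonOn A' V := by
  have h1 : ∀ y ∈ V, A' =ᶠ[𝓝 y] A := fun y hy => he.eventuallyEq_of_mem (hV.mem_nhds hy)
  refine ⟨hV, fun y hy => (h.contDiffAt y (hVU hy)).congr_of_eventuallyEq (h1 y hy),
    fun y hy => ?_, fun y hy => ?_, fun y hy => ?_⟩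
  · rw [he hy]; exact h.skew y (hVU hy)
  · rw [(h1 y hy).fderiv_eq]; exact h.fderiv_skew y (hVU hy)
  · rw [(h1 y hy).fderiv_eq, he hy]; exact h.jacobi y (hVU hy)

/-- Pairing with an arbitrary covector and using skewness of A and of its derivative gives the
Jacobi identity. This is the combination left over when ∂ₛx + A(x)β is differentiated along the
curve. -/
theorem IsPoissonOn.jacobi_vector {A : E → (E →L[ℝ] ℝ) →L[ℝ] E} {U : Set E} (h : IsPoissonOn A U)
    {y : E} (hy : y ∈ U) (g b : E →L[ℝ] ℝ) :
    fderiv ℝ A y (A y b) g - fderiv ℝ A y (A y g) b - A y (pairDeriv A y g b) = 0 := by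
  refine SeparatingDual.eq_zero_of_forall_dual_eq_zero (R := ℝ) fun ζ => ?_
  rw [map_sub, map_sub, h.skew y hy ζ, pairDeriv_apply, h.fderiv_skew y hy _ ζ b]
  have := h.jacobi y hy b ζ g
  linarith

theorem GaugeFamily.congr_field {A A' : E → (E →L[ℝ] ℝ) →L[ℝ] E} {U V : Set E}
    {g δ : ℝ → E →L[ℝ] ℝ} {a b : ℝ} {x : ℝ → ℝ → E} {β β₂ : ℝ → ℝ → E →L[ℝ] ℝ}
    (h : GaugeFamily A' V a b g δ x β β₂) (hV : IsOpen V) (hVU : V ⊆ U) (he : EqOn A' A V) :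
    GaugeFamily A U a b g δ x β β₂ := by
  have h1 : ∀ y ∈ V, A' =ᶠ[𝓝 y] A := fun y hy => he.eventuallyEq_of_mem (hV.mem_nhds hy)
  refine ⟨fun s hs u hu => hVU (h.mem s hs u hu), h.continuousOn_base, h.continuousOn_param,
    h.continuousOn_deriv, h.param_init, h.contDiffOn_param, fun s hs u hu => ?_, h.param_left,
    fun S S' u hu hSu hS => ?_, fun S S' u hu hSu hS => ?_⟩
  · rw [← he (h.mem s hs u hu)]; exact h.base_left s hs u hu
  · rw [← he (h.mem _ hSu u hu)]; exact h.base_diag S S' u hu hSu hS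
  · have := h.param_diag S S' u hu hSu hS
    rwa [pairDeriv, (h1 _ (h.mem _ hSu u hu)).fderiv_eq] at this

variable [FiniteDimensional ℝ E]

/-- The integral equation supplies the u-derivatives of x and β, and its linearization that of ∂ₛx.
The remaining point, ∂ₛx = -A(x)β, is where the Jacobi identity enters; it is imposed on V only, in
which all the curves stay. -/
theorem gaugeFamily_of_curve {A : E → (E →L[ℝ] ℝ) →L[ℝ] E} {V : Set E} (hA : IsPoissonOn A V)
    (hAs : ContDiff ℝ ∞ A) {x₀ : E} {g δ : PathSpace (E →L[ℝ] ℝ)}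
    {c c' : ℝ → PathSpace (E × (E →L[ℝ] ℝ))} (hc : ContDiffOn ℝ ∞ c paramRange)
    (hcd : ∀ s ∈ paramRange, HasDerivAt c (c' s) s) (hc' : ContinuousOn c' paramRange)
    (hcV : ∀ s ∈ paramRange, ∀ u, (c s u).1 ∈ V)
    (heq : ∀ s ∈ paramRange, c s = constPath _ (x₀, 0) +
      equationRhs (gaugeFieldMap A hAs) (pairPath (g + s • δ) δ) (c s)) :
    GaugeFamily A V 0 1 (ext01 g) (ext01 δ) (fun s u => (ext01 (c s) u).1)
      (fun s u => (ext01 (c s) u).2) (fun s u => (ext01 (c' s) u).2) := by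
  have hopen : IsOpen paramRange := isOpen_Ioo
  have hev : ∀ s ∈ paramRange, ∀ u, HasDerivAt (fun r => ext01 (c r) u) (ext01 (c' s) u) s :=
    fun s hs u => hasDerivAt_ext01_apply (hcd s hs) u
  have hinit : ∀ s ∈ paramRange, ext01 (c s) 0 = (x₀, 0) := fun s hs => by
    simpa [ext01] using apply_zero_of_eq_equationRhs (heq s hs)
  have eq1 : ∀ s ∈ paramRange, ∀ t ∈ Icc (0 : ℝ) 1, HasDerivWithinAt (ext01 (c s))
      (-(A (ext01 (c s) t).1 (ext01 g t + s • ext01 δ t)), ext01 δ t -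
        pairDeriv A (ext01 (c s) t).1 (ext01 g t + s • ext01 δ t) (ext01 (c s) t).2)
      (Icc 0 1) t := by
    intro s hs t ht
    refine (hasDerivWithinAt_of_eq_equationRhs (heq s hs) ht).congr_deriv ?_
    rw [ext01_pairPath]
    exact gaugeField_apply A _ _ _
  have eq2 : ∀ s ∈ paramRange, ∀ t ∈ Icc (0 : ℝ) 1,
      HasDerivWithinAt (fun t => (ext01 (c' s) t).1)
        (-(fderiv ℝ A (ext01 (c s) t).1 (ext01 (c' s) t).1 (ext01 g t + s • ext01 δ t)) -
          A (ext01 (c s) t).1 (ext01 δ t)) (Icc 0 1) t := by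
    intro s hs t ht
    have h1 := eq_primitive_of_eventually_eq (f := gaugeFieldMap A hAs) (contDiff_gaugeField hAs)
      (hcd s hs) (hasDerivAt_pairPath g δ s) (Filter.eventually_of_mem (hopen.mem_nhds hs) heq)
    have h2 := (hasDerivWithinAt_primitive (pointwiseApply _ _ (linearization (gaugeFieldMap A hAs)
      (contDiff_gaugeField hAs) (pairPath (g + s • δ) δ) (c s)) (c' s) +
        pointwiseApply _ _ ((gaugeFieldMap A hAs).comp (c s)) (pairPath δ 0)) ht)
    rw [← h1] at h2
    refine (hasDerivWithinAt_fst h2).congr_deriv ?_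
    have h3 : (fderiv ℝ (gaugeField A) (ext01 (c s) t) (ext01 (c' s) t)
        (ext01 (pairPath (g + s • δ) δ) t) +
        gaugeField A (ext01 (c s) t) (ext01 (pairPath δ 0) t)).1 =
      -(fderiv ℝ A (ext01 (c s) t).1 (ext01 (c' s) t).1 (ext01 g t + s • ext01 δ t)) -
          A (ext01 (c s) t).1 (ext01 δ t) := by
      rw [ext01_pairPath, ext01_pairPath, gaugeField_apply, Prod.fst_add,
        fst_fderiv_gaugeField hAs]
      exact (sub_eq_add_neg _ _).symm
    exact h3
  have init2 : ∀ s ∈ paramRange, ext01 (c' s) 0 = 0 := by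
    intro s hs
    refine (hev s hs 0).unique ((hasDerivAt_const s (x₀, (0 : E →L[ℝ] ℝ))).congr_of_eventuallyEq ?_)
    exact Filter.eventually_of_mem (hopen.mem_nhds hs) hinit
  have hV : ∀ s ∈ paramRange, ∀ t, (ext01 (c s) t).1 ∈ V := fun s hs t => hcV s hs _
  -- The defect W = ∂ₛx + A(x)β vanishes at 0, since the initial data do not depend on s. The terms
  -- with δ cancel, and the Jacobi identity turns the rest into the linear equation W' = -DA(x)(W)(g
  -- + sδ), so W vanishes identically.
  have key : ∀ s ∈ paramRange, ∀ t ∈ Icc (0 : ℝ) 1,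
      (ext01 (c' s) t).1 = -(A (ext01 (c s) t).1 (ext01 (c s) t).2) := by
    intro s hs t ht
    have hcont : Continuous (ext01 (c s)) := (c s).continuous.comp continuous_projIcc
    have hgc : Continuous (fun t => ext01 g t + s • ext01 δ t) :=
      (g.continuous.comp continuous_projIcc).add
        ((δ.continuous.comp continuous_projIcc).const_smul s)
    have hB : Continuous (fun t => -((fderiv ℝ A (ext01 (c s) t).1).flip
        (ext01 g t + s • ext01 δ t))) :=
      ((contDiff_fderiv_flip_apply hAs).continuous.comp
        ((continuous_fst.comp hcont).prodMk hgc)).neg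
    have hW := eq_zero_of_hasDerivWithinAt (a := 0) (b := 1) hB.continuousOn
      (W := fun t => (ext01 (c' s) t).1 + A (ext01 (c s) t).1 (ext01 (c s) t).2) (fun t ht => ?_)
      (by simp [hinit s hs, init2 s hs]) t ht
    · exact eq_neg_of_add_eq_zero_left hW
    · have h1 := hasDerivWithinAt_fst (eq1 s hs t ht)
      have h2 := hasDerivWithinAt_snd (eq1 s hs t ht)
      have h3 : HasDerivWithinAt (fun t => A (ext01 (c s) t).1) _ (Icc 0 1) t :=
        HasFDerivAt.comp_hasDerivWithinAt (l := A) t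
          (hAs.differentiable (by simp) (ext01 (c s) t).1).hasFDerivAt h1
      refine ((eq2 s hs t ht).add (h3.clm_apply h2)).congr_deriv ?_
      have hj := hA.jacobi_vector (hV s hs t) (ext01 g t + s • ext01 δ t) (ext01 (c s) t).2
      generalize (ext01 (c s) t) = y at *
      generalize ext01 g t + s • ext01 δ t = γ at *
      simp only [map_neg, map_sub, map_add, neg_apply, ContinuousLinearMap.flip_apply]
      rw [sub_sub, sub_eq_zero] at hj
      rw [hj]
      abel
  refine ⟨fun s hs u _ => hV s hs u, ?_, ?_, ?_, fun s hs => by rw [hinit s hs],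
    fun u _ => ?_, fun s hs u hu => ?_, fun s hs u hu => (ContinuousLinearMap.snd ℝ E (E →L[ℝ] ℝ)).hasFDerivAt.comp_hasDerivAt s (hev s hs u),
    fun S S' u hu hSu hS => ?_, fun S S' u hu hSu hS => ?_⟩
  · exact continuous_fst.comp_continuousOn (continuousOn_ext01_uncurry hc.continuousOn _)
  · exact continuous_snd.comp_continuousOn (continuousOn_ext01_uncurry hc.continuousOn _)
  · exact continuous_snd.comp_continuousOn (continuousOn_ext01_uncurry hc' _)
  · exact contDiff_snd.comp_contDiffOn (contDiffOn_ext01_apply hc u)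
  · rw [← key s hs u hu]
    exact (ContinuousLinearMap.fst ℝ E (E →L[ℝ] ℝ)).hasFDerivAt.comp_hasDerivAt s (hev s hs u)
  · refine (hasDerivWithinAt_fst
      (hasDerivWithinAt_ext01_diag (hcd _ hSu) hS (eq1 _ hSu u hu))).congr_deriv ?_
    rw [Prod.fst_add, Prod.smul_fst, key _ hSu u hu]
    simp only [map_add, map_smul, smul_neg]
    abel
  · refine (hasDerivWithinAt_snd
      (hasDerivWithinAt_ext01_diag (hcd _ hSu) hS (eq1 _ hSu u hu))).congr_deriv ?_
    rw [Prod.snd_add, Prod.smul_snd, add_comm]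

/-- Near a solution there are families of solutions with prescribed initial values `x₀` and
prescribed covectors `g + s δ`. -/
theorem exists_gaugeFamily {A : E → (E →L[ℝ] ℝ) →L[ℝ] E} {U : Set E} (hA : IsPoissonOn A U)
    {X : PathSpace E} {p : PathSpace (E →L[ℝ] ℝ)} (hX : ∀ u, X u ∈ U)
    (heq : ∀ t ∈ Icc (0 : ℝ) 1,
      HasDerivWithinAt (ext01 X) (-(A (ext01 X t) (ext01 p t))) (Icc 0 1) t) :
    ∃ ε > 0, ∀ (x₀ : E) (g δ : PathSpace (E →L[ℝ] ℝ)), ‖x₀ - X 0‖ < ε → ‖g - p‖ < ε → ‖δ‖ < ε →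
      ∃ x β β₂, GaugeFamily A U 0 1 (ext01 g) (ext01 δ) x β β₂ ∧ x 0 0 = x₀ := by
  have : CompleteSpace E := FiniteDimensional.complete ℝ E
  obtain ⟨A', V, hA', -, hV, hKV, hVU, he⟩ := exists_cutoff hA.isOpen hA.contDiffAt
    (isCompact_range X.continuous) (range_subset_iff.2 hX)
  have hXV : ∀ u, X u ∈ V := fun u => hKV (mem_range_self u)
  -- The given solution is the base point of the implicit function theorem: with δ = 0 the parameter
  -- component is identically zero.
  set Y₀ : PathSpace (E × (E →L[ℝ] ℝ)) := pathMap (.inl ℝ E (E →L[ℝ] ℝ)) X with hY₀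
  have hY₀e : ∀ u, Y₀ u = (X u, 0) := fun u => rfl
  have hsol : Y₀ = constPath _ (X 0, 0) + equationRhs (gaugeFieldMap A' hA') (pairPath p 0) Y₀ := by
    refine eq_equationRhs_of_hasDerivWithinAt fun t ht => ?_
    have h1 : HasDerivWithinAt (ext01 Y₀) (-(A (ext01 X t) (ext01 p t)), 0) (Icc 0 1) t :=
      (ContinuousLinearMap.inl ℝ E (E →L[ℝ] ℝ)).hasFDerivAt.comp_hasDerivWithinAt t (heq t ht)
    refine h1.congr_deriv ?_
    rw [ext01_pairPath]
    refine Eq.trans ?_ (gaugeField_apply A' (ext01 X t, 0) (ext01 p t) 0).symm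
    have h2 : pairDeriv A' (ext01 X t) (ext01 p t) 0 = 0 := by ext w; simp [pairDeriv_apply]
    rw [he (hXV _), h2, sub_zero]
  have hopen : {Y : PathSpace (E × (E →L[ℝ] ℝ)) | ∀ u, (Y u).1 ∈ V} ∈ 𝓝 Y₀ := by
    have h1 : IsOpen {Y : PathSpace (E × (E →L[ℝ] ℝ)) | MapsTo Y univ (Prod.fst ⁻¹' V)} :=
      ContinuousMap.isOpen_setOfPred_mapsTo isCompact_univ (hV.preimage continuous_fst)
    filter_upwards [h1.mem_nhds fun u _ => hXV u] with Y hY u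
    exact hY (mem_univ u)
  obtain ⟨S, hS⟩ := exists_smooth_solution (gaugeFieldMap A' hA') (contDiff_gaugeField hA') hsol hopen
  have hΨ : Continuous (fun q : E × PathSpace (E →L[ℝ] ℝ) × PathSpace (E →L[ℝ] ℝ) =>
      ((q.1, (0 : E →L[ℝ] ℝ)), pairPath q.2.1 q.2.2)) :=
    (continuous_fst.prodMk continuous_const).prodMk (continuous_pairPath.comp continuous_snd)
  obtain ⟨r, hr, hball⟩ := Metric.eventually_nhds_iff.1
    ((hΨ.tendsto (X 0, p, 0)).eventually hS)
  -- As |s| ≤ 2 on `paramRange`, these bounds keep g + sδ within 3r/4 of p, so one neighbourhood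
  -- serves all values of s.
  refine ⟨r / 4, by positivity, fun x₀ g δ hx₀ hg hδ => ?_⟩
  set z : ℝ → (E × (E →L[ℝ] ℝ)) × PathSpace ((E →L[ℝ] ℝ) × (E →L[ℝ] ℝ)) :=
    fun s => ((x₀, 0), pairPath (g + s • δ) δ) with hz
  have hzs : ContDiff ℝ ∞ z := contDiff_const.prodMk (contDiff_pairPath g δ)
  have hprop : ∀ s ∈ paramRange, ContDiffAt ℝ ∞ S (z s) ∧ (∀ u, (S (z s) u).1 ∈ V) ∧
      S (z s) = constPath _ (x₀, 0) +
        equationRhs (gaugeFieldMap A' hA') (pairPath (g + s • δ) δ) (S (z s)) := by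
    intro s hs
    refine hball (y := (x₀, g + s • δ, δ)) ?_
    have hs2 : |s| ≤ 2 := abs_le.2 ⟨by linarith [hs.1], hs.2.le⟩
    have h1 : ‖g + s • δ - p‖ < r := by
      have h2 : ‖g + s • δ - p‖ ≤ ‖g - p‖ + |s| * ‖δ‖ := by
        rw [add_sub_right_comm]
        exact (norm_add_le _ _).trans (by rw [norm_smul, Real.norm_eq_abs])
      have h3 : |s| * ‖δ‖ ≤ 2 * ‖δ‖ := mul_le_mul_of_nonneg_right hs2 (norm_nonneg δ)
      linarith
    rw [Prod.dist_eq, Prod.dist_eq, dist_eq_norm, dist_eq_norm, dist_eq_norm, sub_zero]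
    exact max_lt (by linarith) (max_lt h1 (by linarith))
  have hc : ContDiffOn ℝ ∞ (fun s => S (z s)) paramRange := fun s hs =>
    ((hprop s hs).1.comp s hzs.contDiffAt).contDiffWithinAt
  have hopenR : IsOpen paramRange := isOpen_Ioo
  have hfam := gaugeFamily_of_curve (hA.congr hV hVU he) hA' hc
    (c' := deriv fun s => S (z s))
    (fun s hs => ((hc.contDiffAt (hopenR.mem_nhds hs)).differentiableAt (by simp)).hasDerivAt)
    (hc.continuousOn_deriv_of_isOpen hopenR (by simp))
    (fun s hs => (hprop s hs).2.1) (fun s hs => (hprop s hs).2.2)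
  refine ⟨_, _, _, hfam.congr_field hV hVU he, ?_⟩
  have h0 : (0 : ℝ) ∈ paramRange := ⟨by norm_num, by norm_num⟩
  have := apply_zero_of_eq_equationRhs (hprop 0 h0).2.2
  simp [ext01, this]

end Poisson

/-! ### Deforming a solution inside one chart by a cut off gauge family. -/

section Moved

theorem ContinuousOn.flip_apply {X E F G : Type*} [TopologicalSpace X] [NormedAddCommGroup E]
    [NormedSpace ℝ E] [NormedAddCommGroup F] [NormedSpace ℝ F]
    [NormedAddCommGroup G] [NormedSpace ℝ G] {D : X → E →L[ℝ] F →L[ℝ] G} {b : X → F} {s : Set X}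
    (hD : ContinuousOn D s) (hb : ContinuousOn b s) : ContinuousOn (fun x => (D x).flip (b x)) s := by
  have h0 : ContDiff ℝ 0 (fun L : E →L[ℝ] F →L[ℝ] G => L.flip) :=
    IsBoundedLinearMap.contDiff
      { map_add := fun _ _ => rfl
        map_smul := fun _ _ => rfl
        bound := ⟨1, one_pos, fun L => by rw [one_mul, ContinuousLinearMap.opNorm_flip]⟩ }
  have h1 : ContinuousOn (fun x => (D x).flip) s := h0.continuous.comp_continuousOn hD
  exact h1.clm_apply hb

theorem continuousOn_comp_fderiv_flip {X E F G : Type*} [TopologicalSpace X] [NormedAddCommGroup E]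
    [NormedSpace ℝ E] [NormedAddCommGroup F] [NormedSpace ℝ F]
    [NormedAddCommGroup G] [NormedSpace ℝ G] {A : E → F →L[ℝ] G} {U : Set E}
    (hA : ∀ y ∈ U, ContDiffAt ℝ ∞ A y) {s : Set X} {y : X → E} {ξ : X → G →L[ℝ] ℝ} {ζ : X → F}
    (hy : ContinuousOn y s) (hyU : MapsTo y s U) (hξ : ContinuousOn ξ s)
    (hζ : ContinuousOn ζ s) :
    ContinuousOn (fun q => ξ q ∘L (fderiv ℝ A (y q)).flip (ζ q)) s := by
  have h1 : ContinuousOn (fderiv ℝ A) U := fun z hz =>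
    (((hA z hz).fderiv_right (m := 0) (by simp)).continuousAt).continuousWithinAt
  exact hξ.clm_comp (ContinuousOn.flip_apply (h1.comp hy hyU) hζ)

variable {E : Type u} [NormedAddCommGroup E] [NormedSpace ℝ E]

theorem IsPoissonOn.continuousOn_pairDeriv {A : E → (E →L[ℝ] ℝ) →L[ℝ] E} {U : Set E}
    (hA : IsPoissonOn A U) {X : Type*} [TopologicalSpace X] {s : Set X} {y : X → E}
    {ξ ζ : X → E →L[ℝ] ℝ} (hy : ContinuousOn y s) (hyU : MapsTo y s U) (hξ : ContinuousOn ξ s)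
    (hζ : ContinuousOn ζ s) : ContinuousOn (fun q => pairDeriv A (y q) (ξ q) (ζ q)) s := by
  exact continuousOn_comp_fderiv_flip hA.contDiffAt hy hyU hξ hζ

theorem IsPoissonOn.pairDeriv_self {A : E → (E →L[ℝ] ℝ) →L[ℝ] E} {U : Set E}
    (hA : IsPoissonOn A U) {y : E} (hy : y ∈ U) (ξ : E →L[ℝ] ℝ) : pairDeriv A y ξ ξ = 0 := by
  ext w
  have := hA.fderiv_skew y hy w ξ ξ
  rw [pairDeriv_apply, zero_apply]
  linarith

theorem pairDeriv_add_left (A : E → (E →L[ℝ] ℝ) →L[ℝ] E) (y : E) (ξ ξ' ζ : E →L[ℝ] ℝ) :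
    pairDeriv A y (ξ + ξ') ζ = pairDeriv A y ξ ζ + pairDeriv A y ξ' ζ := by
  ext w; simp [pairDeriv_apply]

theorem pairDeriv_smul_left (A : E → (E →L[ℝ] ℝ) →L[ℝ] E) (y : E) (r : ℝ) (ξ ζ : E →L[ℝ] ℝ) :
    pairDeriv A y (r • ξ) ζ = r • pairDeriv A y ξ ζ := by
  ext w; simp [pairDeriv_apply]

theorem pairDeriv_smul_right (A : E → (E →L[ℝ] ℝ) →L[ℝ] E) (y : E) (r : ℝ) (ξ ζ : E →L[ℝ] ℝ) :
    pairDeriv A y ξ (r • ζ) = r • pairDeriv A y ξ ζ := by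
  ext w; simp [pairDeriv_apply]

variable {M : Type*} [TopologicalSpace M] [ChartedSpace E M] [IsManifold 𝓘(ℝ, E) ∞ M]

/-- The solution obtained from `P` by replacing its restriction to `[a, b]` by the member
`s κ(u)` of a family of solutions given in the chart centred at `c`. -/
def movedCurve {α : PoissonStructure E M} (P : Constraint α) (c : M) (a b : ℝ)
    (g δ : ℝ → E →L[ℝ] ℝ) (x : ℝ → ℝ → E) (β : ℝ → ℝ → E →L[ℝ] ℝ) (κ : ℝ → ℝ) (s u : ℝ) :
    CoTangentBundle E M :=
  if u ∈ Icc a b then ofCoord c (x (s * κ u) u)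
    (g u + (s * κ u) • δ u + (s * deriv κ u) • β (s * κ u) u)
  else ext01 P.toMap u

/-- The gauge parameter of `movedCurve`. -/
def movedParam {α : PoissonStructure E M} (P : Constraint α) (c : M) (a b : ℝ)
    (x : ℝ → ℝ → E) (β : ℝ → ℝ → E →L[ℝ] ℝ) (κ : ℝ → ℝ) (s u : ℝ) : CoTangentBundle E M :=
  if u ∈ Icc a b then ofCoord c (x (s * κ u) u) (κ u • β (s * κ u) u)
  else scale 0 (ext01 P.toMap u)

theorem mul_mem_paramRange {s k : ℝ} (hs : s ∈ Icc (0 : ℝ) 1) (hk : k ∈ Icc (0 : ℝ) 1) :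
    s * k ∈ paramRange :=
  ⟨by nlinarith [hs.1, hk.1], by nlinarith [hs.1, hk.1, hs.2, hk.2]⟩

section Square

variable {α : PoissonStructure E M} {P : Constraint α} {c : M} {a b : ℝ}
  {g δ : ℝ → E →L[ℝ] ℝ} {x : ℝ → ℝ → E} {β β₂ : ℝ → ℝ → E →L[ℝ] ℝ} {κ : ℝ → ℝ} {U : Set E}

theorem movedCurve_of_mem {s u : ℝ} (hu : u ∈ Icc a b) :
    movedCurve P c a b g δ x β κ s u = ofCoord c (x (s * κ u) u)
      (g u + (s * κ u) • δ u + (s * deriv κ u) • β (s * κ u) u) := if_pos hu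

theorem movedParam_of_mem {s u : ℝ} (hu : u ∈ Icc a b) :
    movedParam P c a b x β κ s u = ofCoord c (x (s * κ u) u) (κ u • β (s * κ u) u) := if_pos hu

variable (h : GaugeFamily (α.coord c) U a b g δ x β β₂) (hU : U ⊆ (extChartAt 𝓘(ℝ, E) c).target)
  (hκ : ContDiff ℝ ∞ κ) (hκI : ∀ u, κ u ∈ Icc (0 : ℝ) 1)
include h hU hκ hκI

/-- The u-dependence of the family parameter sκ(u) adds sκ'β to the form, and the chain rule in s
turns β into κβ as gauge parameter. The remaining equation is the formula for the u-derivative of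
κβ. -/
theorem gaugeEq_moved (hA : IsPoissonOn (α.coord c) U) {s u : ℝ} (hs : s ∈ Icc (0 : ℝ) 1)
    (hu : u ∈ Icc a b) (hn : Icc a b ∈ 𝓝[Icc 0 1] u) :
    GaugeEq α (movedCurve P c a b g δ x β κ) (movedParam P c a b x β κ) c
      (κ u • (δ u - pairDeriv (α.coord c) (x (s * κ u) u) (g u + (s * κ u) • δ u) (β (s * κ u) u) +
        (s * deriv κ u) • β₂ (s * κ u) u) + deriv κ u • β (s * κ u) u) s u := by
  have hmem : ∀ r ∈ Icc (0 : ℝ) 1, ∀ v ∈ Icc a b, x (r * κ v) v ∈ U := fun r hr v hv =>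
    h.mem _ (mul_mem_paramRange hr (hκI v)) v hv
  have hκd : ∀ v, HasDerivAt κ (deriv κ v) v := fun v =>
    ((hκ.differentiable (by simp)) v).hasDerivAt
  have hS : HasDerivWithinAt (fun v => s * κ v) (s * deriv κ u) (Icc a b) u :=
    ((hκd u).const_mul s).hasDerivWithinAt
  have hsu := mul_mem_paramRange hs (hκI u)
  have e1 : ∀ r ∈ Icc (0 : ℝ) 1, ∀ v ∈ Icc a b,
      extChartAt 𝓘(ℝ, E) c (movedCurve P c a b g δ x β κ r v).proj = x (r * κ v) v :=
    fun r hr v hv => by rw [movedCurve_of_mem hv, extChartAt_ofCoord (hU (hmem r hr v hv))]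
  have e2 : ∀ r ∈ Icc (0 : ℝ) 1, ∀ v ∈ Icc a b,
      coordCovector c (movedCurve P c a b g δ x β κ r v) =
        g v + (r * κ v) • δ v + (r * deriv κ v) • β (r * κ v) v :=
    fun r hr v hv => by rw [movedCurve_of_mem hv, coordCovector_ofCoord (hU (hmem r hr v hv))]
  have e3 : ∀ r ∈ Icc (0 : ℝ) 1, ∀ v ∈ Icc a b,
      coordCovector c (movedParam P c a b x β κ r v) = κ v • β (r * κ v) v :=
    fun r hr v hv => by rw [movedParam_of_mem hv, coordCovector_ofCoord (hU (hmem r hr v hv))]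
  have hr : HasDerivAt (fun r => r * κ u) (κ u) s := by
    simpa using (hasDerivAt_id s).mul_const (κ u)
  have hβr : HasDerivAt (fun r => β (r * κ u) u) (κ u • β₂ (s * κ u) u) s :=
    HasDerivAt.scomp (g₁ := fun r => β r u) s (h.param_left _ hsu u hu) hr
  refine ⟨?_, ?_, ?_, ?_, ?_⟩
  · rw [movedCurve_of_mem hu, ofCoord_proj]
    exact symm_mem_source (hU (hmem s hs u hu))
  · rw [e1 s hs u hu, e2 s hs u hu]
    exact ((h.base_diag _ _ u hu hsu hS).congr (fun v hv => e1 s hs v hv)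
      (e1 s hs u hu)).mono_of_mem_nhdsWithin hn
  · rw [e1 s hs u hu, e3 s hs u hu, map_smul, ← smul_neg]
    exact (HasDerivAt.scomp (g₁ := fun r => x r u) s (h.base_left _ hsu u hu) hr).hasDerivWithinAt.congr
      (fun r hr => e1 r hr u hu) (e1 s hs u hu)
  · exact ((((hκd u).hasDerivWithinAt.smul (h.param_diag _ _ u hu hsu hS))).congr
      (fun v hv => e3 s hs v hv) (e3 s hs u hu)).mono_of_mem_nhdsWithin hn
  · have hβr' : HasDerivAt (fun r => (r * deriv κ u) • β (r * κ u) u)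
        ((s * deriv κ u) • κ u • β₂ (s * κ u) u + deriv κ u • β (s * κ u) u) s := by
      have : HasDerivAt (fun r => r * deriv κ u) (deriv κ u) s := by
        simpa using (hasDerivAt_id s).mul_const (deriv κ u)
      exact this.smul hβr
    have h1 := (((hasDerivAt_const s (g u)).add (hr.smul_const (δ u))).add hβr').hasDerivWithinAt
      (s := Icc 0 1)
    rw [e1 s hs u hu, e2 s hs u hu, e3 s hs u hu]
    refine (h1.congr (fun r hr => e2 r hr u hu) (e2 s hs u hu)).congr_deriv ?_
    change _ = _ + pairDeriv (α.coord c) _ _ _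
    -- The part of the form along β pairs to zero with the parameter κβ by skewness; the part along
    -- g + sκδ cancels the corresponding term of b'.
    rw [pairDeriv_smul_right, pairDeriv_add_left _ _ (g u + (s * κ u) • δ u), pairDeriv_smul_left,
      hA.pairDeriv_self (hmem s hs u hu)]
    module

/-- The formula on [a, b] has to hold near u. Requiring a neighbourhood within [0,1], rather than in
the line, lets u be an end point of the unit interval. -/
theorem gaugeEqNear_moved (hA : IsPoissonOn (α.coord c) U) (hg : ContinuousOn g (Icc a b))
    (hδ : ContinuousOn δ (Icc a b)) {s u : ℝ} (hs : s ∈ Icc (0 : ℝ) 1) (hu : u ∈ Icc (0 : ℝ) 1)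
    (hn : Icc a b ∈ 𝓝[Icc 0 1] u) :
    ContinuousWithinAt (fun q : ℝ × ℝ => movedCurve P c a b g δ x β κ q.1 q.2) unitSquare (s, u) ∧
    ContinuousWithinAt (fun q : ℝ × ℝ => movedParam P c a b x β κ q.1 q.2) unitSquare (s, u) ∧
    GaugeEqNear α (movedCurve P c a b g δ x β κ) (movedParam P c a b x β κ) s u := by
  have hua : u ∈ Icc a b := mem_of_mem_nhdsWithin hu hn
  have hset : (Icc (0 : ℝ) 1 ×ˢ Icc a b) ∈ 𝓝[unitSquare] (s, u) := by
    rw [nhdsWithin_prod_eq]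
    exact Filter.prod_mem_prod self_mem_nhdsWithin hn
  have hm : MapsTo (fun q : ℝ × ℝ => (q.1 * κ q.2, q.2)) (Icc (0 : ℝ) 1 ×ˢ Icc a b)
      (paramRange ×ˢ Icc a b) := fun q hq => ⟨mul_mem_paramRange hq.1 (hκI _), hq.2⟩
  have cκ : Continuous κ := hκ.continuous
  have cκ' : Continuous (deriv κ) := hκ.continuous_deriv (by simp)
  have hcm : ContinuousOn (fun q : ℝ × ℝ => (q.1 * κ q.2, q.2)) (Icc (0 : ℝ) 1 ×ˢ Icc a b) := by
    fun_prop
  have cx := h.continuousOn_base.comp hcm hm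
  have cβ := h.continuousOn_param.comp hcm hm
  have cβ₂ := h.continuousOn_deriv.comp hcm hm
  have cg : ContinuousOn (fun q : ℝ × ℝ => g q.2) (Icc (0 : ℝ) 1 ×ˢ Icc a b) :=
    hg.comp continuousOn_snd fun q hq => hq.2
  have cδ : ContinuousOn (fun q : ℝ × ℝ => δ q.2) (Icc (0 : ℝ) 1 ×ˢ Icc a b) :=
    hδ.comp continuousOn_snd fun q hq => hq.2
  have c1 : ContinuousOn (fun q : ℝ × ℝ => q.1 * κ q.2) (Icc (0 : ℝ) 1 ×ˢ Icc a b) := by fun_prop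
  have c2 : ContinuousOn (fun q : ℝ × ℝ => q.1 * deriv κ q.2) (Icc (0 : ℝ) 1 ×ˢ Icc a b) := by
    fun_prop
  have c3 : ContinuousOn (fun q : ℝ × ℝ => κ q.2) (Icc (0 : ℝ) 1 ×ˢ Icc a b) := by fun_prop
  have c4 : ContinuousOn (fun q : ℝ × ℝ => deriv κ q.2) (Icc (0 : ℝ) 1 ×ˢ Icc a b) := by fun_prop
  have hmem : ∀ q ∈ Icc (0 : ℝ) 1 ×ˢ Icc a b, x (q.1 * κ q.2) q.2 ∈ U := fun q hq =>
    h.mem _ (hm hq).1 _ hq.2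
  have hsu : ((s, u) : ℝ × ℝ) ∈ Icc (0 : ℝ) 1 ×ˢ Icc a b := ⟨hs, hua⟩
  have cof : ∀ ξ : ℝ × ℝ → E →L[ℝ] ℝ, ContinuousOn ξ (Icc (0 : ℝ) 1 ×ˢ Icc a b) →
      ContinuousOn (fun q : ℝ × ℝ => ofCoord c (x (q.1 * κ q.2) q.2) (ξ q))
        (Icc (0 : ℝ) 1 ×ˢ Icc a b) := by
    intro ξ hξ q hq
    have hq' : (ofCoord c (x (q.1 * κ q.2) q.2) (ξ q)).proj ∈ (chartAt E c).source :=
      symm_mem_source (hU (hmem q hq))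
    refine (continuousWithinAt_cotangent_iff c
      (f := fun q : ℝ × ℝ => ofCoord c (x (q.1 * κ q.2) q.2) (ξ q)) hq').2 ⟨?_, ?_⟩
    · refine (continuousWithinAt_proj_iff c
        (f := fun q : ℝ × ℝ => (ofCoord c (x (q.1 * κ q.2) q.2) (ξ q)).proj) (eventually_mem_nhdsWithin.mono fun r hr =>
        symm_mem_source (hU (hmem r hr))) hq').2 ?_
      exact (cx q hq).congr (fun r hr => extChartAt_ofCoord (hU (hmem r hr)) _)
        (extChartAt_ofCoord (hU (hmem q hq)) _)
    · exact (hξ q hq).congr (fun r hr => coordCovector_ofCoord (hU (hmem r hr)) _)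
        (coordCovector_ofCoord (hU (hmem q hq)) _)
  refine ⟨?_, ?_, c, fun q => κ q.2 • (δ q.2 - pairDeriv (α.coord c) (x (q.1 * κ q.2) q.2)
    (g q.2 + (q.1 * κ q.2) • δ q.2) (β (q.1 * κ q.2) q.2) +
    (q.1 * deriv κ q.2) • β₂ (q.1 * κ q.2) q.2) + deriv κ q.2 • β (q.1 * κ q.2) q.2, ?_, ?_⟩
  · have := cof _ ((cg.add (c1.smul cδ)).add (c2.smul cβ))
    exact ((this (s, u) hsu).congr (fun q hq => movedCurve_of_mem hq.2)
      (movedCurve_of_mem hua)).mono_of_mem_nhdsWithin hset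
  · have := cof _ (c3.smul cβ)
    exact ((this (s, u) hsu).congr (fun q hq => movedParam_of_mem hq.2)
      (movedParam_of_mem hua)).mono_of_mem_nhdsWithin hset
  · have c5 := hA.continuousOn_pairDeriv cx hmem (cg.add (c1.smul cδ)) cβ
    have c6 := (c3.smul ((cδ.sub c5).add (c2.smul cβ₂))).add (c4.smul cβ)
    exact (c6 (s, u) hsu).mono_of_mem_nhdsWithin hset
  · have h1 : ∀ᶠ q : ℝ × ℝ in 𝓝[unitSquare] (s, u), Icc a b ∈ 𝓝[Icc 0 1] q.2 := by
      have : ∀ᶠ v in 𝓝[Icc 0 1] u, Icc a b ∈ 𝓝[Icc 0 1] v :=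
        eventually_eventually_nhdsWithin.2 hn
      have h2 : Filter.Tendsto Prod.snd (𝓝[unitSquare] (s, u)) (𝓝[Icc (0 : ℝ) 1] u) := by
        rw [nhdsWithin_prod_eq]; exact Filter.tendsto_snd
      exact h2.eventually this
    filter_upwards [h1, eventually_mem_nhdsWithin] with q h2 h3
    exact gaugeEq_moved h hU hκ hκI hA h3.1 (mem_of_mem_nhdsWithin h3.2 h2) h2

end Square

theorem GaugeSquare.of_gaugeEqNear {α : PoissonStructure E M} {Z B : ℝ → ℝ → CoTangentBundle E M}
    (h : ∀ s ∈ Icc (0 : ℝ) 1, ∀ u ∈ Icc (0 : ℝ) 1,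
      ContinuousWithinAt (fun q : ℝ × ℝ => Z q.1 q.2) unitSquare (s, u) ∧
      ContinuousWithinAt (fun q : ℝ × ℝ => B q.1 q.2) unitSquare (s, u) ∧ GaugeEqNear α Z B s u)
    (hp : ∀ s ∈ Icc (0 : ℝ) 1, ∀ u ∈ Icc (0 : ℝ) 1, (B s u).proj = (Z s u).proj)
    (h0 : ∀ s ∈ Icc (0 : ℝ) 1, (B s 0).2 = 0) (h1 : ∀ s ∈ Icc (0 : ℝ) 1, (B s 1).2 = 0) :
    GaugeSquare α Z B :=
  ⟨fun q hq => (h q.1 hq.1 q.2 hq.2).1, fun q hq => (h q.1 hq.1 q.2 hq.2).2.1, hp, h0, h1,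
    fun s hs u hu => (h s hs u hu).2.2⟩

theorem ofCoord_snd_zero (c : M) (y : E) : (ofCoord c y 0).2 = 0 :=
  ContinuousLinearMap.zero_comp _

variable [FiniteDimensional ℝ E] [T2Space M]

/-- Moving a solution along a family of solutions in a chart does not change its class. -/
theorem exists_gaugeRelated_moved {α : PoissonStructure E M} (P : Constraint α) {c : M} {a b : ℝ}
    {g δ : ℝ → E →L[ℝ] ℝ} {x : ℝ → ℝ → E} {β β₂ : ℝ → ℝ → E →L[ℝ] ℝ} {κ : ℝ → ℝ} {U : Set E}
    (ha : 0 ≤ a) (hab : a < b) (hb : b ≤ 1)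
    (h : GaugeFamily (α.coord c) U a b g δ x β β₂) (hUo : IsOpen U)
    (hU : U ⊆ (extChartAt 𝓘(ℝ, E) c).target)
    (hsrc : ∀ u ∈ Icc a b, (ext01 P.toMap u).proj ∈ (chartAt E c).source)
    (hg : ∀ u ∈ Icc a b, g u = coordCovector c (ext01 P.toMap u))
    (hx : x 0 a = extChartAt 𝓘(ℝ, E) c (ext01 P.toMap a).proj)
    (hδ : ContinuousOn δ (Icc a b)) (hκ : ContDiff ℝ ∞ κ) (hκI : ∀ u, κ u ∈ Icc (0 : ℝ) 1)
    (hκ1 : κ 1 = 0) (hκn : ∀ u ∈ Icc (0 : ℝ) 1, κ =ᶠ[𝓝 u] 0 ∨ Icc a b ∈ 𝓝[Icc 0 1] u) :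
    ∃ Q : Constraint α, GaugeRelated P Q ∧
      (∀ u ∈ Icc (0 : ℝ) 1, u ∉ Icc a b ∨ κ =ᶠ[𝓝 u] 0 → ext01 Q.toMap u = ext01 P.toMap u) ∧
      ∀ u ∈ Icc a b, ext01 Q.toMap u =
        ofCoord c (x (κ u) u) (g u + κ u • δ u + deriv κ u • β (κ u) u) := by
  have hsub : Icc a b ⊆ Icc (0 : ℝ) 1 := Icc_subset_Icc ha hb
  have hA := isPoissonOn_coord α c
  have hAU : IsPoissonOn (α.coord c) U := hA.congr hUo hU fun _ _ => rfl
  have hP1 := P.continuous_ext01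
  have hgc : ContinuousOn g (Icc a b) := by
    refine ContinuousOn.congr (fun u hu => ?_) hg
    exact ((continuousWithinAt_cotangent_iff c (hsrc u hu)).1 hP1.continuousWithinAt).2
  have h00 : (0 : ℝ) ∈ paramRange := by constructor <;> norm_num
  -- At s = 0 the family solves the same equation as P with the same initial value, so it retraces P
  -- on [a, b]; hence the two branches of the deformed curve match where κ vanishes.
  have hbase : EqOn (x 0) (fun u => extChartAt 𝓘(ℝ, E) c (ext01 P.toMap u).proj) (Icc a b) := by
    refine eqOn_of_hasDerivWithinAt (A := α.coord c) hA.isOpen hA.contDiffAt hgc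
      (fun u hu => hU (h.mem 0 h00 u hu)) (fun u hu => extChartAt_mem_target (hsrc u hu))
      (fun u hu => ?_) (fun u hu => ?_) hx
    · have := h.base_diag (fun _ => 0) 0 u hu h00 (hasDerivWithinAt_const _ _ _)
      simpa only [zero_smul, add_zero] using this
    · rw [hg u hu]
      exact (P.isSolutionAt (hsub hu) (hsrc u hu)).mono hsub
  have e0 : ∀ u ∈ Icc a b, ofCoord c (x 0 u) (g u) = ext01 P.toMap u := fun u hu => by
    rw [hbase hu, hg u hu, ofCoord_coord (hsrc u hu)]
  have e1 : ∀ u ∈ Icc a b, ofCoord c (x 0 u) 0 = scale 0 (ext01 P.toMap u) := fun u hu => by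
    refine eq_of_snd_eq_zero ?_ (ofCoord_snd_zero c _) (scale_zero_snd _)
    rw [ofCoord_proj, hbase hu, symm_extChartAt (hsrc u hu)]
    rfl
  have hZP : ∀ s u, κ =ᶠ[𝓝 u] 0 → movedCurve P c a b g δ x β κ s u = ext01 P.toMap u ∧
      movedParam P c a b x β κ s u = scale 0 (ext01 P.toMap u) := by
    intro s u hk
    have hk0 : κ u = 0 := hk.self_of_nhds
    have hk1 : deriv κ u = 0 := by rw [hk.deriv_eq]; simp
    unfold movedCurve movedParam
    split_ifs with hu
    · simp only [hk0, hk1, mul_zero, zero_smul, add_zero]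
      exact ⟨e0 u hu, e1 u hu⟩
    · exact ⟨rfl, rfl⟩
  have hsq : GaugeSquare α (movedCurve P c a b g δ x β κ) (movedParam P c a b x β κ) := by
    refine GaugeSquare.of_gaugeEqNear (fun s hs u hu => ?_) (fun s hs u hu => ?_) (fun s hs => ?_)
      fun s hs => ?_
    · rcases hκn u hu with hk | hn
      · have hev : ∀ᶠ q : ℝ × ℝ in 𝓝[unitSquare] (s, u),
            movedCurve P c a b g δ x β κ q.1 q.2 = ext01 P.toMap q.2 ∧
            movedParam P c a b x β κ q.1 q.2 = scale 0 (ext01 P.toMap q.2) := by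
          have h2 : Filter.Tendsto Prod.snd (𝓝[unitSquare] (s, u)) (𝓝 u) :=
            continuous_snd.continuousAt.mono_left nhdsWithin_le_nhds
          filter_upwards [h2.eventually (eventually_eventually_nhds.2 hk)] with q hq
          exact hZP q.1 q.2 hq
        have hself := hev.self_of_nhdsWithin ⟨hs, hu⟩
        have hc := P.gaugeSquare
        exact ⟨(hc.continuousOn_curve (s, u) ⟨hs, hu⟩).congr_of_eventuallyEq
            (hev.mono fun _ hq => hq.1) hself.1,
          (hc.continuousOn_param (s, u) ⟨hs, hu⟩).congr_of_eventuallyEq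
            (hev.mono fun _ hq => hq.2) hself.2, (hc.gaugeEqNear s hs u hu).congr hev⟩
      · exact gaugeEqNear_moved h hU hκ hκI hAU hgc hδ hs hu hn
    · unfold movedCurve movedParam
      split_ifs <;> rfl
    -- The two ends differ: at 0 the initial condition on β makes the parameter vanish whatever κ
    -- is, while at 1 only the cutoff does.
    · by_cases hu : (0 : ℝ) ∈ Icc a b
      · obtain rfl : a = 0 := le_antisymm hu.1 ha
        rw [movedParam_of_mem hu, h.param_init _ (mul_mem_paramRange hs (hκI _)), smul_zero]
        exact ofCoord_snd_zero _ _
      · rw [movedParam, if_neg hu]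
        exact scale_zero_snd _
    · by_cases hu : (1 : ℝ) ∈ Icc a b
      · rw [movedParam_of_mem hu, hκ1, zero_smul]
        exact ofCoord_snd_zero _ _
      · rw [movedParam, if_neg hu]
        exact scale_zero_snd _
  refine ⟨hsq.row 1 (by simp), hsq.gaugeRelated (fun u hu => ?_) (fun u hu => hsq.ext01_row _ hu),
    fun u hu hk => ?_, fun u hu => ?_⟩
  · unfold movedCurve
    split_ifs with hua
    · simp only [zero_mul, zero_smul, add_zero]
      exact (e0 u hua).symm
    · rfl
  · rw [hsq.ext01_row _ hu]
    rcases hk with hk | hk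
    · exact if_neg hk
    · exact (hZP 1 u hk).1
  · rw [hsq.ext01_row _ (hsub hu), movedCurve_of_mem hu]
    simp only [one_mul]

end Moved

/-! ### Making the one-form vanish near a point. -/

section Flattening

theorem exists_plateau (l r : ℝ) {η : ℝ} (hη : 0 < η) : ∃ κ : ℝ → ℝ, ContDiff ℝ ∞ κ ∧
    (∀ u, κ u ∈ Icc (0 : ℝ) 1) ∧ (∀ u, u ≤ l + η ∨ r - η ≤ u → κ u = 0) ∧
    ∀ u ∈ Icc (l + 2 * η) (r - 2 * η), κ u = 1 := by
  refine ⟨fun u => Real.smoothTransition ((u - l - η) / η) *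
    Real.smoothTransition ((r - η - u) / η), ?_, fun u => ⟨?_, ?_⟩, fun u hu => ?_, fun u hu => ?_⟩
  · exact (Real.smoothTransition.contDiff.comp (by fun_prop)).mul
      (Real.smoothTransition.contDiff.comp (by fun_prop))
  · exact mul_nonneg (Real.smoothTransition.nonneg _) (Real.smoothTransition.nonneg _)
  · exact mul_le_one₀ (Real.smoothTransition.le_one _) (Real.smoothTransition.nonneg _)
      (Real.smoothTransition.le_one _)
  · rcases hu with hu | hu
    · simp only []
      rw [Real.smoothTransition.zero_of_nonpos (div_nonpos_of_nonpos_of_nonneg (by linarith) hη.le),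
        zero_mul]
    · simp only []
      rw [Real.smoothTransition.zero_of_nonpos (x := (r - η - u) / η)
        (div_nonpos_of_nonpos_of_nonneg (by linarith) hη.le), mul_zero]
  · simp only []
    rw [Real.smoothTransition.one_of_one_le ((one_le_div hη).2 (by linarith [hu.1])),
      Real.smoothTransition.one_of_one_le ((one_le_div hη).2 (by linarith [hu.2])), mul_one]

theorem eventuallyEq_zero_of_plateau {κ : ℝ → ℝ} {l r η u : ℝ}
    (h : ∀ u, u ≤ l + η ∨ r - η ≤ u → κ u = 0) (hu : u < l + η ∨ r - η < u) : κ =ᶠ[𝓝 u] 0 := by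
  rcases hu with hu | hu
  · filter_upwards [Iio_mem_nhds hu] with v hv using h v (Or.inl (le_of_lt hv))
  · filter_upwards [Ioi_mem_nhds hu] with v hv using h v (Or.inr (le_of_lt hv))

theorem continuous_smul_ext01 {F : Type*} [NormedAddCommGroup F] [NormedSpace ℝ F]
    (f : PathSpace F) (r a b : ℝ) : Continuous (fun u => r • ext01 f ((u - a) / (b - a))) := by
  have h1 : Continuous (ext01 f) := f.continuous.comp continuous_projIcc
  have h2 : Continuous (fun u => ext01 f ((u - a) / (b - a))) := h1.comp (by fun_prop)
  exact h2.const_smul r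

variable {E : Type u} [NormedAddCommGroup E] [NormedSpace ℝ E]
variable {M : Type*} [TopologicalSpace M] [ChartedSpace E M] [IsManifold 𝓘(ℝ, E) ∞ M]
variable {α : PoissonStructure E M}

theorem affine_mem_Icc {a b t : ℝ} (hab : a < b) (ht : t ∈ Icc (0 : ℝ) 1) :
    a + (b - a) * t ∈ Icc a b :=
  ⟨by nlinarith [ht.1], by nlinarith [ht.2]⟩

theorem div_mem_Icc {a b u : ℝ} (hab : a < b) (hu : u ∈ Icc a b) :
    (u - a) / (b - a) ∈ Icc (0 : ℝ) 1 :=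
  ⟨div_nonneg (by linarith [hu.1]) (by linarith), (div_le_one (by linarith)).2 (by linarith [hu.2])⟩

theorem affine_div {a b : ℝ} (hab : a < b) (u : ℝ) : a + (b - a) * ((u - a) / (b - a)) = u := by
  have : b - a ≠ 0 := by linarith
  field_simp
  ring

theorem Constraint.continuousOn_coordCovector (P : Constraint α) {c : M} {s : Set ℝ}
    (h : ∀ u ∈ s, (ext01 P.toMap u).proj ∈ (chartAt E c).source) :
    ContinuousOn (fun u => coordCovector c (ext01 P.toMap u)) s := fun u hu =>
  ((continuousWithinAt_cotangent_iff c (h u hu)).1 P.continuous_ext01.continuousWithinAt).2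

/-- The components of the one-form of `P` on `[a, b]`, transported to `[0, 1]`. -/
def Constraint.coordPath (P : Constraint α) (c : M) {a b : ℝ} (hab : a < b)
    (h : ∀ u ∈ Icc a b, (ext01 P.toMap u).proj ∈ (chartAt E c).source) :
    PathSpace (E →L[ℝ] ℝ) :=
  ⟨fun t => (b - a) • coordCovector c (ext01 P.toMap (a + (b - a) * t)),
    ((P.continuousOn_coordCovector h).comp_continuous
      (f := fun t : I => a + (b - a) * (t : ℝ)) (by fun_prop)
      fun t => affine_mem_Icc hab t.2).const_smul (b - a)⟩

theorem Constraint.coordPath_apply (P : Constraint α) (c : M) {a b : ℝ} (hab : a < b)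
    (h : ∀ u ∈ Icc a b, (ext01 P.toMap u).proj ∈ (chartAt E c).source) (t : I) :
    P.coordPath c hab h t = (b - a) • coordCovector c (ext01 P.toMap (a + (b - a) * t)) := rfl

theorem Constraint.ext01_coordPath (P : Constraint α) (c : M) {a b : ℝ} (hab : a < b)
    (h : ∀ u ∈ Icc a b, (ext01 P.toMap u).proj ∈ (chartAt E c).source) {u : ℝ} (hu : u ∈ Icc a b) :
    (b - a)⁻¹ • ext01 (P.coordPath c hab h) ((u - a) / (b - a)) =
      coordCovector c (ext01 P.toMap u) := by
  have h1 : b - a ≠ 0 := by linarith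
  rw [ext01, Constraint.coordPath_apply, projIcc_of_mem _ (div_mem_Icc hab hu), smul_smul,
    inv_mul_cancel₀ h1, one_smul, affine_div hab]

variable [FiniteDimensional ℝ E] [T2Space M]

/-- The one-form can be made to vanish near a point by a gauge transformation supported near that
point. -/
theorem Constraint.exists_flat_of_lt (P : Constraint α) {u₀ : ℝ} (h0 : 0 ≤ u₀) (h1 : u₀ < 1)
    {V : Set M} (hV : IsOpen V) (hX : (ext01 P.toMap u₀).proj ∈ V) {ρ : ℝ} (hρ : 0 < ρ) :
    ∃ Q : Constraint α, GaugeRelated P Q ∧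
      (∀ u ∈ Icc (0 : ℝ) 1, ext01 Q.toMap u = ext01 P.toMap u ∨
        (|u - u₀| < ρ ∧ (ext01 Q.toMap u).proj ∈ V)) ∧
      ∀ᶠ u in 𝓝[Icc 0 1] u₀, (ext01 Q.toMap u).2 = 0 := by
  set c : M := (ext01 P.toMap u₀).proj with hc
  set y₀ : E := extChartAt 𝓘(ℝ, E) c c with hy₀
  have hcs : c ∈ (chartAt E c).source := mem_chart_source _ _
  set U : Set E := (extChartAt 𝓘(ℝ, E) c).target ∩ (extChartAt 𝓘(ℝ, E) c).symm ⁻¹' V with hU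
  have hUo : IsOpen U :=
    (continuousOn_extChartAt_symm c).isOpen_inter_preimage (isOpen_extChartAt_target c) hV
  have hUt : U ⊆ (extChartAt 𝓘(ℝ, E) c).target := inter_subset_left
  have hyU : y₀ ∈ U := ⟨extChartAt_mem_target hcs, by
    rw [mem_preimage, hy₀, symm_extChartAt hcs]; exact hX⟩
  have hAU : IsPoissonOn (α.coord c) U := (isPoissonOn_coord α c).congr hUo hUt fun _ _ => rfl
  -- The reference solution is constant with zero form. Restricted to a short interval and rescaled
  -- to [0,1], any solution is close to it.
  obtain ⟨ε, hε, hfam⟩ := exists_gaugeFamily hAU (X := ContinuousMap.const _ y₀) (p := 0)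
    (fun _ => hyU) fun t ht => by
      change HasDerivWithinAt (fun _ => y₀) (-(α.coord c y₀ 0)) _ _
      rw [map_zero, neg_zero]
      exact hasDerivWithinAt_const _ _ _
  set C : ℝ := ‖coordCovector c (ext01 P.toMap u₀)‖ + 1 with hC
  have hC0 : 0 < C := by positivity
  have hXc : Continuous (fun u => (ext01 P.toMap u).proj) :=
    continuous_proj_cotangent.comp P.continuous_ext01
  have hev : ∀ᶠ u in 𝓝 u₀, (ext01 P.toMap u).proj ∈ (chartAt E c).source ∧
      ‖coordCovector c (ext01 P.toMap u)‖ < C ∧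
      ‖extChartAt 𝓘(ℝ, E) c (ext01 P.toMap u).proj - y₀‖ < ε := by
    have e1 : ∀ᶠ u in 𝓝 u₀, (ext01 P.toMap u).proj ∈ (chartAt E c).source :=
      hXc.continuousAt ((chartAt E c).open_source.mem_nhds hcs)
    have hcov : ContinuousAt (fun u => coordCovector c (ext01 P.toMap u)) u₀ :=
      (P.continuousOn_coordCovector (s := (fun u => (ext01 P.toMap u).proj) ⁻¹'
        (chartAt E c).source) fun u hu => hu).continuousAt e1
    have e2 : ContinuousAt (fun u => extChartAt 𝓘(ℝ, E) c (ext01 P.toMap u).proj) u₀ :=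
      ContinuousAt.comp (g := extChartAt 𝓘(ℝ, E) c)
        (continuousAt_extChartAt' (by rw [extChartAt_source]; exact hcs)) hXc.continuousAt
    have e3 : ∀ᶠ u in 𝓝 u₀, ‖coordCovector c (ext01 P.toMap u)‖ < C :=
      hcov.norm.eventually_lt continuousAt_const (by linarith)
    have e4 : ∀ᶠ u in 𝓝 u₀, ‖extChartAt 𝓘(ℝ, E) c (ext01 P.toMap u).proj - y₀‖ < ε :=
      (e2.sub continuousAt_const).norm.eventually_lt continuousAt_const (by
        change ‖y₀ - y₀‖ < ε
        rw [sub_self, norm_zero]; exact hε)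
    filter_upwards [e1, e3, e4] with u h1 h2 h3 using ⟨h1, h2, h3⟩
  obtain ⟨r₁, hr₁, hball⟩ := Metric.eventually_nhds_iff.1 hev
  -- Rescaling an interval of length at most 2r multiplies the form by at most 2r, and C bounds the
  -- form; thus 2rC < ε puts the rescaled form in the range of the family. The bound r ≤ 1 - u₀
  -- keeps the right end inside [0,1].
  obtain ⟨r, hr, hrr₁, hrρ, hr1, hrε⟩ : ∃ r > 0, r < r₁ ∧ r < ρ ∧ r ≤ 1 - u₀ ∧ 2 * r * C < ε := by
    refine ⟨min (min (r₁ / 2) (ρ / 2)) (min (1 - u₀) (ε / (4 * C))), ?_, ?_, ?_, ?_, ?_⟩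
    · have : 0 < 1 - u₀ := by linarith
      positivity
    · exact ((min_le_left _ _).trans (min_le_left _ _)).trans_lt (by linarith)
    · exact ((min_le_left _ _).trans (min_le_right _ _)).trans_lt (by linarith)
    · exact (min_le_right _ _).trans (min_le_left _ _)
    · have h2 : min (min (r₁ / 2) (ρ / 2)) (min (1 - u₀) (ε / (4 * C))) ≤ ε / (4 * C) :=
        (min_le_right _ _).trans (min_le_right _ _)
      calc _ ≤ 2 * (ε / (4 * C)) * C := by gcongr
        _ = ε / 2 := by field_simp; norm_num
        _ < ε := by linarith
  set a : ℝ := max 0 (u₀ - r) with ha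
  set b : ℝ := u₀ + r with hb
  have ha0 : 0 ≤ a := le_max_left _ _
  have har : u₀ - r ≤ a := le_max_right _ _
  have hau : a ≤ u₀ := max_le h0 (by linarith)
  have hab : a < b := by linarith
  have hb1 : b ≤ 1 := by linarith
  have hnear : ∀ u ∈ Icc a b, |u - u₀| ≤ r := fun u hu =>
    abs_le.2 ⟨by linarith [hu.1], by linarith [hu.2]⟩
  have hprop : ∀ u ∈ Icc a b, _ := fun u hu =>
    hball (y := u) (by rw [Real.dist_eq]; exact (hnear u hu).trans_lt hrr₁)
  have hsrc : ∀ u ∈ Icc a b, (ext01 P.toMap u).proj ∈ (chartAt E c).source :=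
    fun u hu => (hprop u hu).1
  set g := P.coordPath c hab hsrc with hg
  have hgn : ‖g‖ < ε := by
    refine (ContinuousMap.norm_lt_iff _ hε).2 fun t => ?_
    rw [hg, Constraint.coordPath_apply, norm_smul, Real.norm_eq_abs, abs_of_pos (by linarith)]
    refine lt_of_le_of_lt ?_ hrε
    exact mul_le_mul (by linarith) (hprop _ (affine_mem_Icc hab t.2)).2.1.le (norm_nonneg _)
      (by linarith)
  -- With δ = -g the form g + sδ reaches zero at s = 1.
  obtain ⟨x, β, β₂, hF, hx0⟩ := hfam (extChartAt 𝓘(ℝ, E) c (ext01 P.toMap a).proj) g (-g)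
    (hprop a ⟨le_rfl, hab.le⟩).2.2 (by rwa [sub_zero]) (by rwa [norm_neg])
  have hF' := hF.comp_affine hab
  have hη : 0 < r / 4 := by positivity
  -- The plateau is laid on the untruncated interval around u₀, so κ = 1 near u₀ even when u₀ = 0; a
  -- nonzero value of κ at 0 is harmless because β vanishes there.
  obtain ⟨κ, hκ, hκI, hκ0, hκ1⟩ := exists_plateau (u₀ - r) (u₀ + r) hη
  obtain ⟨Q, hPQ, hQ0, hQ1⟩ := exists_gaugeRelated_moved P ha0 hab hb1 hF' hUo hUt hsrc
    (fun u hu => P.ext01_coordPath c hab hsrc hu) (by simp [hx0])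
    (continuous_smul_ext01 (-g) _ a b).continuousOn hκ hκI (hκ0 1 (Or.inr (by linarith))) (fun u hu => by
      by_cases hu' : u < u₀ - r + r / 4 ∨ u₀ + r - r / 4 < u
      · exact Or.inl (eventuallyEq_zero_of_plateau hκ0 hu')
      · push Not at hu'
        refine Or.inr ?_
        have h3 : Ioo (u₀ - r) b ∈ 𝓝 u := Ioo_mem_nhds (by linarith) (by linarith)
        filter_upwards [nhdsWithin_le_nhds h3, self_mem_nhdsWithin] with v hv hv1
        exact ⟨max_le hv1.1 hv.1.le, hv.2.le⟩)
  refine ⟨Q, hPQ, fun u hu => ?_, ?_⟩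
  · by_cases hu' : u ∈ Icc a b
    · refine Or.inr ⟨(hnear u hu').trans_lt hrρ, ?_⟩
      rw [hQ1 u hu', ofCoord_proj]
      exact (hF'.mem (κ u) ⟨by linarith [(hκI u).1], by linarith [(hκI u).2]⟩ u hu').2
    · exact Or.inl (hQ0 u hu (Or.inl hu'))
  · have h3 : Ioo (u₀ - r / 2) (u₀ + r / 2) ∈ 𝓝 u₀ := Ioo_mem_nhds (by linarith) (by linarith)
    filter_upwards [nhdsWithin_le_nhds h3, self_mem_nhdsWithin] with u hu hu1
    have hua : u ∈ Icc a b := ⟨max_le hu1.1 (by linarith [hu.1]), by linarith [hu.2]⟩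
    have e1 : κ =ᶠ[𝓝 u] fun _ => 1 := by
      filter_upwards [Ioo_mem_nhds hu.1 hu.2] with v hv
      exact hκ1 v ⟨by linarith [hv.1], by linarith [hv.2]⟩
    have e2 : deriv κ u = 0 := by rw [e1.deriv_eq]; simp
    have e3 : κ u = 1 := e1.self_of_nhds
    rw [hQ1 u hua, e2, e3]
    have e4 : ext01 (-g) ((u - a) / (b - a)) = -(ext01 g ((u - a) / (b - a))) := rfl
    rw [e4, zero_smul, one_smul, add_zero, smul_neg, add_neg_cancel]
    exact ofCoord_snd_zero _ _

/-- The construction needs room to the right of the point, since β starts from zero on the left; the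
point 1 is handled by reversing the solution. -/
theorem Constraint.exists_flat (P : Constraint α) {u₀ : ℝ} (h0 : u₀ ∈ Icc (0 : ℝ) 1)
    {V : Set M} (hV : IsOpen V) (hX : (ext01 P.toMap u₀).proj ∈ V) {ρ : ℝ} (hρ : 0 < ρ) :
    ∃ Q : Constraint α, PhaseSpace.mk Q = PhaseSpace.mk P ∧
      (∀ u ∈ Icc (0 : ℝ) 1, ext01 Q.toMap u = ext01 P.toMap u ∨
        (|u - u₀| < ρ ∧ (ext01 Q.toMap u).proj ∈ V)) ∧
      ∀ᶠ u in 𝓝[Icc 0 1] u₀, (ext01 Q.toMap u).2 = 0 := by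
  rcases h0.2.lt_or_eq with h1 | rfl
  · obtain ⟨Q, h2, h3, h4⟩ := P.exists_flat_of_lt h0.1 h1 hV hX hρ
    exact ⟨Q, (PhaseSpace.mk_eq_of_gaugeRelated h2).symm, h3, h4⟩
  · obtain ⟨Q, h2, h3, h4⟩ := P.reverse.exists_flat_of_lt le_rfl zero_lt_one hV (by
      rw [PhaseSpace.ext01_reverse P (by simp), scale_proj, sub_zero]; exact hX) hρ
    refine ⟨Q.reverse, ?_, fun u hu => ?_, ?_⟩
    · have := PhaseSpace.mk_reverse_congr (PhaseSpace.mk_eq_of_gaugeRelated h2)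
      rw [PhaseSpace.reverse_reverse] at this
      exact this.symm
    · have hu' := mapsTo_one_sub hu
      dsimp only at hu'
      rw [PhaseSpace.ext01_reverse Q hu]
      rcases h3 _ hu' with h5 | ⟨h5, h6⟩
      · left
        rw [h5, PhaseSpace.ext01_reverse P hu', scale_scale, sub_sub_cancel, neg_mul_neg, one_mul, scale_one]
      · right
        refine ⟨?_, h6⟩
        rwa [show 1 - u - 0 = -(u - 1) by ring, abs_neg] at h5
    · have h5 : Filter.Tendsto (fun u : ℝ => 1 - u) (𝓝[Icc 0 1] 1) (𝓝[Icc 0 1] 0) := by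
        refine tendsto_nhdsWithin_iff.2 ⟨?_, eventually_mem_nhdsWithin.mono fun u hu => mapsTo_one_sub hu⟩
        have : Continuous (fun u : ℝ => 1 - u) := by fun_prop
        simpa using (this.tendsto 1).mono_left nhdsWithin_le_nhds
      filter_upwards [h5.eventually h4, self_mem_nhdsWithin] with u hu hu1
      rw [PhaseSpace.ext01_reverse Q hu1]
      change (-1 : ℝ) • (ext01 Q.toMap (1 - u)).2 = 0
      rw [hu, smul_zero]

end Flattening

/-! ### Making a solution smooth on a piece mapped to one chart. -/

section Smoothing

variable {E : Type u} [NormedAddCommGroup E] [NormedSpace ℝ E]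

/-- Where g and δ both vanish, the equation for β reads β' = 0. This controls the extra term κ'β
near both ends of the interval. -/
theorem GaugeFamily.param_eq {A : E → (E →L[ℝ] ℝ) →L[ℝ] E} {U : Set E} {a b : ℝ}
    {g δ : ℝ → E →L[ℝ] ℝ} {x : ℝ → ℝ → E} {β β₂ : ℝ → ℝ → E →L[ℝ] ℝ}
    (h : GaugeFamily A U a b g δ x β β₂) {J : Set ℝ} (hJ : Convex ℝ J) (hJab : J ⊆ Icc a b)
    (h0 : ∀ u ∈ J, g u = 0 ∧ δ u = 0) {s : ℝ} (hs : s ∈ paramRange) {u v : ℝ} (hu : u ∈ J)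
    (hv : v ∈ J) : β s u = β s v := by
  have hd : ∀ w ∈ J, HasDerivWithinAt (β s) 0 J w := fun w hw => by
    have h1 := h.param_diag (fun _ => s) 0 w (hJab hw) hs (hasDerivWithinAt_const _ _ _)
    refine (h1.mono hJab).congr_deriv ?_
    rw [(h0 w hw).1, (h0 w hw).2]
    ext y
    simp [pairDeriv_apply]
  have h2 := hJ.norm_image_sub_le_of_norm_hasDerivWithin_le (C := 0) hd (by simp) hv hu
  rw [zero_mul] at h2
  exact sub_eq_zero.1 (norm_le_zero_iff.1 h2)

variable {M : Type*} [TopologicalSpace M] [ChartedSpace E M] [IsManifold 𝓘(ℝ, E) ∞ M]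
variable {α : PoissonStructure E M}

namespace Constraint

/-- The solution is smooth at the point `t` of the interval. -/
def SmoothAt (P : Constraint α) (t : ℝ) : Prop :=
  ContMDiffWithinAt 𝓘(ℝ, ℝ) (𝓘(ℝ, E).prod 𝓘(ℝ, E →L[ℝ] ℝ)) ∞ (ext01 P.toMap) (Icc 0 1) t

/-- The one-form vanishes near `t`. -/
def FlatAt (P : Constraint α) (t : ℝ) : Prop := ∀ᶠ v in 𝓝[Icc 0 1] t, (ext01 P.toMap v).2 = 0

theorem SmoothAt.congr {P Q : Constraint α} {t : ℝ} (h : P.SmoothAt t) (ht : t ∈ Icc (0 : ℝ) 1)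
    (he : ext01 Q.toMap =ᶠ[𝓝[Icc 0 1] t] ext01 P.toMap) : Q.SmoothAt t :=
  ContMDiffWithinAt.congr_of_eventuallyEq h he (he.self_of_nhdsWithin ht)

theorem FlatAt.congr {P Q : Constraint α} {t : ℝ} (h : P.FlatAt t)
    (he : ext01 Q.toMap =ᶠ[𝓝[Icc 0 1] t] ext01 P.toMap) : Q.FlatAt t := by
  filter_upwards [h, he] with v h1 h2
  rw [h2, h1]

theorem smoothAt_of_coord {P : Constraint α} {t : ℝ} {c : M}
    (hc : (ext01 P.toMap t).proj ∈ (chartAt E c).source)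
    (h1 : ContDiffWithinAt ℝ ∞ (fun τ => extChartAt 𝓘(ℝ, E) c (ext01 P.toMap τ).proj) (Icc 0 1) t)
    (h2 : ContDiffWithinAt ℝ ∞ (fun τ => coordCovector c (ext01 P.toMap τ)) (Icc 0 1) t) :
    P.SmoothAt t :=
  (contMDiffWithinAt_cotangent_iff c hc
    (continuous_proj_cotangent.comp P.continuous_ext01).continuousWithinAt).2 ⟨h1, h2⟩

/-- Where the form vanishes the constraint makes the base point locally constant, so both components
are constant in a chart. -/
theorem FlatAt.smoothAt {P : Constraint α} {t : ℝ} (h : P.FlatAt t) (ht : t ∈ Icc (0 : ℝ) 1) :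
    P.SmoothAt t := by
  set c : M := (ext01 P.toMap t).proj with hc
  have hcs : (ext01 P.toMap t).proj ∈ (chartAt E c).source := mem_chart_source _ _
  have hXc : Continuous (fun u => (ext01 P.toMap u).proj) :=
    continuous_proj_cotangent.comp P.continuous_ext01
  have e1 : ∀ᶠ u in 𝓝[Icc 0 1] t, (ext01 P.toMap u).proj ∈ (chartAt E c).source :=
    nhdsWithin_le_nhds (hXc.continuousAt ((chartAt E c).open_source.mem_nhds hcs))
  obtain ⟨r, hr, hb⟩ := Metric.mem_nhdsWithin_iff.1 (h.and e1)
  have hconv : Convex ℝ (Metric.ball t r ∩ Icc 0 1) := (convex_ball t r).inter (convex_Icc 0 1)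
  have hz : ∀ u ∈ Metric.ball t r ∩ Icc 0 1, coordCovector c (ext01 P.toMap u) = 0 := fun u hu =>
    coordCovector_of_snd_eq_zero _ (hb hu).1
  have hd : ∀ u ∈ Metric.ball t r ∩ Icc 0 1, HasDerivWithinAt
      (fun τ => extChartAt 𝓘(ℝ, E) c (ext01 P.toMap τ).proj) 0 (Metric.ball t r ∩ Icc 0 1) u :=
    fun u hu => by
      have h1 := P.isSolutionAt hu.2 (hb hu).2
      rw [IsSolutionAt, hz u hu, map_zero, neg_zero] at h1
      exact h1.mono inter_subset_right
  have hconst : ∀ u ∈ Metric.ball t r ∩ Icc 0 1, extChartAt 𝓘(ℝ, E) c (ext01 P.toMap u).proj =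
      extChartAt 𝓘(ℝ, E) c (ext01 P.toMap t).proj := fun u hu => by
    have h2 := hconv.norm_image_sub_le_of_norm_hasDerivWithin_le (C := 0) hd (by simp)
      ⟨Metric.mem_ball_self hr, ht⟩ hu
    rw [zero_mul] at h2
    exact sub_eq_zero.1 (norm_le_zero_iff.1 h2)
  have hmem : Metric.ball t r ∩ Icc 0 1 ∈ 𝓝[Icc 0 1] t :=
    Filter.inter_mem (nhdsWithin_le_nhds (Metric.ball_mem_nhds t hr)) self_mem_nhdsWithin
  refine smoothAt_of_coord hcs ?_ ?_
  · exact (contDiffWithinAt_const (c := extChartAt 𝓘(ℝ, E) c (ext01 P.toMap t).proj)).congr_of_eventuallyEq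
      (Filter.eventuallyEq_of_mem hmem hconst) rfl
  · exact (contDiffWithinAt_const (c := (0 : E →L[ℝ] ℝ))).congr_of_eventuallyEq
      (Filter.eventuallyEq_of_mem hmem hz) (hz t ⟨Metric.mem_ball_self hr, ht⟩)

/-- The coordinates of the base curve of `P` on `[a, b]`, transported to `[0, 1]`. -/
def basePath (P : Constraint α) (c : M) {a b : ℝ} (hab : a < b)
    (h : ∀ u ∈ Icc a b, (ext01 P.toMap u).proj ∈ (chartAt E c).source) : PathSpace E :=
  ⟨fun t => extChartAt 𝓘(ℝ, E) c (ext01 P.toMap (a + (b - a) * t)).proj, by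
    have h1 : ContinuousOn (fun u => extChartAt 𝓘(ℝ, E) c (ext01 P.toMap u).proj) (Icc a b) :=
      (continuousOn_extChartAt c).comp
        (continuous_proj_cotangent.comp P.continuous_ext01).continuousOn fun u hu => by
          rw [extChartAt_source]; exact h u hu
    exact h1.comp_continuous (f := fun t : I => a + (b - a) * (t : ℝ)) (by fun_prop)
      fun t => affine_mem_Icc hab t.2⟩

theorem hasDerivWithinAt_basePath (P : Constraint α) (c : M) {a b : ℝ} (ha : 0 ≤ a) (hab : a < b)
    (hb : b ≤ 1) (h : ∀ u ∈ Icc a b, (ext01 P.toMap u).proj ∈ (chartAt E c).source) {t : ℝ}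
    (ht : t ∈ Icc (0 : ℝ) 1) :
    HasDerivWithinAt (ext01 (P.basePath c hab h))
      (-(α.coord c (ext01 (P.basePath c hab h) t) (ext01 (P.coordPath c hab h) t))) (Icc 0 1) t := by
  have hsub : Icc a b ⊆ Icc (0 : ℝ) 1 := Icc_subset_Icc ha hb
  have e : ∀ v ∈ Icc (0 : ℝ) 1, ext01 (P.basePath c hab h) v =
      extChartAt 𝓘(ℝ, E) c (ext01 P.toMap (a + (b - a) * v)).proj := fun v hv => by
    rw [ext01, projIcc_of_mem _ hv]; rfl
  have e' : ext01 (P.coordPath c hab h) t =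
      (b - a) • coordCovector c (ext01 P.toMap (a + (b - a) * t)) := by
    rw [ext01, projIcc_of_mem _ ht]; rfl
  have hu := affine_mem_Icc hab ht
  have h1 : HasDerivWithinAt (fun τ => extChartAt 𝓘(ℝ, E) c (ext01 P.toMap τ).proj) _ (Icc 0 1)
    (a + (b - a) * t) := P.isSolutionAt (hsub hu) (h _ hu)
  have h2 : HasDerivWithinAt (fun t => a + (b - a) * t) (b - a) (Icc 0 1) t := by
    simpa using (((hasDerivAt_id t).const_mul (b - a)).const_add a).hasDerivWithinAt
  have h3 := HasDerivWithinAt.scomp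
    (h := fun t => a + (b - a) * t) t h1 h2
    fun v hv => hsub (affine_mem_Icc hab hv)
  rw [e t ht, e', map_smul, ← smul_neg]
  exact h3.congr e (e t ht)

variable [FiniteDimensional ℝ E] [T2Space M]

/-- A solution whose one-form vanishes near the end points of a subinterval mapped to a chart can
be made smooth on this subinterval by a gauge transformation supported in its interior. -/
theorem exists_smooth_piece (P : Constraint α) {c : M} {a b : ℝ} (ha : 0 ≤ a) (hab : a < b)
    (hb : b ≤ 1) (hsrc : ∀ u ∈ Icc a b, (ext01 P.toMap u).proj ∈ (chartAt E c).source)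
    (fa : P.FlatAt a) (fb : P.FlatAt b) : ∃ Q : Constraint α, GaugeRelated P Q ∧
      (∀ u ∈ Icc (0 : ℝ) 1, u ∉ Ioo a b → ext01 Q.toMap =ᶠ[𝓝[Icc 0 1] u] ext01 P.toMap) ∧
      (∀ u ∈ Icc a b, (ext01 Q.toMap u).proj ∈ (chartAt E c).source) ∧
      ∀ u ∈ Icc a b, Q.SmoothAt u := by
  have : CompleteSpace E := FiniteDimensional.complete ℝ E
  have hsub : Icc a b ⊆ Icc (0 : ℝ) 1 := Icc_subset_Icc ha hb
  have hA := isPoissonOn_coord α c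
  obtain ⟨ε, hε, hfam⟩ := exists_gaugeFamily hA (X := P.basePath c hab hsrc)
    (p := P.coordPath c hab hsrc)
    (fun t => extChartAt_mem_target (hsrc _ (affine_mem_Icc hab t.2)))
    fun t ht => P.hasDerivWithinAt_basePath c ha hab hb hsrc ht
  set g := P.coordPath c hab hsrc with hg
  have hG : UniformContinuous (ext01 g) :=
    (CompactSpace.uniformContinuous_of_continuous g.continuous).comp
      (LipschitzWith.projIcc zero_le_one).uniformContinuous
  obtain ⟨g₁, hg₁, hgg⟩ := hG.exists_contDiff_dist_le hε
  -- Nested margins: the form vanishes within 4η of the ends, μ vanishes within 3η and equals 1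
  -- beyond 4η, and κ vanishes within η and equals 1 beyond 2η. Thus κ varies only where g and δ
  -- both vanish.
  obtain ⟨η, hη, hflat⟩ : ∃ η > 0, ∀ u ∈ Icc a b, u ≤ a + 4 * η ∨ b - 4 * η ≤ u →
      coordCovector c (ext01 P.toMap u) = 0 := by
    obtain ⟨r, hr, h1⟩ := Metric.mem_nhdsWithin_iff.1 fa
    obtain ⟨r', hr', h2⟩ := Metric.mem_nhdsWithin_iff.1 fb
    refine ⟨min r r' / 8, by positivity, fun u hu hu' => coordCovector_of_snd_eq_zero _ ?_⟩
    have h3 := min_le_left r r'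
    have h4 := min_le_right r r'
    have h5 : 0 < min r r' := lt_min hr hr'
    rcases hu' with hu' | hu'
    · exact h1 ⟨by
        rw [Metric.mem_ball, Real.dist_eq, abs_lt]
        constructor <;> linarith [hu.1], hsub hu⟩
    · exact h2 ⟨by
        rw [Metric.mem_ball, Real.dist_eq, abs_lt]
        constructor <;> linarith [hu.2], hsub hu⟩
  obtain ⟨κ, hκ, hκI, hκ0, hκ1⟩ := exists_plateau a b hη
  obtain ⟨μ, hμ, hμI, hμ0, hμ1⟩ := exists_plateau (a + 2 * η) (b - 2 * η) hη
  -- At s = 1 the form becomes μ g₁, which is smooth; μ keeps it zero near the ends, and δ is small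
  -- because g vanishes wherever μ differs from 1.
  set δ : PathSpace (E →L[ℝ] ℝ) := ⟨fun t => μ (a + (b - a) * t) • g₁ t - g t, by
    have h1 := hμ.continuous
    have h2 := hg₁.continuous
    have h3 := g.continuous
    fun_prop⟩ with hδ
  have hδn : ‖δ‖ < ε := by
    refine (ContinuousMap.norm_lt_iff _ hε).2 fun t => ?_
    change ‖μ (a + (b - a) * t) • g₁ t - g t‖ < ε
    have h1 := hgg t
    have h2 : ext01 g (t : ℝ) = g t := by rw [ext01, projIcc_val]
    rw [h2, dist_eq_norm] at h1
    have hu := affine_mem_Icc hab t.2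
    by_cases h3 : a + (b - a) * (t : ℝ) ≤ a + 4 * η ∨ b - 4 * η ≤ a + (b - a) * (t : ℝ)
    · have h4 : g t = 0 := by
        rw [hg, coordPath_apply, hflat _ hu h3, smul_zero]
      rw [h4, sub_zero] at h1 ⊢
      rw [norm_smul, Real.norm_eq_abs, abs_of_nonneg (hμI _).1]
      exact (mul_le_of_le_one_left (norm_nonneg _) (hμI _).2).trans_lt h1
    · push Not at h3
      rw [hμ1 _ ⟨by linarith [h3.1], by linarith [h3.2]⟩, one_smul]
      exact h1
  obtain ⟨x, β, β₂, hF, hx0⟩ := hfam (P.basePath c hab hsrc 0) g δ (by simpa using hε)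
    (by simpa using hε) hδn
  have hF' := hF.comp_affine hab
  have hx0' : x 0 0 = extChartAt 𝓘(ℝ, E) c (ext01 P.toMap a).proj := by
    rw [hx0]
    change extChartAt 𝓘(ℝ, E) c (ext01 P.toMap (a + (b - a) * ((0 : I) : ℝ))).proj = _
    simp
  obtain ⟨Q, hPQ, hQ0, hQ1⟩ := exists_gaugeRelated_moved P ha hab hb hF' hA.isOpen subset_rfl hsrc
    (fun u hu => P.ext01_coordPath c hab hsrc hu) (by simpa using hx0')
    (continuous_smul_ext01 δ _ a b).continuousOn hκ hκI (hκ0 1 (Or.inr (by linarith))) (fun u hu => by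
      by_cases hu' : u < a + η ∨ b - η < u
      · exact Or.inl (eventuallyEq_zero_of_plateau hκ0 hu')
      · push Not at hu'
        exact Or.inr (nhdsWithin_le_nhds (Icc_mem_nhds (by linarith) (by linarith))))
  -- coordinates of the new solution
  have hgu : ∀ u ∈ Icc a b, (b - a)⁻¹ • ext01 g ((u - a) / (b - a)) =
      coordCovector c (ext01 P.toMap u) := fun u hu => P.ext01_coordPath c hab hsrc hu
  have hδu : ∀ u ∈ Icc a b, (b - a)⁻¹ • ext01 δ ((u - a) / (b - a)) =
      (b - a)⁻¹ • (μ u • g₁ ((u - a) / (b - a))) - coordCovector c (ext01 P.toMap u) := fun u hu => by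
    have h1 := div_mem_Icc hab hu
    have h2 : ext01 δ ((u - a) / (b - a)) =
        μ u • g₁ ((u - a) / (b - a)) - ext01 g ((u - a) / (b - a)) := by
      simp only [ext01, projIcc_of_mem _ h1]
      change μ (a + (b - a) * ((u - a) / (b - a))) • g₁ ((u - a) / (b - a)) - g ⟨_, h1⟩ = _
      rw [affine_div hab]
    rw [← hgu u hu, h2]
    exact smul_sub _ _ _
  have hzero : ∀ u ∈ Icc a b, u ≤ a + 3 * η ∨ b - 3 * η ≤ u →
      (b - a)⁻¹ • ext01 g ((u - a) / (b - a)) = 0 ∧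
      (b - a)⁻¹ • ext01 δ ((u - a) / (b - a)) = 0 := fun u hu hu' => by
    rw [hδu u hu, hgu u hu, hflat u hu (hu'.imp (fun h => by linarith) fun h => by linarith),
      hμ0 u (hu'.imp (fun h => by linarith) fun h => by linarith), zero_smul, smul_zero, sub_zero]
    exact ⟨rfl, rfl⟩
  have hκr : ∀ u, κ u ∈ paramRange := fun u =>
    ⟨by linarith [(hκI u).1], by linarith [(hκI u).2]⟩
  set p : ℝ → E →L[ℝ] ℝ := fun u => (b - a)⁻¹ • ext01 g ((u - a) / (b - a)) +
    κ u • (b - a)⁻¹ • ext01 δ ((u - a) / (b - a)) + deriv κ u • β (κ u) ((u - a) / (b - a)) with hp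
  have hsm : ContDiffOn ℝ ∞ p (Icc a b) := by
    intro u hu
    -- Near the left end g and δ vanish, and β keeps its initial value 0, so the new form is zero.
    by_cases h1 : u < a + 3 * η
    · refine (contDiffWithinAt_const (c := (0 : E →L[ℝ] ℝ))).congr_of_eventuallyEq_of_mem ?_ hu
      filter_upwards [self_mem_nhdsWithin, nhdsWithin_le_nhds (Iio_mem_nhds h1)] with v hv hv1
      have h2 := hF'.param_eq (J := Icc a v) (convex_Icc a v) (Icc_subset_Icc_right hv.2)
        (fun w hw => hzero w ⟨hw.1, hw.2.trans hv.2⟩ (Or.inl (hw.2.trans (le_of_lt hv1))))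
        (hκr v) (u := v) (v := a) ⟨hv.1, le_rfl⟩ ⟨le_rfl, hv.1⟩
      have h3 := hF'.param_init (κ v) (hκr v)
      have h4 := hzero v hv (Or.inl (le_of_lt hv1))
      simp only [hp]
      rw [h4.1, h4.2, h2, h3, smul_zero, smul_zero, add_zero, add_zero]
    -- Near the right end β is constant in u but need not vanish. It is replaced by β(s, b), whose
    -- smoothness in s makes κ'β(κ, b) smooth.
    by_cases h1' : b - 3 * η < u
    · have hc1 : ContDiff ℝ ∞ (deriv κ) := (contDiff_infty_iff_deriv.1 hκ).2
      have hc2 : ContDiffAt ℝ ∞ (fun r => β r ((b - a) / (b - a))) (κ u) :=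
        (hF'.contDiffOn_param b ⟨hab.le, le_rfl⟩).contDiffAt (isOpen_Ioo.mem_nhds (hκr u))
      have hc3 : ContDiffAt ℝ ∞ (fun v => deriv κ v • β (κ v) ((b - a) / (b - a))) u :=
        hc1.contDiffAt.smul (hc2.comp u hκ.contDiffAt)
      refine hc3.contDiffWithinAt.congr_of_eventuallyEq_of_mem ?_ hu
      filter_upwards [self_mem_nhdsWithin, nhdsWithin_le_nhds (Ioi_mem_nhds h1')] with v hv hv1
      have h2 := hF'.param_eq (J := Icc v b) (convex_Icc v b) (Icc_subset_Icc_left hv.1)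
        (fun w hw => hzero w ⟨hv.1.trans hw.1, hw.2⟩ (Or.inr ((le_of_lt hv1).trans hw.1)))
        (hκr v) (u := v) (v := b) ⟨le_rfl, hv.2⟩ ⟨hv.2, le_rfl⟩
      have h4 := hzero v hv (Or.inr (le_of_lt hv1))
      simp only [hp]
      rw [h4.1, h4.2, h2, smul_zero, add_zero, zero_add]
    -- In the middle κ is identically 1 and the form is μ g₁, up to the rescaling.
    · push Not at h1 h1'
      have hc₀ : ContDiff ℝ ∞ (fun v => g₁ ((v - a) / (b - a))) :=
        hg₁.comp (f := fun v => (v - a) / (b - a)) (by fun_prop)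
      have hc : ContDiff ℝ ∞ (fun v => (b - a)⁻¹ • (μ v • g₁ ((v - a) / (b - a)))) :=
        ContDiff.const_smul (f := fun v => μ v • g₁ ((v - a) / (b - a))) _ (hμ.smul hc₀)
      refine hc.contDiffWithinAt.congr_of_eventuallyEq_of_mem ?_ hu
      have hI : Ioo (a + 2 * η) (b - 2 * η) ∈ 𝓝 u := Ioo_mem_nhds (by linarith) (by linarith)
      filter_upwards [self_mem_nhdsWithin, nhdsWithin_le_nhds hI] with v hv hv1
      have e1 : κ =ᶠ[𝓝 v] fun _ => 1 := by
        filter_upwards [Ioo_mem_nhds hv1.1 hv1.2] with w hw using hκ1 w ⟨hw.1.le, hw.2.le⟩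
      have e2 : deriv κ v = 0 := by rw [e1.deriv_eq]; simp
      have e3 : κ v = 1 := e1.self_of_nhds
      simp only [hp]
      rw [e2, e3, zero_smul, add_zero, one_smul, hδu v hv, hgu v hv, add_sub_cancel]
  have hxU : ∀ u ∈ Icc a b, x (κ u) ((u - a) / (b - a)) ∈ (extChartAt 𝓘(ℝ, E) c).target :=
    fun u hu => hF'.mem (κ u) (hκr u) u hu
  have hxsm : ContDiffOn ℝ ∞ (fun u => x (κ u) ((u - a) / (b - a))) (Icc a b) := by
    -- The base curve solves an equation whose coefficients are smooth now that the form is, and so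
    -- gains smoothness of all orders.
    refine ODE.contDiffOn_enat_Icc_of_hasDerivWithinAt (n := ⊤)
      (f := fun t y => -(α.coord c y (p t))) (u := (extChartAt 𝓘(ℝ, E) c).target) ?_
      (fun u hu => ?_) hxU
    · have h1 : ContDiffOn ℝ ∞ (fun q : ℝ × E => α.coord c q.2)
          (Icc a b ×ˢ (extChartAt 𝓘(ℝ, E) c).target) :=
        (α.smooth c).comp contDiffOn_snd fun q hq => hq.2
      have h2 : ContDiffOn ℝ ∞ (fun q : ℝ × E => p q.1)
          (Icc a b ×ˢ (extChartAt 𝓘(ℝ, E) c).target) :=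
        hsm.comp contDiffOn_fst fun q hq => hq.1
      exact (h1.clm_apply h2).neg
    · exact hF'.base_diag κ (deriv κ u) u hu (hκr u)
        ((hκ.differentiable (by simp)) u).hasDerivAt.hasDerivWithinAt
  have hQP : ∀ u ∈ Icc (0 : ℝ) 1, u ∉ Ioo a b → ext01 Q.toMap =ᶠ[𝓝[Icc 0 1] u] ext01 P.toMap := by
    intro u hu hu'
    have h1 : κ =ᶠ[𝓝 u] 0 := by
      refine eventuallyEq_zero_of_plateau hκ0 ?_
      by_contra! h2
      exact hu' ⟨by linarith, by linarith⟩
    filter_upwards [self_mem_nhdsWithin, nhdsWithin_le_nhds (eventually_eventually_nhds.2 h1)] with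
      v hv hv1
    exact hQ0 v hv (Or.inr hv1)
  have hQs : ∀ u ∈ Icc a b, (ext01 Q.toMap u).proj ∈ (chartAt E c).source := fun u hu => by
    rw [hQ1 u hu, ofCoord_proj]
    exact symm_mem_source (hxU u hu)
  refine ⟨Q, hPQ, hQP, hQs, fun u hu => ?_⟩
  by_cases hu' : u ∈ Ioo a b
  · have hn : Icc a b ∈ 𝓝[Icc 0 1] u := nhdsWithin_le_nhds (Icc_mem_nhds hu'.1 hu'.2)
    refine smoothAt_of_coord (hQs u hu) ?_ ?_
    · refine ((hxsm u hu).congr_of_mem (fun v hv => ?_) hu).mono_of_mem_nhdsWithin hn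
      rw [hQ1 v hv, extChartAt_ofCoord (hxU v hv)]
    · refine ((hsm u hu).congr_of_mem (fun v hv => ?_) hu).mono_of_mem_nhdsWithin hn
      rw [hQ1 v hv, coordCovector_ofCoord (hxU v hv)]
  · have h1 := hQP u (hsub hu) hu'
    have h2 : u = a ∨ u = b := by
      by_contra! h3
      exact hu' ⟨lt_of_le_of_ne hu.1 h3.1.symm, lt_of_le_of_ne hu.2 h3.2⟩
    have h3 : P.FlatAt u := by rcases h2 with rfl | rfl <;> assumption
    exact (h3.smoothAt (hsub hu)).congr (hsub hu) h1

end Constraint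

end Smoothing

/-! ### Subdivision of the interval and passage from local to global. -/

section SmoothRepresentative

variable {E : Type u} [NormedAddCommGroup E] [NormedSpace ℝ E] [FiniteDimensional ℝ E]
variable {M : Type*} [TopologicalSpace M] [ChartedSpace E M] [IsManifold 𝓘(ℝ, E) ∞ M] [T2Space M]
variable {α : PoissonStructure E M}

namespace Constraint

/-- The pieces of the subdivision of the interval into `N` pieces are mapped to the charts centred
at the points `c j`. -/
def Subordinate (P : Constraint α) (N : ℕ) (c : ℕ → M) : Prop :=
  ∀ j < N, ∀ u ∈ Icc ((j : ℝ) / N) ((j + 1 : ℝ) / N), (ext01 P.toMap u).proj ∈ (chartAt E (c j)).source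

theorem exists_subordinate (P : Constraint α) : ∃ (N : ℕ) (c : ℕ → M), 0 < N ∧ P.Subordinate N c := by
  have hXc : Continuous (fun u => (ext01 P.toMap u).proj) :=
    continuous_proj_cotangent.comp P.continuous_ext01
  obtain ⟨δ, hδ, h⟩ := lebesgue_number_lemma_of_metric (isCompact_Icc (a := (0 : ℝ)) (b := 1))
    (c := fun m : M => (fun u => (ext01 P.toMap u).proj) ⁻¹' (chartAt E m).source)
    (fun m => (chartAt E m).open_source.preimage hXc)
    fun u _ => mem_iUnion.2 ⟨(ext01 P.toMap u).proj, mem_chart_source _ _⟩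
  obtain ⟨n, hn⟩ := exists_nat_one_div_lt hδ
  have hN : (0 : ℝ) < (n + 1 : ℕ) := by positivity
  have hc : ∀ j : ℕ, ∃ m : M, j < n + 1 → Metric.ball ((j : ℝ) / (n + 1 : ℕ)) δ ⊆
      (fun u => (ext01 P.toMap u).proj) ⁻¹' (chartAt E m).source := fun j => by
    by_cases hj : j < n + 1
    · obtain ⟨m, hm⟩ := h ((j : ℝ) / (n + 1 : ℕ)) ⟨by positivity, (div_le_one hN).2 (by
        exact_mod_cast hj.le)⟩
      exact ⟨m, fun _ => hm⟩
    · exact ⟨(ext01 P.toMap 0).proj, fun h => absurd h hj⟩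
  choose c hc using hc
  refine ⟨n + 1, c, n.succ_pos, fun j hj u hu => hc j hj ?_⟩
  rw [Metric.mem_ball, Real.dist_eq, abs_lt]
  have h1 : (j + 1 : ℝ) / (n + 1 : ℕ) = j / (n + 1 : ℕ) + 1 / (n + 1 : ℕ) := add_div _ _ _
  have h2 : (1 : ℝ) / (n + 1 : ℕ) < δ := by push_cast; exact hn
  exact ⟨by linarith [hu.1], by linarith [hu.2]⟩

theorem node_mem {N k : ℕ} (hN : 0 < N) (hk : k ≤ N) : (k : ℝ) / N ∈ Icc (0 : ℝ) 1 :=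
  ⟨by positivity, (div_le_one (by positivity)).2 (by exact_mod_cast hk)⟩

/-- Induction over the N + 1 nodes. Each modification is supported near one node, so it preserves
the flatness already obtained, and it keeps the base curve in the charts attached to the pieces. -/
theorem exists_flatAt_nodes (P : Constraint α) {N : ℕ} {c : ℕ → M} (hN : 0 < N)
    (hP : P.Subordinate N c) : ∀ k ≤ N + 1, ∃ Q : Constraint α,
      PhaseSpace.mk Q = PhaseSpace.mk P ∧ Q.Subordinate N c ∧ ∀ i < k, Q.FlatAt ((i : ℝ) / N) := by
  have hN' : (0 : ℝ) < N := by exact_mod_cast hN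
  intro k
  induction k with
  | zero => exact fun _ => ⟨P, rfl, hP, by simp⟩
  | succ k ih =>
    intro hk
    obtain ⟨Q, hQP, hQ, hQf⟩ := ih (by omega)
    -- The charts of the pieces that contain the node k/N; a modification near this node with values
    -- in V stays subordinate to all of them.
    set V : Set M := ⋂ j ∈ (Finset.range N).filter (fun j => j ≤ k ∧ k ≤ j + 1),
      (chartAt E (c j)).source with hV
    have hVo : IsOpen V := isOpen_biInter_finset fun j _ => (chartAt E (c j)).open_source
    have hXV : (ext01 Q.toMap ((k : ℝ) / N)).proj ∈ V := by
      refine mem_iInter₂.2 fun j hj => ?_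
      rw [Finset.mem_filter, Finset.mem_range] at hj
      refine hQ j hj.1 _ ⟨?_, ?_⟩ <;> gcongr
      · exact hj.2.1
      · exact_mod_cast hj.2.2
    -- Half of the mesh: the modified part then meets only the pieces adjacent to the node and stays
    -- at least half a mesh away from the other nodes.
    obtain ⟨R, hRQ, hR, hRf⟩ := Q.exists_flat (node_mem hN (by omega : k ≤ N)) hVo hXV
      (ρ := 1 / (2 * N)) (by positivity)
    refine ⟨R, hRQ.trans hQP, fun j hj u hu => ?_, fun i hi => ?_⟩
    · have huI : u ∈ Icc (0 : ℝ) 1 := ⟨(node_mem hN hj.le).1.trans hu.1, hu.2.trans (by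
        have := (node_mem hN (Nat.succ_le_of_lt hj)).2
        rwa [Nat.succ_eq_add_one, Nat.cast_add, Nat.cast_one] at this)⟩
      rcases hR u huI with h | ⟨h1, h2⟩
      · rw [h]
        exact hQ j hj u hu
      · refine mem_iInter₂.1 h2 j ?_
        rw [Finset.mem_filter, Finset.mem_range]
        rw [abs_lt] at h1
        have e1 : (1 : ℝ) / (2 * N) * N = 1 / 2 := by field_simp
        have e2 : (k : ℝ) / N * N = k := by field_simp
        have e3 : (j : ℝ) ≤ u * N := (div_le_iff₀ hN').1 hu.1
        have e4 : u * N ≤ j + 1 := (le_div_iff₀ hN').1 hu.2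
        have e5 := mul_lt_mul_of_pos_right h1.1 hN'
        have e6 := mul_lt_mul_of_pos_right h1.2 hN'
        rw [neg_mul, e1, sub_mul, e2] at e5
        rw [e1, sub_mul, e2] at e6
        have e7 : (j : ℝ) < k + 1 := by linarith
        have e8 : (k : ℝ) < j + 1 + 1 := by linarith
        refine ⟨hj, ?_, ?_⟩
        · exact Nat.lt_succ_iff.1 (by exact_mod_cast e7)
        · exact Nat.lt_succ_iff.1 (by exact_mod_cast e8)
    · rcases (Nat.lt_succ_iff.1 hi).lt_or_eq with hi | rfl
      · refine (hQf i hi).congr ?_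
        filter_upwards [self_mem_nhdsWithin, nhdsWithin_le_nhds (Metric.ball_mem_nhds ((i : ℝ) / N)
          (by positivity : (0 : ℝ) < 1 / (2 * N)))] with u hu hu1
        refine (hR u hu).resolve_right fun h => ?_
        rw [Metric.mem_ball, Real.dist_eq, abs_lt] at hu1
        have h1 := abs_lt.1 h.1
        have h2 : (i + 1 : ℝ) / N ≤ k / N := by
          gcongr
          exact_mod_cast hi
        rw [add_div] at h2
        have h3 : (1 : ℝ) / N = 1 / (2 * N) + 1 / (2 * N) := by field_simp; norm_num
        linarith [h1.1, hu1.2]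
      · exact hRf

/-- Induction over the pieces. Each modification keeps the germs at all points outside the open
piece, so flatness at the nodes and smoothness on the earlier pieces survive, and nothing has to be
matched at the nodes. -/
theorem exists_smoothAt_of_le (P : Constraint α) {N : ℕ} {c : ℕ → M} (hN : 0 < N)
    (hP : P.Subordinate N c) (hf : ∀ i ≤ N, P.FlatAt ((i : ℝ) / N)) : ∀ k ≤ N, ∃ Q : Constraint α,
      PhaseSpace.mk Q = PhaseSpace.mk P ∧ Q.Subordinate N c ∧ (∀ i ≤ N, Q.FlatAt ((i : ℝ) / N)) ∧
      ∀ u ∈ Icc (0 : ℝ) ((k : ℝ) / N), Q.SmoothAt u := by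
  have hN' : (0 : ℝ) < N := by exact_mod_cast hN
  intro k
  induction k with
  | zero =>
    refine fun _ => ⟨P, rfl, hP, hf, fun u hu => ?_⟩
    have h0 := hf 0 (Nat.zero_le _)
    rw [Nat.cast_zero, zero_div] at hu h0
    obtain rfl : u = 0 := le_antisymm hu.2 hu.1
    exact h0.smoothAt (by simp)
  | succ k ih =>
    intro hk
    obtain ⟨Q, hQP, hQ, hQf, hQs⟩ := ih (by omega)
    have hk1 : k < N := hk
    have f1 := hQf (k + 1) hk
    have m1 := node_mem hN hk
    rw [Nat.cast_add, Nat.cast_one] at f1 m1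
    have m0 := node_mem hN hk1.le
    obtain ⟨R, hQR, hR, hRs, hRsm⟩ := Q.exists_smooth_piece m0.1
      (by gcongr; linarith : (k : ℝ) / N < (k + 1 : ℝ) / N) m1.2 (hQ k hk1) (hQf k hk1.le) f1
    refine ⟨R, (PhaseSpace.mk_eq_of_gaugeRelated hQR).symm.trans hQP, fun j hj u hu => ?_,
      fun i hi => ?_, fun u hu => ?_⟩
    · have huI : u ∈ Icc (0 : ℝ) 1 := ⟨(node_mem hN hj.le).1.trans hu.1, hu.2.trans (by
        have := (node_mem hN (Nat.succ_le_of_lt hj)).2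
        rwa [Nat.succ_eq_add_one, Nat.cast_add, Nat.cast_one] at this)⟩
      by_cases hu' : u ∈ Ioo ((k : ℝ) / N) ((k + 1 : ℝ) / N)
      · have h1 : (k : ℝ) < j + 1 := (div_lt_div_iff_of_pos_right hN').1 (hu'.1.trans_le hu.2)
        have h2 : (j : ℝ) < k + 1 := (div_lt_div_iff_of_pos_right hN').1 (hu.1.trans_lt hu'.2)
        have h3 : k < j + 1 := by exact_mod_cast h1
        have h4 : j < k + 1 := by exact_mod_cast h2
        obtain rfl : j = k := by omega
        exact hRs u hu
      · rw [(hR u huI hu').self_of_nhdsWithin huI]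
        exact hQ j hj u hu
    · refine (hQf i hi).congr (hR _ (node_mem hN hi) fun h => ?_)
      have h1 : (k : ℝ) < i := (div_lt_div_iff_of_pos_right hN').1 h.1
      have h2 : (i : ℝ) < k + 1 := (div_lt_div_iff_of_pos_right hN').1 h.2
      have h3 : k < i := by exact_mod_cast h1
      have h4 : i < k + 1 := by exact_mod_cast h2
      omega
    · rw [Nat.cast_add, Nat.cast_one] at hu
      rcases le_or_gt ((k : ℝ) / N) u with h | h
      · exact hRsm u ⟨h, hu.2⟩
      · have huI : u ∈ Icc (0 : ℝ) 1 := ⟨hu.1, h.le.trans m0.2⟩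
        exact (hQs u ⟨hu.1, h.le⟩).congr huI (hR u huI fun h' => absurd h'.1 (not_lt.2 h.le))

end Constraint

/-- Every class has a smooth representative. -/
theorem exists_smooth_representative (P : Constraint α) : ∃ Q : Constraint α,
    Q.Smooth ∧ PhaseSpace.mk Q = PhaseSpace.mk P := by
  obtain ⟨N, c, hN, hP⟩ := P.exists_subordinate
  obtain ⟨Q, hQP, hQ, hQf⟩ := P.exists_flatAt_nodes hN hP (N + 1) le_rfl
  obtain ⟨R, hRQ, -, -, hR⟩ := Q.exists_smoothAt_of_le hN hQ (fun i hi => hQf i (by omega)) N le_rfl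
  refine ⟨R, fun u hu => hR u ?_, hRQ.trans hQP⟩
  rwa [div_self (by positivity)]

end SmoothRepresentative

end PoissonSigma

end

/-! ### The theorem assembled from smooth representatives and the groupoid laws. -/

theorem mainTheorem7
    {E : Type*} [NormedAddCommGroup E] [NormedSpace ℝ E] [FiniteDimensional ℝ E]
    {M : Type*} [TopologicalSpace M] [ChartedSpace E M] [IsManifold 𝓘(ℝ, E) ∞ M]
    [T2Space M] [ParacompactSpace M] (α : PoissonStructure E M) :
    (∀ P : Constraint α, ∃ Q : Constraint α,
      Q.Normalized ∧ PhaseSpace.mk Q = PhaseSpace.mk P) ∧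
    (∀ P : Constraint α, ∃ Q : Constraint α,
      Q.Smooth ∧ PhaseSpace.mk Q = PhaseSpace.mk P) ∧
    ∃ (l r : PhaseSpace α → M) (inv : PhaseSpace α → PhaseSpace α)
      (comp : ∀ g h : PhaseSpace α, r g = l h → PhaseSpace α),
      (∀ P : Constraint α, l (PhaseSpace.mk P) = P.left) ∧
      (∀ P : Constraint α, r (PhaseSpace.mk P) = P.right) ∧
      (∀ P : Constraint α, inv (PhaseSpace.mk P) = PhaseSpace.mk P.reverse) ∧
      (∀ (P Q : Constraint α) (hP : P.Normalized) (hQ : Q.Normalized)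
        (h : P.right = Q.left) (p : r (PhaseSpace.mk P) = l (PhaseSpace.mk Q)),
        comp (PhaseSpace.mk P) (PhaseSpace.mk Q) p = PhaseSpace.mk (P.concat Q hP hQ h)) ∧
      IsGroupoid (fun x => PhaseSpace.mk (Constraint.const α x)) l r inv comp := by
  have hsm := fun P : Constraint α => exists_smooth_representative P
  exact ⟨fun P => ⟨P.flat, P.flat_normalized, PhaseSpace.mk_flat hsm P⟩, hsm, PhaseSpace.left,
    PhaseSpace.right, PhaseSpace.inv, fun g h _ => PhaseSpace.comp g h, fun _ => rfl, fun _ => rfl,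
    fun _ => rfl, fun P Q hP hQ h _ => PhaseSpace.comp_mk_concat hsm P Q hP hQ h,
    PhaseSpace.isGroupoid hsm⟩
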